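/- Let $k$ be a field with separable closure $k^s$ and absolute Galois group $\Gamma=\mathrm{Gal}(k^s/k)$, let $d\ge 1$ be an integer invertible in $k$, put $\mathbf F=\mathbf Z/d\mathbf Z$, and let $n\ge 3$. Let $\mathcal M_{k,d}$ be the abelian category of finite discrete $\Gamma$-modules killed by $d$. Let $A,B\in\mathcal M_{k,d}$, assume that $A$ or $B$ is free as an $\mathbf F$-module, and let $e\in \mathrm{YExt}^n_{k,d}(A,B)$ be a Yoneda equivalence class of $n$-extensions $0\to B\to E_1\to\dots\to E_n\to A\to 0$ in $\mathcal M_{k,d}$. Then there is a sequence $(X_i)_{i\in\mathbf N}$ of smooth, geometrically integral $k$-varieties, with closed embeddings $X_i\to X_{i+1}$ over $k$ (a smooth geometrically integral ind-variety), which is a splitting family for $e$: for every field extension $l/k$ with $l$ infinite, the restriction of $e$ to $\mathrm{YExt}^n_{l,d}(A,B)$ vanishes if and only if $X_i(l)\neq\emptyset$ for some $i$. Moreover, $(X_i)$ can be chosen with the following description. There is an extension $\mathcal E$ representing $e$ (if $B$ is not free, replace $\mathcal E$ below by its Pontryagin dual $\mathrm{Hom}(\mathcal E,\mathbf F)$,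 and $A$, $B$ by $\mathrm{Hom}(B,\mathbf F)$, $\mathrm{Hom}(A,\mathbf F)$) such that $E_n$ is free over $\mathbf F$. Let $a$ and $b$ be ranks of $E_n$ and $B$ over $\mathbf F$. For $m\ge 0$ let $\mathcal E_{n-1}(a,b,m)$ be the exact sequence of $\mathbf F$-modules $0\to F_0\to F_1\to\dots\to F_n\to 0$ with $F_0=\mathbf F^b$, $F_1=\mathbf F^b\oplus\mathbf F^m$, $F_2=\dots=F_{n-2}=\mathbf F^m\oplus\mathbf F^m$, $F_{n-1}=\mathbf F^m\oplus\mathbf F^a$, $F_n=\mathbf F^a$, and maps $x\mapsto(x,0)$ on $F_0$, $(x,y)\mapsto(y,0)$ on $F_i$ for $1\le i\le n-2$, $(x,y)\mapsto y$ on $F_{n-1}$. An $\mathcal E$-diagram (of $\mathbf F$-modules) is an exact sequence $\mathcal F=(0\to F_0\to\dots\to F_n\to0)$ of finite $\mathbf F$-modules with a morphism of complexes $\phi:\mathcal E\to\mathcal F$ that identifies $B$ with $F_0$ and $E_n$ with $F_n$; it is injective if $\phi_0,\dots,\phi_n$ are injective. Then there are an integer $m_0$ and injective $\mathcal E$-diagrams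 $\mathcal D_m:\mathcal E\to\mathcal E_{n-1}(a,b,m)$, $m\ge m_0$, compatible with the natural inclusions $\mathcal E_{n-1}(a,b,m)\to\mathcal E_{n-1}(a,b,m+1)$, and cofinal (every injective $\mathcal E$-diagram maps to some $\mathcal D_m$ by a morphism that is the identity on $\mathcal E$), such that for each $m \geq m_0$ the homomorphism of finite groups of automorphisms of $\mathbf F$-module diagrams $\mathrm{Aut}(\mathcal D_m)\to\mathrm{Aut}(\mathcal E)$ is surjective and $X_{m-m_0}$ is a lifting variety for it and for the $\mathrm{Aut}(\mathcal E)$-torsor $P_{\mathcal E}$ over $k$ given by the action $\Gamma\to\mathrm{Aut}(\mathcal E)$. Here, for a homomorphism $\varphi:H\to G$ of finite groups and a $G$-torsor $P$ over $k$, a lifting triangle over a $k$-scheme $S$ is an $H$-torsor $Q\to S$ with an $H$-equivariant $S$-morphism $Q\to P\times_k S$. A geometrically integral $k$-variety $X$ is a lifting variety for $(\varphi,P)$ if it carries a lifting triangle $\mathcal T$ over $X$ such that, for every extension $l/k$ with $l$ infinite and every lifting triangle $t$ over $\mathrm{Spec}(l)$, the set of $x\in X(l)$ with $x^*\mathcal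 T\cong t$ is Zariski-dense in $X_l$. -/

import Mathlib

universe u

open CategoryTheory CategoryTheory.Limits AlgebraicGeometry

noncomputable section

namespace YonedaSplitting

/-! ## Finite modules and exact sequences -/

/-- A finite discrete `Γ`-module killed by `d`: a finite `ℤ/d`-module on which `Γ` acts by linear
automorphisms with open stabilizers. For `Γ` the absolute Galois group of `k`, these are the
objects of the category `M_{k,d}`. -/
structure GalMod (Γ : Type u) [Group Γ] [TopologicalSpace Γ] (d : ℕ) where
  V : Type
  [addCommGroup : AddCommGroup V]
  [module : Module (ZMod d) V]
  [finite : Finite V]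
  ρ : Γ →* (V ≃ₗ[ZMod d] V)
  isOpen_stabilizer : ∀ v : V, IsOpen {γ : Γ | ρ γ v = v}

attribute [instance] GalMod.addCommGroup GalMod.module GalMod.finite

/-- An exact sequence `0 → X 0 → X 1 → ⋯ → X N → 0` of finite `ℤ/d`-modules
(prolonged by zero modules `X i` for `i > N`, so that the map to `X N` is surjective by
exactness at `X N`). -/
structure ExactSeq (d N : ℕ) where
  X : ℕ → Type
  [addCommGroup : ∀ i, AddCommGroup (X i)]
  [module : ∀ i, Module (ZMod d) (X i)]
  [finite : ∀ i, Finite (X i)]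
  f : ∀ i, X i →ₗ[ZMod d] X (i + 1)
  injective_zero : Function.Injective (f 0)
  exact : ∀ i, Function.Exact (f i) (f (i + 1))
  subsingleton : ∀ i, N < i → Subsingleton (X i)

attribute [instance] ExactSeq.addCommGroup ExactSeq.module ExactSeq.finite

/-- The group `Aut(E)` of automorphisms of an exact sequence of `ℤ/d`-modules. -/
def ExactSeq.Aut {d N : ℕ} (E : ExactSeq d N) : Subgroup (∀ i, E.X i ≃ₗ[ZMod d] E.X i) where
  carrier := {α | ∀ i x, E.f i (α i x) = α (i + 1) (E.f i x)}
  one_mem' := fun _ _ => rfl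
  mul_mem' := fun {α β} hα hβ i x => by
    have h1 := hα i (β i x)
    have h2 := hβ i x
    simp only [Pi.mul_apply, LinearEquiv.mul_apply]
    rw [h1, h2]
  inv_mem' := fun {α} hα i x => by
    apply (α (i + 1)).injective
    have h1 := hα i ((α⁻¹) i x)
    rw [← h1]
    change E.f i (α i ((α i).symm x)) = α (i + 1) ((α (i + 1)).symm (E.f i x))
    simp

/-- An exact sequence `0 → X 0 → ⋯ → X N → 0` of finite discrete `Γ`-modules killed by `d`. -/
structure GalExactSeq (Γ : Type u) [Group Γ] [TopologicalSpace Γ] (d N : ℕ) extends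
    ExactSeq d N where
  ρ : ∀ i, Γ →* (X i ≃ₗ[ZMod d] X i)
  isOpen_stabilizer : ∀ i (x : X i), IsOpen {γ : Γ | ρ i γ x = x}
  equivariant : ∀ i γ x, f i (ρ i γ x) = ρ (i + 1) γ (f i x)

section Yoneda

variable {Γ : Type u} [Group Γ] [TopologicalSpace Γ] {d N : ℕ}

/-- The homomorphism `Γ → Aut(E)` given by the action of `Γ`. -/
def GalExactSeq.toAut (E : GalExactSeq Γ d N) : Γ →* E.toExactSeq.Aut :=
  (MonoidHom.pi E.ρ).codRestrict E.toExactSeq.Aut fun γ i x => E.equivariant i γ x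

/-- A Yoneda `n`-extension `0 → B → E_1 → ⋯ → E_n → A → 0` (for `n ≥ 1`). The terms are
`X 0 ≃ B`, `X i = E_i` for `1 ≤ i ≤ n`, and `X (n + 1) ≃ A`. -/
structure YExtension (n : ℕ) (A B : GalMod Γ d) extends GalExactSeq Γ d (n + 1) where
  left : B.V ≃ₗ[ZMod d] X 0
  left_equivariant : ∀ γ b, left (B.ρ γ b) = ρ 0 γ (left b)
  right : X (n + 1) ≃ₗ[ZMod d] A.V
  right_equivariant : ∀ γ x, right (ρ (n + 1) γ x) = A.ρ γ (right x)

/-- There is a morphism of `n`-extensions `E → E'`, that is, an equivariant morphism of complexes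
inducing the identity on `A` and `B`. -/
def YExtension.Rel {n : ℕ} {A B : GalMod Γ d} (E E' : YExtension n A B) : Prop :=
  ∃ φ : ∀ i, E.X i →ₗ[ZMod d] E'.X i,
    (∀ i γ x, φ i (E.ρ i γ x) = E'.ρ i γ (φ i x)) ∧
    (∀ i x, φ (i + 1) (E.f i x) = E'.f i (φ i x)) ∧
    (∀ b, φ 0 (E.left b) = E'.left b) ∧
    (∀ x, E'.right (φ (n + 1) x) = E.right x)

/-- `YExt^n(A, B)`: Yoneda equivalence classes of `n`-extensions, for the equivalence relation
generated by the existence of a morphism. -/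
def YExt (n : ℕ) (A B : GalMod Γ d) : Type (max 1 u) :=
  Quot (YExtension.Rel (n := n) (A := A) (B := B))

/-- The class of an extension. -/
def YExtension.cls {n : ℕ} {A B : GalMod Γ d} (E : YExtension n A B) : YExt n A B :=
  Quot.mk _ E

/-- `E` is (up to isomorphism) the trivial `n`-extension `0 → B = B → 0 → ⋯ → 0 → A = A → 0`
(for `n ≥ 2`). -/
def YExtension.IsTrivial {n : ℕ} {A B : GalMod Γ d} (E : YExtension n A B) : Prop :=
  Function.Bijective (E.f 0) ∧ (∀ i, 2 ≤ i → i < n → Subsingleton (E.X i)) ∧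
    Function.Bijective (E.f n)

/-- A class in `YExt^n(A, B)`, for `n ≥ 2`, vanishes if it is the class of the trivial
extension, the neutral element of the group `YExt^n(A, B)`. -/
def YExt.IsZero {n : ℕ} {A B : GalMod Γ d} (e : YExt n A B) : Prop :=
  ∃ T : YExtension n A B, T.IsTrivial ∧ T.cls = e

/-! ## Restriction along a continuous homomorphism -/

variable {Γ' : Type u} [Group Γ'] [TopologicalSpace Γ']

/-- Restriction of the action along a continuous group homomorphism. -/
def GalMod.res (r : Γ' →ₜ* Γ) (A : GalMod Γ d) : GalMod Γ' d where
  V := A.V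
  ρ := A.ρ.comp r.toMonoidHom
  isOpen_stabilizer := fun v => (A.isOpen_stabilizer v).preimage r.continuous_toFun

/-- Restriction of the action on an exact sequence. -/
def GalExactSeq.res (r : Γ' →ₜ* Γ) (E : GalExactSeq Γ d N) : GalExactSeq Γ' d N where
  toExactSeq := E.toExactSeq
  ρ := fun i => (E.ρ i).comp r.toMonoidHom
  isOpen_stabilizer := fun i v => (E.isOpen_stabilizer i v).preimage r.continuous_toFun
  equivariant := fun i γ x => E.equivariant i (r γ) x

/-- Restriction of the action on an extension. -/
def YExtension.res (r : Γ' →ₜ* Γ) {n : ℕ} {A B : GalMod Γ d} (E : YExtension n A B) :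
    YExtension n (A.res r) (B.res r) where
  toGalExactSeq := E.toGalExactSeq.res r
  left := E.left
  left_equivariant := fun γ b => E.left_equivariant (r γ) b
  right := E.right
  right_equivariant := fun γ x => E.right_equivariant (r γ) x

/-- The restriction map on classes of extensions. -/
def YExt.res (r : Γ' →ₜ* Γ) {n : ℕ} {A B : GalMod Γ d} (e : YExt n A B) :
    YExt n (A.res r) (B.res r) :=
  Quot.map (fun E => E.res r)
    (fun _ _ ⟨φ, h1, h2, h3, h4⟩ => ⟨φ, fun i γ x => h1 i (r γ) x, h2, h3, h4⟩) e

/-- `E'` is the Pontryagin dual `Hom(E, ℤ/d)` of `E`: the term `E'.X j` is identified with the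
dual of `E.X i`, for `i + j = N`, through invariant perfect pairings for which the
differentials are adjoint to each other. -/
def GalExactSeq.IsPontryaginDual (E E' : GalExactSeq Γ d N) : Prop :=
  ∃ P : ∀ i j, E.X i →ₗ[ZMod d] E'.X j →ₗ[ZMod d] ZMod d,
    (∀ i j, i + j = N → Function.Bijective (fun y : E'.X j => (P i j).flip y)) ∧
    (∀ i j, i + j = N → ∀ γ x y, P i j (E.ρ i γ x) (E'.ρ j γ y) = P i j x y) ∧
    (∀ i j, i + 1 + j = N → ∀ x y, P (i + 1) j (E.f i x) y = P i (j + 1) x (E'.f j y))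

end Yoneda

/-! ## Diagrams -/

section Diagrams

variable {d n : ℕ}

/-- A morphism of complexes `φ : E → F` from `0 → E_0 → ⋯ → E_{n+1} → 0` to
`0 → F_0 → ⋯ → F_n → 0` which identifies `E_0` with `F_0` and `E_n` with `F_n`.
If `E` is an `n`-extension of `A` by `B`, then `F` is, through these identifications, an
`(n-1)`-extension of `E_n` by `B`, and `(F, φ)` is an `E`-diagram. -/
structure Diagram (E : ExactSeq d (n + 1)) (F : ExactSeq d n) where
  φ : ∀ i, E.X i →ₗ[ZMod d] F.X i
  comm : ∀ i x, φ (i + 1) (E.f i x) = F.f i (φ i x)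
  bijective_zero : Function.Bijective (φ 0)
  bijective_last : Function.Bijective (φ n)

/-- The diagram is injective: `φ_0, …, φ_n` are monomorphisms. -/
def Diagram.IsInjective {E : ExactSeq d (n + 1)} {F : ExactSeq d n} (D : Diagram E F) : Prop :=
  ∀ i, i ≤ n → Function.Injective (D.φ i)

/-- The group `Aut(D)` of automorphisms of an `E`-diagram `D = (F, φ)`: pairs of automorphisms of
`E` and of `F` compatible with `φ`. -/
def Diagram.Aut {E : ExactSeq d (n + 1)} {F : ExactSeq d n} (D : Diagram E F) :
    Subgroup (E.Aut × F.Aut) where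
  carrier := {p | ∀ i x, D.φ i (p.1.1 i x) = p.2.1 i (D.φ i x)}
  one_mem' := fun _ _ => rfl
  mul_mem' := fun {p q} hp hq i x => by
    have h1 := hp i (q.1.1 i x)
    have h2 := hq i x
    change D.φ i (p.1.1 i (q.1.1 i x)) = p.2.1 i (q.2.1 i (D.φ i x))
    rw [h1, h2]
  inv_mem' := fun {p} hp i x => by
    apply (p.2.1 i).injective
    have h1 := hp i ((p.1.1 i).symm x)
    change p.2.1 i (D.φ i ((p.1.1 i).symm x)) = p.2.1 i ((p.2.1 i).symm (D.φ i x))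
    rw [← h1]
    simp

/-- The natural homomorphism `Aut(D) → Aut(E)`. -/
def Diagram.autHom {E : ExactSeq d (n + 1)} {F : ExactSeq d n} (D : Diagram E F) :
    D.Aut →* E.Aut :=
  (MonoidHom.fst E.Aut F.Aut).comp D.Aut.subtype

/-- A morphism of `E`-diagrams over the identity of `E`. -/
def Diagram.HasHom {E : ExactSeq d (n + 1)} {F F' : ExactSeq d n} (D : Diagram E F)
    (D' : Diagram E F') : Prop :=
  ∃ ψ : ∀ i, F.X i →ₗ[ZMod d] F'.X i,
    (∀ i x, ψ (i + 1) (F.f i x) = F'.f i (ψ i x)) ∧ ∀ i x, ψ i (D.φ i x) = D'.φ i x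

/-- The ranks `0, b, m, …, m, a, 0, …` (where `a` is in position `n`) of the free modules of
cycles of the standard free extension. -/
def stdRank (n a b m i : ℕ) : ℕ :=
  if i = 0 then 0 else if i = 1 then b else if i < n then m else if i = n then a else 0

/-- The standard free `(n-1)`-extension `0 → F_0 → F_1 → ⋯ → F_n → 0` (for `n ≥ 3`), where, with
`𝔽 = ℤ/d`, `F_0 = 𝔽^b`, `F_1 = 𝔽^b ⊕ 𝔽^m`, `F_2 = ⋯ = F_{n-2} = 𝔽^m ⊕ 𝔽^m`,
`F_{n-1} = 𝔽^m ⊕ 𝔽^a`, `F_n = 𝔽^a`, with the maps `(x, y) ↦ (y, 0)`.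
Here `F_0` is written `0 ⊕ 𝔽^b`, and `F_n` is written `𝔽^a ⊕ 0`. -/
def std (d n a b m : ℕ) [NeZero d] (hn : 2 ≤ n) : ExactSeq d n where
  X := fun i => (Fin (stdRank n a b m i) → ZMod d) × (Fin (stdRank n a b m (i + 1)) → ZMod d)
  f := fun _ => (LinearMap.inl (ZMod d) _ _).comp (LinearMap.snd (ZMod d) _ _)
  injective_zero := by
    rintro ⟨x, y⟩ ⟨x', y'⟩ h
    have h0 : IsEmpty (Fin (stdRank n a b m 0)) := by
      have : stdRank n a b m 0 = 0 := by simp [stdRank]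
      rw [this]; infer_instance
    simp only [LinearMap.comp_apply, LinearMap.snd_apply, LinearMap.inl_apply, Prod.mk.injEq] at h
    exact Prod.ext (Subsingleton.elim _ _) h.1
  exact := by
    rintro i ⟨x, y⟩
    simp only [LinearMap.comp_apply, LinearMap.snd_apply, LinearMap.inl_apply, Set.mem_range,
      Prod.exists, Prod.mk.injEq]
    constructor
    · intro h
      exact ⟨0, x, rfl, (congrArg Prod.fst h).symm⟩
    · rintro ⟨_, _, _, rfl⟩
      rfl
  subsingleton := by
    intro i hi
    have h0 : IsEmpty (Fin (stdRank n a b m i)) := by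
      have : stdRank n a b m i = 0 := by unfold stdRank; split_ifs <;> omega
      rw [this]; infer_instance
    have h1 : IsEmpty (Fin (stdRank n a b m (i + 1))) := by
      have : stdRank n a b m (i + 1) = 0 := by unfold stdRank; split_ifs <;> omega
      rw [this]; infer_instance
    infer_instance

/-- Extension by zero `𝔽^r → 𝔽^s` (for `r ≤ s`: the inclusion of the first `r` coordinates). -/
def extendZero (d r s : ℕ) : (Fin r → ZMod d) →ₗ[ZMod d] (Fin s → ZMod d) where
  toFun := fun x j => if h : j.1 < r then x ⟨j.1, h⟩ else 0
  map_add' := fun x y => by ext j; by_cases h : j.1 < r <;> simp [h]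
  map_smul' := fun c x => by ext j; by_cases h : j.1 < r <;> simp [h]

/-- The natural injective map from the standard extension of parameter `m` to the one of
parameter `m + 1`. -/
def stdIncl (d n a b m : ℕ) [NeZero d] (hn : 2 ≤ n) (i : ℕ) :
    (std d n a b m hn).X i →ₗ[ZMod d] (std d n a b (m + 1) hn).X i :=
  LinearMap.prodMap (extendZero d _ _) (extendZero d _ _)

end Diagrams

/-! ## Torsors under finite groups, lifting triangles, lifting varieties -/

section Torsors

/-- A scheme over `S` with a left action of the (constant) group `G`. -/
structure GScheme (G : Type) [Group G] (S : Scheme.{u}) where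
  T : Scheme.{u}
  π : T ⟶ S
  act : G →* End T
  act_π : ∀ g, (act g : T ⟶ T) ≫ π = π

/-- The `G`-scheme `T` over `S` is a `G_S`-torsor for the fppf topology: it is faithfully flat and
locally of finite presentation over `S`, and `G × T → T ×_S T`, `(g, t) ↦ (t, g t)`, is an
isomorphism. -/
structure GScheme.IsTorsor {G : Type} [Group G] [Finite G] {S : Scheme.{u}} (Q : GScheme G S) :
    Prop where
  flat : Flat Q.π
  surjective : Surjective Q.π
  locallyOfFinitePresentation : LocallyOfFinitePresentation Q.π
  isIso : IsIso (Sigma.desc fun g : G =>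
    pullback.lift (f := Q.π) (g := Q.π) (𝟙 Q.T) (Q.act g : Q.T ⟶ Q.T) (by simp [Q.act_π g]))

/-- A lifting triangle over the base `s : S → S₀`, relative to `φ : H → G` and to the `G`-scheme `P`
over `S₀`: an `H`-torsor `Q` over `S` and an `H`-equivariant morphism `Q → P ×_{S₀} S` over `S`.
The latter is given by its composite `Q → P` with the projection, a morphism over `S₀`. -/
structure LiftingTriangle {H G : Type} [Group H] [Finite H] [Group G] (φ : H →* G)
    {S₀ : Scheme.{u}} (P : GScheme G S₀) {S : Scheme.{u}} (s : S ⟶ S₀) where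
  Q : GScheme H S
  isTorsor : Q.IsTorsor
  F : Q.T ⟶ P.T
  F_over : F ≫ P.π = Q.π ≫ s
  F_equivariant : ∀ h, (Q.act h : Q.T ⟶ Q.T) ≫ F = F ≫ (P.act (φ h) : P.T ⟶ P.T)

/-- The lifting triangle `t` over `S'` is isomorphic to the pullback `x^* T` of `T` along
`x : S' → S`: there is an `H`-equivariant morphism from the torsor of `t` to the torsor of `T`,
compatible with the morphisms to `P`, that makes a cartesian square over `x`. -/
def LiftingTriangle.IsIsoPullback {H G : Type} [Group H] [Finite H] [Group G] {φ : H →* G}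
    {S₀ : Scheme.{u}} {P : GScheme G S₀} {S S' : Scheme.{u}} {s : S ⟶ S₀} {s' : S' ⟶ S₀}
    (t : LiftingTriangle φ P s') (x : S' ⟶ S) (T : LiftingTriangle φ P s) : Prop :=
  ∃ v : t.Q.T ⟶ T.Q.T, IsPullback v t.Q.π T.Q.π x ∧
    (∀ h, (t.Q.act h : t.Q.T ⟶ t.Q.T) ≫ v = v ≫ (T.Q.act h : T.Q.T ⟶ T.Q.T)) ∧ v ≫ T.F = t.F

variable {k : Type u} [Field k]

/-- `Spec l → Spec k`. -/
abbrev specExt (k l : Type u) [Field k] [Field l] [Algebra k l] :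
    Spec (.of l) ⟶ Spec (.of k) :=
  Spec.map (CommRingCat.ofHom (algebraMap k l))

/-- The set `X(l)` of `l`-points of a `k`-scheme `X`. -/
abbrev Points (X : Over (Spec (.of k))) (l : Type u) [Field l] [Algebra k l] : Type u :=
  {x : Spec (.of l) ⟶ X.left // x ≫ X.hom = specExt k l}

/-- The section `Spec l → X_l` given by an `l`-point of `X`. -/
def Points.section {X : Over (Spec (.of k))} {l : Type u} [Field l] [Algebra k l]
    (x : Points X l) : Spec (.of l) ⟶ pullback X.hom (specExt k l) :=
  pullback.lift x.1 (𝟙 _) (by simp [x.2])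

/-- A `k`-variety: a separated `k`-scheme of finite type. -/
structure IsVariety (X : Over (Spec (.of k))) : Prop where
  isSeparated : IsSeparated X.hom
  locallyOfFiniteType : LocallyOfFiniteType X.hom
  quasiCompact : QuasiCompact X.hom

/-- `X` is a lifting variety for `(φ, P)`: it is a geometrically integral variety with a lifting
triangle `T` over `X` such that, for every extension `l/k` with `l` infinite and every lifting
triangle `t` over `Spec l`, the set of `x ∈ X(l)` with `x^* T` isomorphic to `t` is Zariski-dense
(in `X_l`, hence in `X`). -/
structure IsLiftingVariety {H G : Type} [Group H] [Finite H] [Group G] (φ : H →* G)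
    (P : GScheme G (Spec (.of k))) (X : Over (Spec (.of k))) : Prop where
  isVariety : IsVariety X
  geometricallyIntegral : GeometricallyIntegral X.hom
  dense : ∃ T : LiftingTriangle φ P X.hom,
    ∀ (l : Type u) [Field l] [Algebra k l] [Infinite l] (t : LiftingTriangle φ P (specExt k l)),
      Dense {z : ↥(pullback X.hom (specExt k l)) |
        ∃ x : Points X l, t.IsIsoPullback x.1 T ∧ z ∈ Set.range x.section}

end Torsors

/-! ## Galois groups -/

/-- The absolute Galois group of `k`, with its Krull topology. -/
abbrev Gal (k : Type u) [Field k] : Type u := SeparableClosure k ≃ₐ[k] SeparableClosure k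

section Galois

variable {k l : Type u} [Field k] [Field l] [Algebra k l]

/-- The restriction homomorphism `Γ_l → Γ_k` of absolute Galois groups, for an embedding `ι` of the
separable closure of `k` into that of `l`. -/
def galResHom (ι : SeparableClosure k →ₐ[k] SeparableClosure l) : Gal l →* Gal k :=
  letI : Algebra (SeparableClosure k) (SeparableClosure l) := ι.toRingHom.toAlgebra
  haveI : IsScalarTower k (SeparableClosure k) (SeparableClosure l) :=
    IsScalarTower.of_algebraMap_eq fun x => (ι.commutes x).symm
  (AlgEquiv.restrictNormalHom (F := k) (K₁ := SeparableClosure l) (SeparableClosure k)).comp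
    (AlgEquiv.restrictScalarsHom k)

theorem galResHom_apply (ι : SeparableClosure k →ₐ[k] SeparableClosure l) (σ : Gal l)
    (x : SeparableClosure k) : ι (galResHom ι σ x) = σ (ι x) := by
  let : Algebra (SeparableClosure k) (SeparableClosure l) := ι.toRingHom.toAlgebra
  have : IsScalarTower k (SeparableClosure k) (SeparableClosure l) :=
    IsScalarTower.of_algebraMap_eq fun x => (ι.commutes x).symm
  exact AlgEquiv.restrictNormal_commutes (AlgEquiv.restrictScalars k σ) (SeparableClosure k) x

theorem continuous_galResHom (ι : SeparableClosure k →ₐ[k] SeparableClosure l) :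
    Continuous (galResHom ι) := by
  apply continuous_of_continuousAt_one
  intro U hU
  rw [map_one] at hU
  obtain ⟨L, hL, hLU⟩ := (krullTopology_mem_nhds_one_iff k (SeparableClosure k) U).1 hU
  let b := Module.finBasis k L
  have hopen : ∀ j, IsOpen {σ : Gal l | σ (ι (b j)) = ι (b j)} := fun j =>
    stabilizer_isOpen_of_isIntegral (K := l) (ι (b j : SeparableClosure k))
  have hmem : (⋂ j, {σ : Gal l | σ (ι (b j)) = ι (b j)}) ∈ nhds (1 : Gal l) :=
    (isOpen_iInter_of_finite hopen).mem_nhds (by simp)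
  rw [Filter.mem_map]
  refine Filter.mem_of_superset hmem fun σ hσ => hLU ?_
  rw [SetLike.mem_coe, IntermediateField.mem_fixingSubgroup_iff]
  intro x hx
  have key : ((galResHom ι σ : Gal k).toAlgHom.toLinearMap.comp L.val.toLinearMap) =
      L.val.toLinearMap := by
    apply b.ext
    intro j
    apply ι.injective
    have := Set.mem_iInter.1 hσ j
    simpa [galResHom_apply] using this
  exact LinearMap.congr_fun key ⟨x, hx⟩

/-- The restriction homomorphism as a continuous homomorphism. -/
def galRes (ι : SeparableClosure k →ₐ[k] SeparableClosure l) : Gal l →ₜ* Gal k where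
  toMonoidHom := galResHom ι
  continuous_toFun := continuous_galResHom ι

/-- The `k`-algebra of functions `h : G → k^s` that are `Γ`-equivariant for the action
of `Γ` on `G` by left translations through `p : Γ → G`. -/
def torsorAlgebra {G : Type} [Group G] (p : Gal k →* G) :
    Subalgebra k (G → SeparableClosure k) where
  carrier := {h | ∀ σ g, h (p σ * g) = σ (h g)}
  mul_mem' := fun {a b} ha hb σ g => by simp [ha σ g, hb σ g]
  add_mem' := fun {a b} ha hb σ g => by simp [ha σ g, hb σ g]
  algebraMap_mem' := fun c σ g => by simp

/-- Translation by `a ∈ G` on the algebra of equivariant functions: `h ↦ (g ↦ h (g a⁻¹))`. -/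
def torsorAlgebra.trans {G : Type} [Group G] (p : Gal k →* G) (a : G) :
    torsorAlgebra p →+* torsorAlgebra p where
  toFun := fun h => ⟨fun g => h.1 (g * a⁻¹), fun σ g => by
    change h.1 (p σ * g * a⁻¹) = _
    rw [mul_assoc]; exact h.2 σ _⟩
  map_one' := rfl
  map_mul' := fun _ _ => rfl
  map_zero' := rfl
  map_add' := fun _ _ => rfl

/-- The torsor over `Spec k` under the finite group `G` that corresponds to the continuous
homomorphism `p : Γ → G`. Its set of `k^s`-points is `G`, where `Γ` acts by left translations
through `p`, and where `a ∈ G` acts by `g ↦ g a⁻¹`. -/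
def torsorOfHom {G : Type} [Group G] (p : Gal k →* G) : GScheme G (Spec (.of k)) where
  T := Spec (.of (torsorAlgebra p))
  π := Spec.map (CommRingCat.ofHom (algebraMap k (torsorAlgebra p)))
  act :=
    { toFun := fun a => Spec.map (CommRingCat.ofHom (torsorAlgebra.trans p a))
      map_one' := by
        have h : torsorAlgebra.trans p 1 = RingHom.id _ := by
          ext h g; simp [torsorAlgebra.trans]
        rw [h]; exact Spec.map_id _
      map_mul' := fun a b => by
        have h : torsorAlgebra.trans p (a * b) =
            (torsorAlgebra.trans p b).comp (torsorAlgebra.trans p a) := by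
          ext h g; simp [torsorAlgebra.trans, mul_assoc]
        rw [h, End.mul_def, ← Spec.map_comp]; rfl }
  act_π := fun a => by
    change Spec.map _ ≫ Spec.map _ = Spec.map _
    rw [← Spec.map_comp]; rfl

end Galois

/-! ## Splitting families -/

section Splitting

variable {k : Type u} [Field k] {d n : ℕ}

/-- `(X_m)_m` is a splitting family for `e`: for every extension `l/k` with `l` infinite, the
restriction of `e` to `l` vanishes if and only if some `X_m` has an `l`-point. The restriction is
taken along any embedding of the separable closures. -/
def IsSplittingFamily {A B : GalMod (Gal k) d} (e : YExt n A B)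
    (X : ℕ → Over (Spec (.of k))) : Prop :=
  ∀ (l : Type u) [Field l] [Algebra k l] [Infinite l]
    (ι : SeparableClosure k →ₐ[k] SeparableClosure l),
    (e.res (galRes ι)).IsZero ↔ ∃ m, Nonempty (Points (X m) l)

/-- `(X_m)_m` is a smooth, geometrically integral ind-variety over `k`: a sequence of smooth
geometrically integral `k`-varieties for which there are closed embeddings
`X_m → X_{m+1}` over `k`. -/
structure IsSmoothIndVariety (X : ℕ → Over (Spec (.of k))) : Prop where
  isVariety : ∀ m, IsVariety (X m)
  smooth : ∀ m, Smooth (X m).hom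
  geometricallyIntegral : ∀ m, GeometricallyIntegral (X m).hom
  closedEmbedding : ∀ m, ∃ j : X m ⟶ X (m + 1), IsClosedImmersion j.left

/-- The finiteness of `Aut(E)`. -/
instance ExactSeq.finite_aut {N : ℕ} (E : ExactSeq d N) : Finite E.Aut := by
  have : ∀ i, Finite (E.X i ≃ₗ[ZMod d] E.X i) := fun i =>
    Finite.of_injective (fun α => (α : E.X i → E.X i)) DFunLike.coe_injective
  refine Finite.of_injective
    (fun (α : E.Aut) (i : Fin (N + 1)) => α.1 i.1) fun α β h => Subtype.ext (funext fun i => ?_)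
  by_cases hi : i < N + 1
  · exact congrFun h ⟨i, hi⟩
  · have := E.subsingleton i (by omega)
    ext x
    exact Subsingleton.elim _ _

/-- For an exact sequence `E : 0 → E_0 → ⋯ → E_n → E_{n+1} → 0` of finite discrete `Γ`-modules with
`E_n` free over `ℤ/d`, the varieties `X_0, X_1, …` are lifting varieties for the surjections
`Aut(D_m) → Aut(E)` and for the `Aut(E)`-torsor defined by the action `Γ → Aut(E)`. Here
`D_m : E → E_{n-1}(a, b, m)`, for `m ≥ m₀`, are injective diagrams of `ℤ/d`-modules, which
are compatible with the inclusions of the standard free extensions and cofinal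
among the injective diagrams. -/
def IsLiftingSystem [NeZero d] (hn : 2 ≤ n) (E : GalExactSeq (Gal k) d (n + 1))
    (X : ℕ → Over (Spec (.of k))) : Prop :=
  Module.Free (ZMod d) (E.X n) ∧
  ∃ (a b m₀ : ℕ) (D : ∀ m, Diagram E.toExactSeq (std d n a b (m₀ + m) hn)),
    (∀ m, (D m).IsInjective) ∧
    (∀ m i x, (D (m + 1)).φ i x = stdIncl d n a b (m₀ + m) hn i ((D m).φ i x)) ∧
    (∀ (F : ExactSeq d n) (D' : Diagram E.toExactSeq F), D'.IsInjective →
      ∃ m, D'.HasHom (D m)) ∧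
    (∀ m, Function.Surjective (D m).autHom) ∧
    (∀ m, IsLiftingVariety (D m).autHom (torsorOfHom E.toAut) (X m))

end Splitting

end YonedaSplitting

end

open YonedaSplitting

/-!
Let `E` be the exact sequence `0 → B → E_1 → ⋯ → E_n → A → 0`.

*Vanishing of the class.* The class of `E` vanishes if and only if `E` comes from a shorter
sequence (`IsShortenable`): there is a morphism from `E` to an exact sequence
`0 → F_0 → ⋯ → F_n → 0` of Galois modules which is bijective in the positions `0` and `n`
(`YExtension.isZero_cls_iff`). Indeed, this property is preserved by the morphisms which generate
Yoneda equivalence, by pullback and pushout of `F`. Conversely, `E` and the trivial extension both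
map to the sum of `F` and of `A = A`. The property is self-dual (`isShortenable_res_dual_iff`), so
that the case in which `A` is free follows from the case in which `B` is. Pullback along a
surjection from a free module to `E_n` makes `E_n` free (`exists_free_last`).

*Lifting of automorphisms.* Assume that `B` and `E_n` are free. Since `ℤ/d` is self-injective, an
isomorphism between submodules of a finite free module extends to an automorphism
(`exists_extend_equiv`). It follows that two injective diagrams `E → F` and `E → F'` are isomorphic
if `F'` is a standard free extension and the cycles of `F` are free of the right ranks
(`Diagram.exists_equiv_std`). Hence `Aut(D_m) → Aut(E)` is surjective
(`Diagram.autHom_surjective`), and every Galois equivariant diagram `E → F` becomes isomorphic to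
`D_m` as a diagram of modules, for large `m`, after addition of contractible sequences to `F`
(`IsShortenable.exists_std`). An action of `Γ` on the target of `D_m` for which `D_m` is
equivariant is a lift of `Γ → Aut(E)` to `Aut(D_m)`. So `E` comes from a shorter sequence if and
only if `Γ → Aut(E)` lifts to some `Aut(D_m)` (`isShortenable_iff_exists_lift`).

*Lifting varieties.* Let `φ : H → G` be a surjection of finite groups and `P` the `G`-torsor given
by a continuous homomorphism `p : Γ → G`. Let `H` act on `P` through `φ`, on the affine space of
functions on `H` by translation, and trivially on `𝔸^N`. The determinant `conjDet` of the matrix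
`(ξ_{gh})` defines an open subscheme `U` of the space of functions on which `H` acts freely, and
the lifting variety (`liftVariety`) is the quotient of `P × U × 𝔸^N` by `H`. Everything is affine:
`P × U × 𝔸^N` is the spectrum of `NormalRing`, which is a Galois algebra over the ring of
invariants in the sense of `IsGal` (`NormalRing.isGal`). The quotient is smooth by étale descent
(`smooth_of_etale`), and geometrically integral because `H` acts transitively on the geometric
points of `P` (`NormalRing.isDomain_tensorProduct`). A lifting triangle over an infinite field `l`
is an equivariant homomorphism from the algebra of `P` to a Galois algebra `L` over `l`
(`GScheme.IsTorsor.exists_isGal`). It is the fibre at the point given by any normal element of `L`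
and any point of `𝔸^N(l)`. Such points are dense by the normal basis theorem
(`IsGal.exists_isUnit_conjDet`, `NormalRing.exists_point_ne_zero`). In particular, an `l`-point
exists if and only if `p` lifts to `H` over `l` (`NormalRing.nonempty_point_iff`).

*Closed embeddings.* The inclusion of standard free extensions is split, which gives compatible
injections `Aut(D_m) → Aut(D_{m+1})` (`Diagram.autSucc`). They induce morphisms of lifting
varieties, and these are closed embeddings if the factor `𝔸^N` of the target is used to map to
generators of the ring of functions on the source (`exists_sequence_liftVariety`). The construction
is assembled in `exists_liftingSystem`.
-/

universe v

noncomputable section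

namespace YonedaSplitting

set_option linter.unusedSectionVars false

/-! ### Finite modules over `ℤ/d` -/

section ZModModules

variable {d : ℕ} [NeZero d]

/-- The ring `ℤ/d` is injective as a module over itself: a map out of the ideal `(c)` sends `c` to a
multiple of `gcd(c, d)`, that is, of `c`. -/
theorem baer_zmod : Module.Baer (ZMod d) (ZMod d) := by
  intro I g
  have : IsPrincipalIdealRing (ZMod d) :=
    IsPrincipalIdealRing.of_surjective (Int.castRingHom (ZMod d)) (ZMod.ringHom_surjective _)
  obtain ⟨c, rfl⟩ := (IsPrincipalIdealRing.principal I).principal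
  have hc : c ∈ Submodule.span (ZMod d) {c} := Submodule.mem_span_singleton_self c
  set w := g ⟨c, hc⟩ with hw
  obtain ⟨r, hr⟩ : ∃ r, r * c = w := by
    set e := Nat.gcd c.val d with he
    have hd : 0 < d := Nat.pos_of_ne_zero (NeZero.ne d)
    have he0 : 0 < e := Nat.gcd_pos_of_pos_right _ hd
    obtain ⟨d', hd'⟩ : e ∣ d := Nat.gcd_dvd_right _ _
    obtain ⟨c', hc'⟩ : e ∣ c.val := Nat.gcd_dvd_left _ _
    -- `d / e` annihilates `c`, hence `w`
    have h1 : ((d' : ℕ) : ZMod d) * c = 0 := by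
      rw [← ZMod.natCast_zmod_val c, hc', ← Nat.cast_mul, ← mul_assoc, mul_comm d' e, ← hd']
      simp
    have h2 : ((d' : ℕ) : ZMod d) * w = 0 := by
      have : (d' : ZMod d) • (⟨c, hc⟩ : Submodule.span (ZMod d) {c}) = 0 := Subtype.ext h1
      rw [hw, ← smul_eq_mul, ← map_smul, this, map_zero]
    have h3 : e ∣ w.val := by
      rw [← ZMod.natCast_zmod_val w, ← Nat.cast_mul, ZMod.natCast_eq_zero_iff] at h2
      have hd0 : 0 < d' := Nat.pos_of_ne_zero (by rintro rfl; omega)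
      obtain ⟨q, hq⟩ := h2
      refine ⟨q, Nat.eq_of_mul_eq_mul_left hd0 ?_⟩
      rw [hq]; conv_lhs => rw [hd']
      ring
    obtain ⟨w', hw'⟩ := h3
    have h4 : ((e : ℕ) : ZMod d) = c * (Nat.gcdA c.val d : ℤ) := by
      have := congrArg (Int.cast : ℤ → ZMod d) (Nat.gcd_eq_gcd_ab c.val d)
      simpa using this
    refine ⟨(Nat.gcdA c.val d : ℤ) * w', ?_⟩
    rw [← ZMod.natCast_zmod_val w, hw', Nat.cast_mul, h4]
    ring
  refine ⟨LinearMap.toSpanSingleton _ _ r, ?_⟩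
  rintro x hx
  obtain ⟨t, rfl⟩ := Submodule.mem_span_singleton.1 hx
  have : (⟨t • c, hx⟩ : Submodule.span (ZMod d) {c}) = t • ⟨c, hc⟩ := rfl
  rw [map_smul, this, map_smul g, ← hw, ← hr]
  simp only [LinearMap.toSpanSingleton_apply, smul_eq_mul]
  ring

theorem baer_pi {R ι : Type*} [CommRing R] {M : ι → Type*} [∀ i, AddCommGroup (M i)]
    [∀ i, Module R (M i)] (h : ∀ i, Module.Baer R (M i)) : Module.Baer R (∀ i, M i) := by
  intro I g
  choose f hf using fun i => h i I ((LinearMap.proj i).comp g)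
  exact ⟨LinearMap.pi f, fun x hx => funext fun i => hf i x hx⟩

section Extension

variable {R : Type*} [CommRing R] {A N N' : Type*} [AddCommGroup A] [Module R A]
  [AddCommGroup N] [Module R N] [AddCommGroup N'] [Module R N']

/-- A map out of `A` that vanishes on the kernel of `u : A → N` extends along `u`, if its target is
injective. -/
theorem exists_extend (u : A →ₗ[R] N) (u' : A →ₗ[R] N') (h : ∀ a, u a = 0 → u' a = 0)
    (hB : Module.Baer R N') : ∃ g : N →ₗ[R] N', ∀ a, g (u a) = u' a := by
  obtain ⟨g, hg⟩ := hB.extension_property (u.ker.liftQ u le_rfl)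
    (LinearMap.ker_eq_bot.1 (Submodule.ker_liftQ_eq_bot _ _ _ le_rfl))
    (u.ker.liftQ u' fun a ha => h a ha)
  exact ⟨g, fun a => LinearMap.congr_fun hg (u.ker.mkQ a)⟩

end Extension

variable {N N' : Type*} [AddCommGroup N] [Module (ZMod d) N] [AddCommGroup N']
  [Module (ZMod d) N']

/-- A scalar either is invertible on the elements killed by the prime `p`, or kills all of them. -/
theorem mem_or_smul_eq_zero {p : ℕ} (hp : p.Prime) (v : N) (w : N')
    (hv : (p : ZMod d) • v = 0) (hw : (p : ZMod d) • w = 0) (t : ZMod d) (S : Submodule (ZMod d) N)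
    (h : t • v ∈ S) : v ∈ S ∨ (t • v = 0 ∧ t • w = 0) := by
  by_cases hpt : p ∣ t.val
  · right
    obtain ⟨q, hq⟩ := hpt
    have ht : t = (q : ZMod d) * p := by rw [← ZMod.natCast_zmod_val t, hq]; push_cast; ring
    rw [ht, mul_smul, mul_smul, hv, hw, smul_zero, smul_zero]
    exact ⟨rfl, rfl⟩
  · left
    have hg : Nat.gcd t.val p = 1 := Nat.Coprime.symm ((Nat.Prime.coprime_iff_not_dvd hp).2 hpt)
    have := congrArg (Int.cast : ℤ → ZMod d) (Nat.gcd_eq_gcd_ab t.val p)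
    rw [hg] at this
    push_cast at this
    rw [ZMod.natCast_zmod_val] at this
    have e : v = ((Nat.gcdA t.val p : ℤ) : ZMod d) • t • v := by
      conv_lhs => rw [← one_smul (ZMod d) v, this, add_smul, mul_comm (p : ZMod d),
        mul_smul _ (p : ZMod d), hv, smul_zero, add_zero, mul_comm, mul_smul]
    rw [e]
    exact S.smul_mem _ h

/-- A nonzero element of a module over `ℤ/d` has a multiple of prime order. -/
theorem exists_prime_smul_eq_zero (x : N) (hx : x ≠ 0) : ∃ p : ℕ, p.Prime ∧ ∃ t : ZMod d,
    t • x ≠ 0 ∧ (p : ZMod d) • t • x = 0 := by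
  have hd : (d : ZMod d) • x = 0 := by simp
  have hex : ∃ m : ℕ, 0 < m ∧ (m : ZMod d) • x = 0 := ⟨d, Nat.pos_of_ne_zero (NeZero.ne d), hd⟩
  classical
  set m := Nat.find hex with hm
  obtain ⟨hm0, hmx⟩ := Nat.find_spec hex
  have hm1 : m ≠ 1 := by
    intro h
    rw [← hm, h] at hmx
    exact hx (by simpa using hmx)
  obtain ⟨p, hp, q, hq⟩ := Nat.exists_prime_and_dvd hm1
  refine ⟨p, hp, q, fun h => ?_, ?_⟩
  · have hq0 : 0 < q := Nat.pos_of_ne_zero (by rintro rfl; omega)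
    have := Nat.find_min' hex ⟨hq0, h⟩
    have := hp.two_le
    nlinarith
  · rw [← mul_smul, ← Nat.cast_mul, ← hq]; exact hmx

/-- An isomorphism between submodules of two isomorphic finite injective `ℤ/d`-modules extends to an
isomorphism of the modules. The submodules are given as images of one module `A`. -/
theorem exists_extend_equiv [Finite N] (e : N ≃ₗ[ZMod d] N')
    (hB : Module.Baer (ZMod d) N') : ∀ {A : Type _} [AddCommGroup A] [Module (ZMod d) A]
    (u : A →ₗ[ZMod d] N) (u' : A →ₗ[ZMod d] N') (_ : ∀ a, u a = 0 ↔ u' a = 0),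
    ∃ θ : N ≃ₗ[ZMod d] N', ∀ a, θ (u a) = u' a := by
  intro A _ _ u u' h
  induction hk : Nat.card N - Nat.card u.range using Nat.strong_induction_on generalizing A with
  | _ k ih =>
  have : Finite N' := Finite.of_equiv N e.toEquiv
  by_cases hex : ∃ p : ℕ, p.Prime ∧ ∃ v : N, (p : ZMod d) • v = 0 ∧ v ∉ u.range
  · -- enlarge the submodule by an element of prime order
    obtain ⟨p, hp, v, hv, hvu⟩ := hex
    obtain ⟨w, hw, hwu⟩ : ∃ w : N', (p : ZMod d) • w = 0 ∧ w ∉ u'.range := by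
      -- otherwise `x ↦ u (u'⁻¹ (e x))` is an injective self-map of the finite `p`-torsion of `N`,
      -- hence surjective, with image in the range of `u`
      by_contra! hcon
      have key : ∀ x : {x : N // (p : ZMod d) • x = 0}, ∃ a, u' a = e x := fun x =>
        hcon (e x) (by rw [← map_smul, x.2, map_zero])
      choose a ha using key
      have hpa : ∀ x, (p : ZMod d) • u (a x) = 0 := fun x => by
        rw [← map_smul, h, map_smul, ha, ← map_smul, x.2, map_zero]
      let F : {x : N // (p : ZMod d) • x = 0} → {x : N // (p : ZMod d) • x = 0} :=
        fun x => ⟨u (a x), hpa x⟩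
      have hF : Function.Injective F := by
        intro x y hxy
        have h1 : u (a x - a y) = 0 := by
          rw [map_sub, sub_eq_zero]; exact congrArg Subtype.val hxy
        rw [h, map_sub, ha, ha, sub_eq_zero] at h1
        exact Subtype.ext (e.injective h1)
      obtain ⟨x, hx⟩ := Finite.injective_iff_surjective.1 hF ⟨v, hv⟩
      exact hvu ⟨a x, congrArg Subtype.val hx⟩
    let U : A × ZMod d →ₗ[ZMod d] N := u.coprod (LinearMap.toSpanSingleton _ _ v)
    let U' : A × ZMod d →ₗ[ZMod d] N' := u'.coprod (LinearMap.toSpanSingleton _ _ w)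
    have hU : ∀ a, U a = 0 ↔ U' a = 0 := by
      rintro ⟨a, t⟩
      simp only [U, U', LinearMap.coprod_apply, LinearMap.toSpanSingleton_apply]
      constructor
      · intro hh
        have h1 : t • v ∈ u.range := ⟨-a, by rw [map_neg]; exact neg_eq_of_add_eq_zero_right hh⟩
        obtain h2 | ⟨h2, h3⟩ := mem_or_smul_eq_zero hp v w hv hw t _ h1
        · exact absurd h2 hvu
        · rw [h2, add_zero, h] at hh; rw [hh, h3, add_zero]
      · intro hh
        have h1 : t • w ∈ u'.range := ⟨-a, by rw [map_neg]; exact neg_eq_of_add_eq_zero_right hh⟩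
        obtain h2 | ⟨h2, h3⟩ := mem_or_smul_eq_zero hp w v hw hv t _ h1
        · exact absurd h2 hwu
        · rw [h2, add_zero, ← h] at hh; rw [hh, h3, add_zero]
    have hlt : u.range < U.range := by
      refine lt_of_le_of_ne ?_ fun heq => hvu ?_
      · rintro _ ⟨a, rfl⟩
        exact ⟨(a, 0), by simp [U]⟩
      · rw [heq]; exact ⟨(0, 1), by simp [U]⟩
    have hcard : Nat.card u.range < Nat.card U.range :=
      Set.ncard_lt_ncard (SetLike.coe_ssubset_coe.2 hlt) (Set.toFinite _)
    have hle : Nat.card U.range ≤ Nat.card N :=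
      Nat.card_le_card_of_injective _ Subtype.val_injective
    obtain ⟨θ, hθ⟩ := ih (Nat.card N - Nat.card U.range) (by omega) U U' hU rfl
    exact ⟨θ, fun a => by simpa [U, U'] using hθ (a, 0)⟩
  · -- the submodule contains the socle, so that every extension is injective
    push Not at hex
    obtain ⟨g, hg⟩ := exists_extend u u' (fun a => (h a).1) hB
    have hinj : Function.Injective g := by
      rw [injective_iff_map_eq_zero]
      intro x hx
      by_contra hx0
      obtain ⟨p, hp, t, ht, hpt⟩ := exists_prime_smul_eq_zero (d := d) x hx0
      obtain ⟨a, ha⟩ := hex p hp _ hpt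
      apply ht
      rw [← ha, h, ← hg, ha, map_smul, hx, smul_zero]
    have hbij : Function.Bijective g :=
      (Nat.bijective_iff_injective_and_card g).2 ⟨hinj, Nat.card_congr e.toEquiv⟩
    exact ⟨LinearEquiv.ofBijective g hbij, hg⟩

/-- The dual separates the points: `ℤ/d` is injective and contains an element of every prime order
which occurs in `N`. -/
theorem exists_dual_ne_zero (x : N) (hx : x ≠ 0) : ∃ l : N →ₗ[ZMod d] ZMod d, l x ≠ 0 := by
  obtain ⟨p, hp, t, ht, hpt⟩ := exists_prime_smul_eq_zero (d := d) x hx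
  have hpd : p ∣ d := by
    by_contra hpd
    have hg : Nat.gcd p d = 1 := (Nat.Prime.coprime_iff_not_dvd hp).2 hpd
    have := congrArg (Int.cast : ℤ → ZMod d) (Nat.gcd_eq_gcd_ab p d)
    rw [hg] at this
    push_cast at this
    rw [ZMod.natCast_self, zero_mul, add_zero] at this
    exact ht (by rw [← one_smul (ZMod d) (t • x), this, mul_comm, mul_smul, hpt, smul_zero])
  obtain ⟨q, hq⟩ := hpd
  have hq1 : (p : ZMod d) • (q : ZMod d) = 0 := by
    rw [smul_eq_mul, ← Nat.cast_mul, ← hq, ZMod.natCast_self]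
  have hq0 : (q : ZMod d) ≠ 0 := by
    rw [Ne, ZMod.natCast_eq_zero_iff]
    intro h
    have hd : 0 < d := Nat.pos_of_ne_zero (NeZero.ne d)
    have hq0 : 0 < q := Nat.pos_of_ne_zero (by rintro rfl; omega)
    have := Nat.le_of_dvd hq0 h
    have := hp.two_le
    nlinarith
  obtain ⟨g, hg⟩ := exists_extend (LinearMap.toSpanSingleton (ZMod d) N (t • x))
    (LinearMap.toSpanSingleton (ZMod d) (ZMod d) (q : ZMod d)) (fun s hs => by
      simp only [LinearMap.toSpanSingleton_apply] at hs ⊢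
      obtain h | h := mem_or_smul_eq_zero hp (t • x) (q : ZMod d) hpt hq1 s ⊥ (by rw [hs]; simp)
      · exact absurd h ht
      · exact h.2) baer_zmod
  refine ⟨g, fun h => hq0 ?_⟩
  have := hg 1
  simp only [LinearMap.toSpanSingleton_apply, one_smul, map_smul, h, smul_zero] at this
  exact this.symm

instance finite_linearMap {R M M' : Type*} [Semiring R] [AddCommMonoid M] [Module R M]
    [AddCommMonoid M'] [Module R M'] [Finite M] [Finite M'] : Finite (M →ₗ[R] M') :=
  Finite.of_injective (fun l => (l : M → M')) DFunLike.coe_injective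

/-- The canonical map to the bidual. -/
def evalDual (N : Type*) [AddCommGroup N] [Module (ZMod d) N] :
    N →ₗ[ZMod d] (N →ₗ[ZMod d] ZMod d) →ₗ[ZMod d] ZMod d := LinearMap.id.flip

theorem evalDual_injective : Function.Injective (evalDual (d := d) N) := by
  rw [injective_iff_map_eq_zero]
  intro x hx
  by_contra h
  obtain ⟨l, hl⟩ := exists_dual_ne_zero (d := d) x h
  exact hl (LinearMap.congr_fun hx l)

variable (N) in
/-- The canonical embedding of a `ℤ/d`-module in the module of functions on its dual. -/
def toFunDual : N →ₗ[ZMod d] ((N →ₗ[ZMod d] ZMod d) → ZMod d) :=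
  LinearMap.pi fun l => l

theorem toFunDual_injective : Function.Injective (toFunDual (d := d) N) := by
  intro x y h
  exact evalDual_injective (LinearMap.ext fun l => congrFun h l)

/-- An element `ξ` of the bidual is a function `y` on the dual. If `y` were not in the image of
`N`, some linear form would vanish on this image but not on `y`; this linear form is the evaluation
at an element of the dual, which is then zero. -/
theorem evalDual_bijective [Finite N] : Function.Bijective (evalDual (d := d) N) := by
  refine ⟨evalDual_injective, fun ξ => ?_⟩
  classical
  let K := N →ₗ[ZMod d] ZMod d
  have : Fintype K := Fintype.ofFinite _
  let y : K → ZMod d := fun l => ξ l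
  by_cases hy : y ∈ (toFunDual (d := d) N).range
  · obtain ⟨x, hx⟩ := hy
    exact ⟨x, LinearMap.ext fun l => congrFun hx l⟩
  · exfalso
    obtain ⟨l, hl⟩ := exists_dual_ne_zero (d := d) ((toFunDual (d := d) N).range.mkQ y)
      (by rwa [Ne, Submodule.mkQ_apply, Submodule.Quotient.mk_eq_zero])
    let L : (K → ZMod d) →ₗ[ZMod d] ZMod d := l.comp (toFunDual (d := d) N).range.mkQ
    have h0 : L.comp (toFunDual N) = 0 := by
      ext x
      change l (Submodule.Quotient.mk _) = 0
      rw [(Submodule.Quotient.mk_eq_zero _).2 (LinearMap.mem_range_self _ x), map_zero]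
    apply hl
    have hsum : ∀ z : K → ZMod d, L z = ∑ k, z k * L (Pi.single k 1) := fun z => by
      conv_lhs => rw [← Finset.univ_sum_single z, map_sum]
      refine Finset.sum_congr rfl fun k _ => ?_
      have : (Pi.single k (z k) : K → ZMod d) = z k • Pi.single k 1 := by
        ext k'; by_cases hk : k' = k
        · subst hk; simp
        · simp [hk]
      rw [this, map_smul, smul_eq_mul]
    have h1 : (∑ k : K, L (Pi.single k 1) • k) = 0 := by
      rw [← h0]
      refine LinearMap.ext fun x => ?_
      rw [LinearMap.comp_apply, hsum, LinearMap.sum_apply]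
      exact Finset.sum_congr rfl fun k _ => mul_comm _ _
    change L y = 0
    rw [hsum, ← map_zero ξ, ← h1, map_sum]
    exact Finset.sum_congr rfl fun k _ => by rw [map_smul, smul_eq_mul, mul_comm]

/-- The cokernel of an injective map between free `ℤ/d`-modules of finite rank is free, with the
expected rank. -/
theorem exists_quotient_equiv [Finite N] {r s : ℕ} (e : N ≃ₗ[ZMod d] (Fin s → ZMod d))
    (j : (Fin r → ZMod d) →ₗ[ZMod d] N) (hj : Function.Injective j) :
    ∃ t, Nonempty ((N ⧸ j.range) ≃ₗ[ZMod d] (Fin t → ZMod d)) := by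
  by_cases hd : d = 1
  · subst hd
    have : Subsingleton (N ⧸ j.range) := Module.subsingleton (ZMod 1) _
    exact ⟨0, ⟨LinearEquiv.ofSubsingleton _ _⟩⟩
  have hd2 : 1 < d := by have := NeZero.ne d; omega
  have hrs : r ≤ s := by
    have h1 := Nat.card_le_card_of_injective (e ∘ j) (e.injective.comp hj)
    rw [Nat.card_fun, Nat.card_fun, Nat.card_zmod, Nat.card_fin, Nat.card_fin] at h1
    exact (Nat.pow_le_pow_iff_right hd2).1 h1
  obtain ⟨t, rfl⟩ := Nat.exists_eq_add_of_le hrs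
  refine ⟨t, ?_⟩
  let e₀ : (Fin (r + t) → ZMod d) ≃ₗ[ZMod d] (Fin r → ZMod d) × (Fin t → ZMod d) :=
    (LinearEquiv.funCongrLeft (ZMod d) (ZMod d) finSumFinEquiv).trans
      (LinearEquiv.sumArrowLequivProdArrow (Fin r) (Fin t) (ZMod d) (ZMod d))
  have hB : Module.Baer (ZMod d) ((Fin r → ZMod d) × (Fin t → ZMod d)) :=
    Module.Baer.of_equiv e₀ (baer_pi fun _ => baer_zmod)
  -- by extension of isomorphisms, `j` may be assumed to be the inclusion of the first summand
  obtain ⟨θ, hθ⟩ := exists_extend_equiv (e.trans e₀) hB j (LinearMap.inl _ _ _) (fun a => by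
    rw [← map_zero j, hj.eq_iff]; simp)
  have hr : j.range = ((LinearMap.snd (ZMod d) (Fin r → ZMod d) (Fin t → ZMod d)).comp
      θ.toLinearMap).ker := by
    ext x
    simp only [LinearMap.mem_range, LinearMap.mem_ker, LinearMap.comp_apply, LinearMap.snd_apply,
      LinearEquiv.coe_coe]
    constructor
    · rintro ⟨a, rfl⟩; rw [hθ]; simp
    · intro hx
      refine ⟨(θ x).1, θ.injective ?_⟩
      rw [hθ]
      exact Prod.ext rfl hx.symm
  rw [hr]
  exact ⟨LinearMap.quotKerEquivOfSurjective _ (Prod.snd_surjective.comp θ.surjective)⟩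

end ZModModules

/-! ### Diagrams with values in the standard free extensions -/

section StandardDiagrams


variable {d n : ℕ} [NeZero d] {a b m : ℕ} {hn : 2 ≤ n}

theorem subsingleton_fin_fun {r : ℕ} (hr : r = 0) : Subsingleton (Fin r → ZMod d) := by
  subst hr; infer_instance

theorem stdRank_zero : stdRank n a b m 0 = 0 := by simp [stdRank]

theorem stdRank_of_lt (hn : 2 ≤ n) {i : ℕ} (hi : n < i) : stdRank n a b m i = 0 := by
  unfold stdRank; split_ifs <;> omega

/-- The first component of a diagram `E → std`: it determines the diagram. -/
def Diagram.fstComp {E : ExactSeq d (n + 1)} (D : Diagram E (std d n a b m hn)) (i : ℕ) :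
    E.X i →ₗ[ZMod d] (Fin (stdRank n a b m i) → ZMod d) :=
  (LinearMap.fst (ZMod d) (Fin (stdRank n a b m i) → ZMod d)
    (Fin (stdRank n a b m (i + 1)) → ZMod d)).comp (D.φ i)

theorem Diagram.φ_eq {E : ExactSeq d (n + 1)} (D : Diagram E (std d n a b m hn)) (i : ℕ)
    (x : E.X i) : D.φ i x = (D.fstComp i x, D.fstComp (i + 1) (E.f i x)) := by
  refine Prod.ext rfl ?_
  have h := D.comm i x
  exact (congrArg Prod.fst h).symm

/-- The morphism of complexes `F → std` with given first components. -/
def toStd {N : ℕ} (F : ExactSeq d N) (p : ∀ i, F.X i →ₗ[ZMod d] (Fin (stdRank n a b m i) → ZMod d))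
    (hn : 2 ≤ n) (i : ℕ) : F.X i →ₗ[ZMod d] (std d n a b m hn).X i :=
  (p i).prod ((p (i + 1)).comp (F.f i))

theorem ExactSeq.f_f {N : ℕ} (F : ExactSeq d N) (i : ℕ) (x : F.X i) : F.f (i + 1) (F.f i x) = 0 :=
  (F.exact i (F.f i x)).2 ⟨x, rfl⟩

theorem toStd_comm {N : ℕ} (F : ExactSeq d N)
    (p : ∀ i, F.X i →ₗ[ZMod d] (Fin (stdRank n a b m i) → ZMod d)) (i : ℕ) (x : F.X i) :
    toStd F p hn (i + 1) (F.f i x) = (std d n a b m hn).f i (toStd F p hn i x) := by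
  refine Prod.ext rfl ?_
  change p (i + 2) (F.f (i + 1) (F.f i x)) = 0
  rw [F.f_f, map_zero]

/-- Every injective diagram maps to every diagram with values in a standard free extension, because
the modules of the latter are injective. -/
theorem Diagram.hasHom_std {E : ExactSeq d (n + 1)} {F : ExactSeq d n} (D' : Diagram E F)
    (hD' : D'.IsInjective) (D : Diagram E (std d n a b m hn)) : D'.HasHom D := by
  have key : ∀ i, ∃ p : F.X i →ₗ[ZMod d] (Fin (stdRank n a b m i) → ZMod d),
      ∀ x, p (D'.φ i x) = D.fstComp i x := by
    intro i
    by_cases hi : i ≤ n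
    · exact exists_extend (D'.φ i) (D.fstComp i) (fun x hx => by
        rw [(injective_iff_map_eq_zero _).1 (hD' i hi) x hx, map_zero]) (baer_pi fun _ => baer_zmod)
    · have := subsingleton_fin_fun (d := d) (stdRank_of_lt (a := a) (b := b) (m := m) hn
        (not_le.1 hi))
      exact ⟨0, fun x => Subsingleton.elim _ _⟩
  choose p hp using key
  refine ⟨toStd F p hn, toStd_comm F p, fun i x => ?_⟩
  rw [D.φ_eq]
  refine Prod.ext (hp i x) ?_
  change p (i + 1) (F.f i (D'.φ i x)) = _
  rw [← D'.comm, hp]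

/-- Two injective diagrams are isomorphic if one takes its values in a standard free extension and
the modules of cycles of the other one are free of the same ranks. The components `F_i → 𝔽^{r_i}` of
the isomorphism can be chosen independently: each of them has to extend the given map on `E_i` and
to be bijective on cycles. -/
theorem Diagram.exists_equiv_std {E : ExactSeq d (n + 1)} {F : ExactSeq d n} (D : Diagram E F)
    (hD : D.IsInjective) (D₀ : Diagram E (std d n a b m hn)) (hD₀ : D₀.IsInjective)
    (hZ : ∀ i, i < n → Nonempty ((F.f i).ker ≃ₗ[ZMod d] (Fin (stdRank n a b m i) → ZMod d))) :
    ∃ θ : ∀ i, F.X i ≃ₗ[ZMod d] (std d n a b m hn).X i,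
      (∀ i x, θ (i + 1) (F.f i x) = (std d n a b m hn).f i (θ i x)) ∧
      ∀ i x, θ i (D.φ i x) = D₀.φ i x := by
  have hFinj : ∀ i, i ≤ n → ∀ x, D.φ i x = 0 → x = 0 := fun i hi =>
    (injective_iff_map_eq_zero _).1 (hD i hi)
  have key : ∀ i, ∃ p : F.X i →ₗ[ZMod d] (Fin (stdRank n a b m i) → ZMod d),
      (∀ x, p (D.φ i x) = D₀.fstComp i x) ∧
      (∀ z, F.f i z = 0 → p z = 0 → z = 0) ∧ ∀ y, ∃ z, F.f i z = 0 ∧ p z = y := by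
    intro i
    obtain hi | rfl | hi := lt_trichotomy i n
    · obtain ⟨e⟩ := hZ i hi
      let u : (E.f i).ker →ₗ[ZMod d] (F.f i).ker :=
        ((D.φ i).comp (E.f i).ker.subtype).codRestrict _ fun x => by
          rw [LinearMap.mem_ker, LinearMap.comp_apply, ← D.comm]
          change D.φ (i + 1) (E.f i x.1) = 0
          rw [LinearMap.mem_ker.1 x.2, map_zero]
      -- on the cycles of `F_i`, an isomorphism which extends the given map on the cycles of `E_i`
      obtain ⟨ζ, hζ⟩ := exists_extend_equiv e (baer_pi fun _ => baer_zmod) u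
        ((D₀.fstComp i).comp (E.f i).ker.subtype) (fun x => by
          constructor
          · intro hx
            have : x.1 = 0 := hFinj i hi.le _ (congrArg Subtype.val hx)
            rw [LinearMap.comp_apply, Submodule.subtype_apply, this, map_zero]
          · intro hx
            have : x.1 = 0 := by
              apply (injective_iff_map_eq_zero _).1 (hD₀ i hi.le)
              rw [D₀.φ_eq, LinearMap.mem_ker.1 x.2, map_zero]
              exact Prod.ext hx rfl
            rw [(Subtype.ext this : x = 0), map_zero])
      -- the maps on the cycles of `F_i` and on `E_i` agree on the intersection, so they extend
      obtain ⟨p, hp⟩ := exists_extend ((F.f i).ker.subtype.coprod (D.φ i))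
        (ζ.toLinearMap.coprod (D₀.fstComp i)) (by
          rintro ⟨z, x⟩ h
          simp only [LinearMap.coprod_apply, Submodule.subtype_apply, LinearEquiv.coe_coe] at h ⊢
          have h1 : E.f i x = 0 := by
            apply hFinj (i + 1) hi
            rw [D.comm]
            have := congrArg (F.f i) h
            rwa [map_add, LinearMap.mem_ker.1 z.2, zero_add, map_zero] at this
          have h2 : z = - u ⟨x, h1⟩ := by
            apply Subtype.ext
            exact eq_neg_of_add_eq_zero_left h
          rw [h2, map_neg, hζ]
          simp) (baer_pi fun _ => baer_zmod)
      have hpz : ∀ z : (F.f i).ker, p z.1 = ζ z := fun z => by simpa using hp (z, 0)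
      refine ⟨p, fun x => by simpa using hp (0, x), fun z hz hpz0 => ?_, fun y => ?_⟩
      · have h := hpz ⟨z, hz⟩
        rw [hpz0] at h
        exact congrArg Subtype.val (ζ.injective (h.symm.trans (map_zero ζ).symm))
      · exact ⟨(ζ.symm y).1, (ζ.symm y).2, by rw [hpz, ζ.apply_symm_apply]⟩
    -- in position `n`, the map `E_n → F_n` is bijective
    · let e := LinearEquiv.ofBijective (D.φ i) D.bijective_last
      have h0 : Subsingleton (Fin (stdRank i a b m (i + 1)) → ZMod d) :=
        subsingleton_fin_fun (stdRank_of_lt hn (Nat.lt_succ_self i))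
      have hF := F.subsingleton (i + 1) (Nat.lt_succ_self i)
      have he : ∀ x, (D₀.fstComp i).comp e.symm.toLinearMap (D.φ i x) = D₀.fstComp i x := by
        intro x
        change D₀.fstComp i (e.symm (e x)) = _
        rw [e.symm_apply_apply]
      refine ⟨(D₀.fstComp i).comp e.symm.toLinearMap, he, fun z _ hz => ?_, fun y => ?_⟩
      · obtain ⟨x, rfl⟩ := e.surjective z
        change (D₀.fstComp i).comp e.symm.toLinearMap (D.φ i x) = 0 at hz
        rw [he] at hz
        have hx0 : x = 0 := (injective_iff_map_eq_zero _).1 D₀.bijective_last.1 x (by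
          rw [D₀.φ_eq]; exact Prod.ext hz (Subsingleton.elim _ _))
        rw [hx0, map_zero]
      · obtain ⟨x, hx⟩ := D₀.bijective_last.2 (y, 0)
        exact ⟨D.φ i x, Subsingleton.elim _ _, (he x).trans (congrArg Prod.fst hx)⟩
    · have := subsingleton_fin_fun (d := d) (stdRank_of_lt (a := a) (b := b) (m := m) hn hi)
      have := F.subsingleton i hi
      exact ⟨0, fun x => Subsingleton.elim _ _, fun z _ _ => Subsingleton.elim _ _,
        fun y => ⟨0, map_zero _, Subsingleton.elim _ _⟩⟩
  choose p hp hp1 hp2 using key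
  have hbij : ∀ i, Function.Bijective (toStd F p hn i) := by
    intro i
    constructor
    · rw [injective_iff_map_eq_zero]
      intro z hz
      have h2 : F.f i z = 0 := hp1 (i + 1) _ (F.f_f i z) (congrArg Prod.snd hz)
      exact hp1 i z h2 (congrArg Prod.fst hz)
    · rintro ⟨y, y'⟩
      obtain ⟨z', hz', rfl⟩ := hp2 (i + 1) y'
      obtain ⟨w, rfl⟩ := (F.exact i z').1 hz'
      obtain ⟨z, hz, hzy⟩ := hp2 i (y - p i w)
      refine ⟨z + w, Prod.ext ?_ ?_⟩
      · change p i (z + w) = y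
        rw [map_add, hzy, sub_add_cancel]
      · change p (i + 1) (F.f i (z + w)) = _
        rw [map_add, hz, zero_add]
  refine ⟨fun i => LinearEquiv.ofBijective _ (hbij i), toStd_comm F p, fun i x => ?_⟩
  rw [D₀.φ_eq]
  refine Prod.ext (hp i x) ?_
  change p (i + 1) (F.f i (D.φ i x)) = _
  rw [← D.comm, hp]

/-- The modules of cycles of the standard free extension are free, of rank `stdRank`. -/
theorem nonempty_ker_std_equiv (i : ℕ) :
    Nonempty (((std d n a b m hn).f i).ker ≃ₗ[ZMod d] (Fin (stdRank n a b m i) → ZMod d)) := by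
  refine ⟨LinearEquiv.ofBijective
    ((LinearMap.fst (ZMod d) (Fin (stdRank n a b m i) → ZMod d)
      (Fin (stdRank n a b m (i + 1)) → ZMod d)).comp ((std d n a b m hn).f i).ker.subtype) ⟨?_, ?_⟩⟩
  · rintro ⟨⟨x, y⟩, h⟩ ⟨⟨x', y'⟩, h'⟩ hxx
    have e : y = 0 := congrArg Prod.fst h
    have e' : y' = 0 := congrArg Prod.fst h'
    have ex : x = x' := hxx
    subst e e' ex
    rfl
  · intro x
    exact ⟨⟨(x, 0), rfl⟩, rfl⟩

/-- Precomposition of a diagram with an automorphism of `E`. -/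
def Diagram.precomp {E : ExactSeq d (n + 1)} {F : ExactSeq d n} (D : Diagram E F) (α : E.Aut) :
    Diagram E F where
  φ := fun i => (D.φ i).comp (α.1 i).toLinearMap
  comm := fun i x => by
    change D.φ (i + 1) (α.1 (i + 1) (E.f i x)) = _
    rw [← α.2 i x, D.comm]; rfl
  bijective_zero := D.bijective_zero.comp (α.1 0).bijective
  bijective_last := D.bijective_last.comp (α.1 n).bijective

/-- Every automorphism `α` of `E` lifts, since `D` and `D ∘ α` are isomorphic. -/
theorem Diagram.autHom_surjective {E : ExactSeq d (n + 1)} (D : Diagram E (std d n a b m hn))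
    (hD : D.IsInjective) : Function.Surjective D.autHom := by
  intro α
  obtain ⟨θ, h1, h2⟩ := D.exists_equiv_std hD (D.precomp α)
    (fun i hi => (hD i hi).comp (α.1 i).injective) (fun i _ => nonempty_ker_std_equiv i)
  exact ⟨⟨(α, ⟨θ, fun i x => (h1 i x).symm⟩), fun i x => (h2 i x).symm⟩, rfl⟩

theorem extendZero_injective {r s : ℕ} (h : r ≤ s) : Function.Injective (extendZero d r s) := by
  intro x y hxy
  ext j
  have := congrFun hxy ⟨j.1, j.2.trans_le h⟩
  simpa [extendZero] using this

theorem extendZero_bijective {r s : ℕ} (h : r = s) : Function.Bijective (extendZero d r s) := by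
  subst h
  refine ⟨extendZero_injective le_rfl, fun y => ⟨y, ?_⟩⟩
  ext j
  simp [extendZero]

theorem stdRank_le (i : ℕ) : stdRank n a b m i ≤ stdRank n a b (m + 1) i := by
  unfold stdRank; split_ifs <;> omega

theorem stdRank_eq {i m' : ℕ} (hi : i ≤ 1 ∨ n ≤ i) :
    stdRank n a b m i = stdRank n a b m' i := by
  unfold stdRank; split_ifs <;> omega

/-- Composition of a diagram with the inclusion of the standard free extension of parameter `m` in
the one of parameter `m + 1`. -/
def Diagram.succ {E : ExactSeq d (n + 1)} (D : Diagram E (std d n a b m hn)) :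
    Diagram E (std d n a b (m + 1) hn) where
  φ := fun i => (stdIncl d n a b m hn i).comp (D.φ i)
  comm := fun i x => by
    rw [LinearMap.comp_apply, D.comm]
    refine Prod.ext rfl ?_
    exact map_zero (extendZero d _ _)
  bijective_zero := by
    rw [LinearMap.coe_comp]
    refine Function.Bijective.comp ?_ D.bijective_zero
    exact Function.Bijective.prodMap (extendZero_bijective (stdRank_eq (Or.inl zero_le_one)))
      (extendZero_bijective (stdRank_eq (Or.inl le_rfl)))
  bijective_last := by
    rw [LinearMap.coe_comp]
    refine Function.Bijective.comp ?_ D.bijective_last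
    exact Function.Bijective.prodMap (extendZero_bijective (stdRank_eq (Or.inr le_rfl)))
      (extendZero_bijective (stdRank_eq (Or.inr (Nat.le_succ n))))

theorem Diagram.succ_isInjective {E : ExactSeq d (n + 1)} {D : Diagram E (std d n a b m hn)}
    (hD : D.IsInjective) : D.succ.IsInjective := fun i hi =>
  (Function.Injective.prodMap (extendZero_injective (stdRank_le i))
    (extendZero_injective (stdRank_le (i + 1)))).comp (hD i hi)

/-- A finite module embeds in the free module on its dual, hence in all larger free modules. -/
theorem exists_injective_fin_fun (N : Type*) [AddCommGroup N] [Module (ZMod d) N] [Finite N] :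
    ∃ r : ℕ, ∀ m, r ≤ m → ∃ s : N →ₗ[ZMod d] (Fin m → ZMod d), Function.Injective s := by
  have e := Finite.equivFin (N →ₗ[ZMod d] ZMod d)
  refine ⟨Nat.card (N →ₗ[ZMod d] ZMod d), fun m hm => ⟨(extendZero d _ m).comp
    ((LinearEquiv.funCongrLeft (ZMod d) (ZMod d) e.symm).toLinearMap.comp (toFunDual N)), ?_⟩⟩
  exact (extendZero_injective hm).comp
    ((LinearEquiv.funCongrLeft (ZMod d) (ZMod d) e.symm).injective.comp toFunDual_injective)

/-- There is an injective diagram with values in the standard free extension of parameter `m`, for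
`m` large enough. -/
theorem exists_diagram_std (hn3 : 3 ≤ n) (E : ExactSeq d (n + 1))
    (e₀ : E.X 0 ≃ₗ[ZMod d] (Fin b → ZMod d)) (eₙ : E.X n ≃ₗ[ZMod d] (Fin a → ZMod d)) :
    ∃ m₀, ∀ m, m₀ ≤ m → ∃ D : Diagram E (std d n a b m hn), D.IsInjective := by
  choose r hr using fun i => exists_injective_fin_fun (d := d) (E.X i)
  refine ⟨(Finset.range n).sup r, fun m hm => ?_⟩
  have hcast : ∀ {r s : ℕ}, r = s → Nonempty ((Fin r → ZMod d) ≃ₗ[ZMod d] (Fin s → ZMod d)) := by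
    rintro r _ rfl; exact ⟨LinearEquiv.refl _ _⟩
  -- the first components: a retraction of `E_0 → E_1` in position `1`, the given isomorphism in
  -- position `n`, and arbitrary embeddings in between
  have key : ∀ i, ∃ s : E.X (i + 1) →ₗ[ZMod d] (Fin (stdRank n a b m (i + 1)) → ZMod d),
      (2 ≤ i + 1 → i + 1 ≤ n → Function.Injective s) ∧ (i + 1 = n → Function.Surjective s) ∧
      (i = 0 → Function.Bijective fun x : E.X i => s (E.f i x)) := by
    intro i
    by_cases h1 : i = 0
    · subst h1
      obtain ⟨c⟩ := hcast (show b = stdRank n a b m 1 by simp [stdRank])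
      obtain ⟨s, hs⟩ := exists_extend (E.f 0) (e₀.trans c).toLinearMap (fun x hx => by
        rw [(injective_iff_map_eq_zero _).1 E.injective_zero x hx, map_zero])
        (baer_pi fun _ => baer_zmod)
      refine ⟨s, by omega, by omega, fun _ => ?_⟩
      simp_rw [hs]
      exact (e₀.trans c).bijective
    by_cases hin : i + 1 = n
    · subst hin
      obtain ⟨c⟩ := hcast (show a = stdRank (i + 1) a b m (i + 1) by
        simp [stdRank, h1])
      exact ⟨(eₙ.trans c).toLinearMap, fun _ _ => (eₙ.trans c).injective,
        fun _ => (eₙ.trans c).surjective, by omega⟩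
    by_cases h2 : i + 1 < n
    · obtain ⟨c⟩ := hcast (show m = stdRank n a b m (i + 1) by simp [stdRank, h1, h2])
      obtain ⟨s, hs⟩ := hr (i + 1) m (le_trans (Finset.le_sup (Finset.mem_range.2 h2)) hm)
      exact ⟨c.toLinearMap.comp s, fun _ _ => c.injective.comp hs, by omega, by omega⟩
    · exact ⟨0, by omega, by omega, by omega⟩
  choose s' hs1' hs2' hs3 using key
  let s : ∀ i, E.X i →ₗ[ZMod d] (Fin (stdRank n a b m i) → ZMod d) := fun i =>
    match i with
    | 0 => 0
    | i + 1 => s' i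
  have hs1 : ∀ i, 2 ≤ i → i ≤ n → Function.Injective (s i) := fun i h h' => by
    obtain _ | i := i
    · omega
    · exact hs1' i h h'
  have hs2 : ∀ i, i = n → Function.Surjective (s i) := fun i h => by
    obtain _ | i := i
    · omega
    · exact hs2' i h
  have h01 : Function.Bijective fun x : E.X 0 => s 1 (E.f 0 x) := hs3 0 rfl
  have hr0 := subsingleton_fin_fun (d := d) (stdRank_zero (n := n) (a := a) (b := b) (m := m))
  have hrn := subsingleton_fin_fun (d := d) (stdRank_of_lt (a := a) (b := b) (m := m) hn
    (Nat.lt_succ_self n))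
  have hinj : ∀ i, i ≤ n → Function.Injective (toStd E s hn i) := by
    intro i hi
    rw [injective_iff_map_eq_zero]
    intro x hx
    have hx1 : s i x = 0 := congrArg Prod.fst hx
    have hx2 : s (i + 1) (E.f i x) = 0 := congrArg Prod.snd hx
    obtain rfl | rfl | hi2 : i = 0 ∨ i = 1 ∨ 2 ≤ i := by omega
    · exact h01.1 (hx2.trans (by simp only [map_zero]))
    · have := (injective_iff_map_eq_zero _).1 (hs1 2 le_rfl (by omega)) _ hx2
      obtain ⟨y, rfl⟩ := (E.exact 0 x).1 this
      rw [h01.1 (a₁ := y) (a₂ := 0) (hx1.trans (by simp only [map_zero])), map_zero]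
    · exact (injective_iff_map_eq_zero _).1 (hs1 i hi2 hi) x hx1
  refine ⟨⟨toStd E s hn, toStd_comm E s, ⟨hinj 0 (Nat.zero_le n), ?_⟩, ⟨hinj n le_rfl, ?_⟩⟩, hinj⟩
  · rintro ⟨y, y'⟩
    obtain ⟨x, hx⟩ := h01.2 y'
    exact ⟨x, Prod.ext (Subsingleton.elim _ _) hx⟩
  · rintro ⟨y, y'⟩
    obtain ⟨x, hx⟩ := hs2 n rfl y
    exact ⟨x, Prod.ext hx (Subsingleton.elim _ _)⟩

end StandardDiagrams

/-! ### Constructions with finite discrete Galois modules -/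


section GaloisModules

variable {Γ : Type u} [Group Γ] [TopologicalSpace Γ] {d : ℕ}

/-- A linear action by endomorphisms, seen as an action by automorphisms. -/
def autOfEnd {V : Type*} [AddCommGroup V] [Module (ZMod d) V] (ρ : Γ →* Module.End (ZMod d) V) :
    Γ →* (V ≃ₗ[ZMod d] V) :=
  (LinearMap.GeneralLinearGroup.generalLinearEquiv (ZMod d) V).toMonoidHom.comp ρ.toHomUnits

theorem isOpen_stabilizer_of_mem [IsTopologicalGroup Γ] {V : Type*} [AddCommGroup V]
    [Module (ZMod d) V] (ρ : Γ →* (V ≃ₗ[ZMod d] V)) (v : V) (U : Set Γ) (hU : IsOpen U)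
    (h1 : (1 : Γ) ∈ U) (h : ∀ γ ∈ U, ρ γ v = v) : IsOpen {γ : Γ | ρ γ v = v} := by
  let S : Subgroup Γ := (MulAction.stabilizer (V ≃ₗ[ZMod d] V) v).comap ρ
  exact S.isOpen_of_mem_nhds (g := 1) (Filter.mem_of_superset (hU.mem_nhds h1) h)

theorem GalMod.isOpen_ker (V : GalMod Γ d) : IsOpen {γ : Γ | ∀ v, V.ρ γ v = v} := by
  rw [Set.ofPred_forall]
  exact isOpen_iInter_of_finite V.isOpen_stabilizer

theorem GalMod.ρ_mul_apply (V : GalMod Γ d) (γ γ' : Γ) (v : V.V) :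
    V.ρ (γ * γ') v = V.ρ γ (V.ρ γ' v) := by rw [map_mul]; rfl

theorem GalMod.ρ_one_apply (V : GalMod Γ d) (v : V.V) : V.ρ 1 v = v := by rw [map_one]; rfl

variable [IsTopologicalGroup Γ]

/-- Construction of a finite discrete module from an action by endomorphisms which is trivial on an
open neighbourhood of `1`. -/
def GalMod.ofEnd (V : Type) [AddCommGroup V] [Module (ZMod d) V] [Finite V]
    (ρ : Γ →* Module.End (ZMod d) V) (U : Set Γ) (hU : IsOpen U) (h1 : (1 : Γ) ∈ U)
    (h : ∀ γ ∈ U, ∀ v, ρ γ v = v) : GalMod Γ d where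
  V := V
  ρ := autOfEnd ρ
  isOpen_stabilizer := fun v => isOpen_stabilizer_of_mem _ v U hU h1 fun γ hγ => h γ hγ v

/-- The direct sum. -/
def GalMod.prod (V W : GalMod Γ d) : GalMod Γ d :=
  GalMod.ofEnd (V.V × W.V)
    { toFun := fun γ => (V.ρ γ).toLinearMap.prodMap (W.ρ γ).toLinearMap
      map_one' := by
        ext x <;> simp
      map_mul' := fun γ γ' => by
        ext x <;> simp }
    _ (V.isOpen_ker.inter W.isOpen_ker) ⟨V.ρ_one_apply, W.ρ_one_apply⟩
    fun _ hγ v => Prod.ext (hγ.1 v.1) (hγ.2 v.2)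

/-- The quotient by an invariant submodule. -/
def GalMod.quot (V : GalMod Γ d) (S : Submodule (ZMod d) V.V) (hS : ∀ γ, ∀ x ∈ S, V.ρ γ x ∈ S) :
    GalMod Γ d :=
  haveI : Finite (V.V ⧸ S) := Finite.of_surjective _ (Submodule.Quotient.mk_surjective S)
  GalMod.ofEnd (V.V ⧸ S)
    { toFun := fun γ => S.mapQ S (V.ρ γ).toLinearMap (hS γ)
      map_one' := by
        ext x; simp
      map_mul' := fun γ γ' => by
        ext x; simp }
    _ V.isOpen_ker V.ρ_one_apply fun γ hγ v => by
      obtain ⟨v, rfl⟩ := Submodule.Quotient.mk_surjective _ v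
      exact congrArg (Submodule.Quotient.mk (p := S)) (hγ v)

/-- An invariant submodule. -/
def GalMod.sub (V : GalMod Γ d) (S : Submodule (ZMod d) V.V) (hS : ∀ γ, ∀ x ∈ S, V.ρ γ x ∈ S) :
    GalMod Γ d :=
  GalMod.ofEnd S
    { toFun := fun γ => (V.ρ γ).toLinearMap.restrict (hS γ)
      map_one' := LinearMap.ext fun x => Subtype.ext (V.ρ_one_apply x.1)
      map_mul' := fun γ γ' => LinearMap.ext fun x => Subtype.ext (V.ρ_mul_apply γ γ' x.1) }
    _ V.isOpen_ker V.ρ_one_apply fun _ hγ v => Subtype.ext (hγ v.1)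

/-- The module `V` if `P` holds, and `0` otherwise, encoded as the module of functions from the
proofs of `P` to `V`. -/
def GalMod.cond (P : Prop) (V : GalMod Γ d) : GalMod Γ d :=
  GalMod.ofEnd (PLift P → V.V)
    { toFun := fun γ => LinearMap.pi fun h => (V.ρ γ).toLinearMap.comp (LinearMap.proj h)
      map_one' := LinearMap.ext fun x => funext fun h => V.ρ_one_apply (x h)
      map_mul' := fun γ γ' => LinearMap.ext fun x => funext fun h => V.ρ_mul_apply γ γ' (x h) }
    _ V.isOpen_ker V.ρ_one_apply fun _ hγ v => funext fun h => hγ (v h)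

/-- The free module of rank `r` with the trivial action. -/
def GalMod.triv (Γ : Type u) [Group Γ] [TopologicalSpace Γ] [IsTopologicalGroup Γ] (d : ℕ)
    [NeZero d] (r : ℕ) : GalMod Γ d :=
  GalMod.ofEnd (Fin r → ZMod d) 1 Set.univ isOpen_univ trivial fun _ _ _ => rfl

/-- The module of functions on the dual of `V`. It is free, and `Γ` acts on it through its action
on the dual. -/
def GalMod.funDual [NeZero d] (V : GalMod Γ d) : GalMod Γ d :=
  GalMod.ofEnd ((V.V →ₗ[ZMod d] ZMod d) → ZMod d)
    { toFun := fun γ => LinearMap.pi fun l => LinearMap.proj (l.comp (V.ρ γ).toLinearMap)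
      map_one' := by
        refine LinearMap.ext fun x => funext fun l => congrArg x (LinearMap.ext fun v => ?_)
        exact congrArg l (V.ρ_one_apply v)
      map_mul' := fun γ γ' => by
        refine LinearMap.ext fun x => funext fun l => congrArg x (LinearMap.ext fun v => ?_)
        exact congrArg l (V.ρ_mul_apply γ γ' v) }
    _ V.isOpen_ker V.ρ_one_apply fun γ hγ x => by
      refine funext fun l => congrArg x (LinearMap.ext fun v => ?_)
      exact congrArg l (hγ v)

/-- The free module on the set `V`. -/
def GalMod.freeOn [NeZero d] (V : GalMod Γ d) : GalMod Γ d :=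
  GalMod.ofEnd (V.V → ZMod d)
    { toFun := fun γ => LinearMap.funLeft (ZMod d) (ZMod d) fun v => V.ρ γ⁻¹ v
      map_one' := by
        refine LinearMap.ext fun x => funext fun v => congrArg x ?_
        rw [inv_one]; exact V.ρ_one_apply v
      map_mul' := fun γ γ' => by
        refine LinearMap.ext fun x => funext fun v => congrArg x ?_
        rw [mul_inv_rev]; exact V.ρ_mul_apply _ _ v }
    _ V.isOpen_ker V.ρ_one_apply fun γ hγ x => by
      refine funext fun v => congrArg x ?_
      have h := V.ρ_mul_apply γ⁻¹ γ v
      rw [inv_mul_cancel, V.ρ_one_apply, hγ v] at h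
      exact h.symm

end GaloisModules

/-! ### Exact sequences of Galois modules -/

section GaloisSequences

variable {Γ : Type u} [Group Γ] [TopologicalSpace Γ] {d N N' N'' : ℕ}

/-- A term of an exact sequence of Galois modules. -/
def GalExactSeq.term (E : GalExactSeq Γ d N) (i : ℕ) : GalMod Γ d where
  V := E.X i
  ρ := E.ρ i
  isOpen_stabilizer := E.isOpen_stabilizer i

/-- An exact sequence of Galois modules with prescribed terms. -/
def GalExactSeq.ofTerms (N : ℕ) (V : ℕ → GalMod Γ d)
    (f : ∀ i, (V i).V →ₗ[ZMod d] (V (i + 1)).V)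
    (equivariant : ∀ i γ x, f i ((V i).ρ γ x) = (V (i + 1)).ρ γ (f i x))
    (injective_zero : ∀ x, f 0 x = 0 → x = 0) (f_f : ∀ i x, f (i + 1) (f i x) = 0)
    (exact : ∀ i x, f (i + 1) x = 0 → ∃ y, f i y = x)
    (subsingleton : ∀ i, N < i → Subsingleton (V i).V) : GalExactSeq Γ d N where
  X := fun i => (V i).V
  f := f
  injective_zero := (injective_iff_map_eq_zero _).2 injective_zero
  exact := fun i x => ⟨exact i x, by rintro ⟨y, rfl⟩; exact f_f i y⟩
  subsingleton := subsingleton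
  ρ := fun i => (V i).ρ
  isOpen_stabilizer := fun i => (V i).isOpen_stabilizer
  equivariant := equivariant

theorem GalExactSeq.f_zero_eq_zero (E : GalExactSeq Γ d N) {x : E.X 0} (h : E.f 0 x = 0) : x = 0 :=
  (injective_iff_map_eq_zero _).1 E.injective_zero x h

theorem GalExactSeq.f_f (E : GalExactSeq Γ d N) (i : ℕ) (x : E.X i) :
    E.f (i + 1) (E.f i x) = 0 :=
  (E.exact i (E.f i x)).2 ⟨x, rfl⟩

theorem GalExactSeq.exists_f (E : GalExactSeq Γ d N) {i : ℕ} {x : E.X (i + 1)}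
    (h : E.f (i + 1) x = 0) : ∃ y, E.f i y = x := (E.exact i x).1 h

/-- An equivariant morphism of complexes between exact sequences, possibly of different lengths. -/
structure SeqHom (E : GalExactSeq Γ d N) (F : GalExactSeq Γ d N') where
  φ : ∀ i, E.X i →ₗ[ZMod d] F.X i
  equivariant : ∀ i γ x, φ i (E.ρ i γ x) = F.ρ i γ (φ i x)
  comm : ∀ i x, φ (i + 1) (E.f i x) = F.f i (φ i x)

/-- Composition of morphisms. -/
def SeqHom.comp {E : GalExactSeq Γ d N} {F : GalExactSeq Γ d N'} {G : GalExactSeq Γ d N''}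
    (β : SeqHom F G) (α : SeqHom E F) : SeqHom E G where
  φ := fun i => (β.φ i).comp (α.φ i)
  equivariant := fun i γ x => by
    simp only [LinearMap.comp_apply, α.equivariant, β.equivariant]
  comm := fun i x => by simp only [LinearMap.comp_apply, α.comm, β.comm]

/-- The identity. -/
def SeqHom.id (E : GalExactSeq Γ d N) : SeqHom E E where
  φ := fun _ => LinearMap.id
  equivariant := fun _ _ _ => rfl
  comm := fun _ _ => rfl

variable [IsTopologicalGroup Γ]

/-- The direct sum of two exact sequences. -/
def GalExactSeq.prod (E : GalExactSeq Γ d N) (F : GalExactSeq Γ d N') (M : ℕ) (hE : N ≤ M)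
    (hF : N' ≤ M) : GalExactSeq Γ d M :=
  GalExactSeq.ofTerms M (fun i => (E.term i).prod (F.term i))
    (fun i => (E.f i).prodMap (F.f i))
    (fun i γ x => Prod.ext (E.equivariant i γ x.1) (F.equivariant i γ x.2))
    (fun x h => Prod.ext (E.f_zero_eq_zero (congrArg Prod.fst h))
      (F.f_zero_eq_zero (congrArg Prod.snd h)))
    (fun i x => Prod.ext (E.f_f i x.1) (F.f_f i x.2))
    (fun i x h => by
      obtain ⟨y, hy⟩ := E.exists_f (congrArg Prod.fst h)
      obtain ⟨z, hz⟩ := F.exists_f (congrArg Prod.snd h)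
      exact ⟨(y, z), Prod.ext hy hz⟩)
    (fun i hi => by
      have := E.subsingleton i (by omega)
      have := F.subsingleton i (by omega)
      exact inferInstanceAs (Subsingleton (E.X i × F.X i)))

/-- The morphism to a direct sum with given components. -/
def SeqHom.prod {E : GalExactSeq Γ d N} {F : GalExactSeq Γ d N'} {G : GalExactSeq Γ d N''}
    (α : SeqHom E F) (β : SeqHom E G) {M : ℕ} (hF : N' ≤ M) (hG : N'' ≤ M) :
    SeqHom E (F.prod G M hF hG) where
  φ := fun i => (α.φ i).prod (β.φ i)
  equivariant := fun i γ x => Prod.ext (α.equivariant i γ x) (β.equivariant i γ x)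
  comm := fun i x => Prod.ext (α.comm i x) (β.comm i x)

/-- The contractible exact sequence with terms `W_i ⊕ W_{i+1}` and maps `(x, y) ↦ (y, 0)`. -/
def GalExactSeq.cone (N : ℕ) (W : ℕ → GalMod Γ d) (h0 : Subsingleton (W 0).V)
    (hW : ∀ i, N < i → Subsingleton (W i).V) : GalExactSeq Γ d N :=
  GalExactSeq.ofTerms N (fun i => (W i).prod (W (i + 1)))
    (fun i => (LinearMap.inl (ZMod d) (W (i + 1)).V (W (i + 2)).V).comp
      (LinearMap.snd (ZMod d) (W i).V (W (i + 1)).V))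
    (fun i γ x => Prod.ext rfl (map_zero ((W (i + 2)).ρ γ)).symm)
    (fun x h => Prod.ext (Subsingleton.elim (α := (W 0).V) _ _) (congrArg Prod.fst h))
    (fun _ _ => rfl)
    (fun i x h => ⟨((0 : (W i).V), x.1), Prod.ext rfl (congrArg Prod.fst h).symm⟩)
    (fun i hi => by
      have := hW i hi
      have := hW (i + 1) (by omega)
      exact inferInstanceAs (Subsingleton ((W i).V × (W (i + 1)).V)))

/-- The morphism to a contractible sequence with given first components. -/
def SeqHom.toCone (E : GalExactSeq Γ d N) {M : ℕ} {W : ℕ → GalMod Γ d}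
    {h0 : Subsingleton (W 0).V} {hW : ∀ i, M < i → Subsingleton (W i).V}
    (s : ∀ i, E.X i →ₗ[ZMod d] (W i).V)
    (hs : ∀ i γ x, s i (E.ρ i γ x) = (W i).ρ γ (s i x)) :
    SeqHom E (GalExactSeq.cone M W h0 hW) where
  φ := fun i => (s i).prod ((s (i + 1)).comp (E.f i))
  equivariant := fun i γ x => Prod.ext (hs i γ x) (by
    change s (i + 1) (E.f i (E.ρ i γ x)) = (W (i + 1)).ρ γ (s (i + 1) (E.f i x))
    rw [E.equivariant, hs])
  comm := fun i x => Prod.ext rfl (by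
    change s (i + 2) (E.f (i + 1) (E.f i x)) = 0
    rw [E.f_f, map_zero])

/-- The morphism from a contractible sequence with given restrictions to the second summands. -/
def SeqHom.ofCone (E : GalExactSeq Γ d N) {M : ℕ} {W : ℕ → GalMod Γ d}
    {h0 : Subsingleton (W 0).V} {hW : ∀ i, M < i → Subsingleton (W i).V}
    (t : ∀ i, (W (i + 1)).V →ₗ[ZMod d] E.X i)
    (ht : ∀ i γ x, t i ((W (i + 1)).ρ γ x) = E.ρ i γ (t i x)) :
    SeqHom (GalExactSeq.cone M W h0 hW) E where
  φ := fun i => match i with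
    | 0 => (t 0).comp (LinearMap.snd (ZMod d) (W 0).V (W 1).V)
    | i + 1 => ((E.f i).comp (t i)).coprod (t (i + 1))
  equivariant := fun i γ x => by
    cases i with
    | zero => exact ht 0 γ x.2
    | succ i =>
      change E.f i (t i ((W (i + 1)).ρ γ x.1)) + t (i + 1) ((W (i + 2)).ρ γ x.2) =
        E.ρ (i + 1) γ (E.f i (t i x.1) + t (i + 1) x.2)
      rw [ht, ht, E.equivariant, map_add]
  comm := fun i x => by
    cases i with
    | zero =>
      change E.f 0 (t 0 x.2) + t 1 0 = E.f 0 (t 0 x.2)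
      rw [map_zero, add_zero]
    | succ i =>
      change E.f (i + 1) (t (i + 1) x.2) + t (i + 2) 0 =
        E.f (i + 1) (E.f i (t i x.1) + t (i + 1) x.2)
      rw [map_zero, add_zero, map_add, E.f_f, zero_add]

section Pushout

variable {K : GalExactSeq Γ d N} {F : GalExactSeq Γ d N'} {E : GalExactSeq Γ d N''}

/-- The submodule of the elements `(α x, - β x)`. -/
def pushoutRel (α : SeqHom K F) (β : SeqHom K E) (i : ℕ) :
    Submodule (ZMod d) ((F.term i).prod (E.term i)).V :=
  ((α.φ i).prod (-β.φ i)).range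

/-- The pushout of `α : K → F` and `β : K → E` is exact if `K → F ⊕ E` is injective. -/
def GalExactSeq.pushout (α : SeqHom K F) (β : SeqHom K E) (M : ℕ)
    (hinj : ∀ i x, α.φ i x = 0 → β.φ i x = 0 → x = 0)
    (hM : ∀ i, M < i → ∀ (x : F.X i) (y : E.X i), ∃ z, α.φ i z = x ∧ β.φ i z = -y) :
    GalExactSeq Γ d M := by
  have hρ : ∀ i γ, ∀ x ∈ pushoutRel α β i,
      ((F.term i).prod (E.term i)).ρ γ x ∈ pushoutRel α β i := by
    rintro i γ _ ⟨z, rfl⟩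
    refine ⟨K.ρ i γ z, Prod.ext (α.equivariant i γ z) ?_⟩
    change -β.φ i (K.ρ i γ z) = E.ρ i γ (-β.φ i z)
    rw [β.equivariant, map_neg]
  have hf : ∀ i, pushoutRel α β i ≤ (pushoutRel α β (i + 1)).comap ((F.f i).prodMap (E.f i)) := by
    rintro i _ ⟨z, rfl⟩
    refine ⟨K.f i z, Prod.ext (α.comm i z) ?_⟩
    change -β.φ (i + 1) (K.f i z) = E.f i (-β.φ i z)
    rw [β.comm, map_neg]
  have key : ∀ i (x : F.X i) (y : E.X i),
      ((F.f i x, E.f i y) : F.X (i + 1) × E.X (i + 1)) ∈ pushoutRel α β (i + 1) →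
      ∃ z : K.X i, F.f i (x - α.φ i z) = 0 ∧ E.f i (y + β.φ i z) = 0 := by
    rintro i x y ⟨k, hk⟩
    have h1 : α.φ (i + 1) k = F.f i x := congrArg Prod.fst hk
    have h2 : -β.φ (i + 1) k = E.f i y := congrArg Prod.snd hk
    have h3 : K.f (i + 1) k = 0 := by
      apply hinj (i + 2)
      · rw [α.comm, h1, F.f_f]
      · rw [β.comm, ← neg_eq_zero, ← map_neg, h2, E.f_f]
    obtain ⟨z, rfl⟩ := K.exists_f h3
    refine ⟨z, ?_, ?_⟩
    · rw [map_sub, ← α.comm, h1, sub_self]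
    · rw [map_add, ← β.comm, ← h2, neg_add_cancel]
  exact GalExactSeq.ofTerms M
    (fun i => ((F.term i).prod (E.term i)).quot (pushoutRel α β i) (hρ i))
    (fun i => (pushoutRel α β i).mapQ (pushoutRel α β (i + 1)) ((F.f i).prodMap (E.f i)) (hf i))
    (fun i γ x => by
      obtain ⟨⟨x, y⟩, rfl⟩ := Submodule.Quotient.mk_surjective _ x
      exact congrArg (Submodule.Quotient.mk (p := pushoutRel α β (i + 1)))
        (Prod.ext (F.equivariant i γ x) (E.equivariant i γ y)))
    (fun x h => by
      obtain ⟨⟨x, y⟩, rfl⟩ := Submodule.Quotient.mk_surjective _ x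
      obtain ⟨z, h1, h2⟩ := key 0 x y ((Submodule.Quotient.mk_eq_zero _).1 h)
      refine (Submodule.Quotient.mk_eq_zero _).2 ⟨z, Prod.ext ?_ ?_⟩
      · exact (sub_eq_zero.1 (F.f_zero_eq_zero h1)).symm
      · exact (eq_neg_of_add_eq_zero_left (E.f_zero_eq_zero h2)).symm)
    (fun i x => by
      obtain ⟨⟨x, y⟩, rfl⟩ := Submodule.Quotient.mk_surjective _ x
      exact congrArg (Submodule.Quotient.mk (p := pushoutRel α β (i + 2)))
        (Prod.ext (F.f_f i x) (E.f_f i y)))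
    (fun i x h => by
      obtain ⟨⟨(x : F.X (i + 1)), (y : E.X (i + 1))⟩, rfl⟩ :=
        Submodule.Quotient.mk_surjective _ x
      obtain ⟨z, h1, h2⟩ := key (i + 1) x y ((Submodule.Quotient.mk_eq_zero _).1 h)
      obtain ⟨x', hx'⟩ := F.exists_f h1
      obtain ⟨y', hy'⟩ := E.exists_f h2
      refine ⟨Submodule.Quotient.mk (p := pushoutRel α β i) (x', y'), ?_⟩
      refine (Submodule.Quotient.eq (pushoutRel α β (i + 1))).2 ⟨-z, Prod.ext ?_ ?_⟩
      · change α.φ (i + 1) (-z) = F.f i x' - x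
        rw [hx', map_neg]; abel
      · change -β.φ (i + 1) (-z) = E.f i y' - y
        rw [hy', map_neg]; abel)
    (fun i hi => by
      refine ⟨fun x y => ?_⟩
      have h0 : ∀ x : ((F.term i).prod (E.term i)).V ⧸ pushoutRel α β i, x = 0 := fun x => by
        obtain ⟨⟨x, y⟩, rfl⟩ := Submodule.Quotient.mk_surjective _ x
        obtain ⟨z, h1, h2⟩ := hM i hi x y
        exact (Submodule.Quotient.mk_eq_zero _).2
          ⟨z, Prod.ext h1 ((congrArg Neg.neg h2).trans (neg_neg (y : E.X i)))⟩
      exact (h0 x).trans (h0 y).symm)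

variable (α : SeqHom K F) (β : SeqHom K E) (M : ℕ)
  (hinj : ∀ i x, α.φ i x = 0 → β.φ i x = 0 → x = 0)
  (hM : ∀ i, M < i → ∀ (x : F.X i) (y : E.X i), ∃ z, α.φ i z = x ∧ β.φ i z = -y)

/-- The first map to the pushout. -/
def SeqHom.pushoutInl : SeqHom F (GalExactSeq.pushout α β M hinj hM) where
  φ := fun i => (pushoutRel α β i).mkQ.comp (LinearMap.inl (ZMod d) (F.X i) (E.X i))
  equivariant := fun i γ _ => congrArg (Submodule.Quotient.mk (p := pushoutRel α β i))
    (Prod.ext rfl (map_zero (E.ρ i γ)).symm)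
  comm := fun i _ => congrArg (Submodule.Quotient.mk (p := pushoutRel α β (i + 1)))
    (Prod.ext rfl (map_zero (E.f i)).symm)

/-- The second map to the pushout. -/
def SeqHom.pushoutInr : SeqHom E (GalExactSeq.pushout α β M hinj hM) where
  φ := fun i => (pushoutRel α β i).mkQ.comp (LinearMap.inr (ZMod d) (F.X i) (E.X i))
  equivariant := fun i γ _ => congrArg (Submodule.Quotient.mk (p := pushoutRel α β i))
    (Prod.ext (map_zero (F.ρ i γ)).symm rfl)
  comm := fun i _ => congrArg (Submodule.Quotient.mk (p := pushoutRel α β (i + 1)))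
    (Prod.ext (map_zero (F.f i)).symm rfl)

theorem SeqHom.pushoutInl_bijective {i : ℕ} (h : Function.Bijective (β.φ i)) :
    Function.Bijective ((SeqHom.pushoutInl α β M hinj hM).φ i) := by
  constructor
  · refine (injective_iff_map_eq_zero _).2 fun x hx => ?_
    obtain ⟨z, hz⟩ := (Submodule.Quotient.mk_eq_zero (pushoutRel α β i)).1 hx
    have h1 : α.φ i z = x := congrArg Prod.fst hz
    have h2 : -β.φ i z = 0 := congrArg Prod.snd hz
    rw [← h1, (injective_iff_map_eq_zero _).1 h.1 z (neg_eq_zero.1 h2), map_zero]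
  · intro x
    obtain ⟨⟨(x : F.X i), (y : E.X i)⟩, rfl⟩ := Submodule.Quotient.mk_surjective _ x
    obtain ⟨z, rfl⟩ := h.2 y
    refine ⟨x + α.φ i z, (Submodule.Quotient.eq (pushoutRel α β i)).2 ⟨z, Prod.ext ?_ ?_⟩⟩
    · change α.φ i z = x + α.φ i z - x
      abel
    · change -β.φ i z = 0 - β.φ i z
      abel

theorem SeqHom.pushoutInr_bijective {i : ℕ} (h : Function.Bijective (α.φ i)) :
    Function.Bijective ((SeqHom.pushoutInr α β M hinj hM).φ i) := by
  constructor
  · refine (injective_iff_map_eq_zero _).2 fun x hx => ?_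
    obtain ⟨z, hz⟩ := (Submodule.Quotient.mk_eq_zero (pushoutRel α β i)).1 hx
    have h1 : α.φ i z = 0 := congrArg Prod.fst hz
    have h2 : -β.φ i z = x := congrArg Prod.snd hz
    rw [← h2, (injective_iff_map_eq_zero _).1 h.1 z h1, map_zero, neg_zero]
  · intro x
    obtain ⟨⟨(x : F.X i), (y : E.X i)⟩, rfl⟩ := Submodule.Quotient.mk_surjective _ x
    obtain ⟨z, rfl⟩ := h.2 x
    refine ⟨y + β.φ i z, (Submodule.Quotient.eq (pushoutRel α β i)).2 ⟨-z, Prod.ext ?_ ?_⟩⟩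
    · change α.φ i (-z) = 0 - α.φ i z
      rw [map_neg]; abel
    · change -β.φ i (-z) = y + β.φ i z - y
      rw [map_neg]; abel

end Pushout

section Pullback

variable {Q : GalExactSeq Γ d N} {F : GalExactSeq Γ d N'} {E : GalExactSeq Γ d N''}

/-- The submodule of the pairs `(x, y)` with `α x = β y`. -/
def pullbackSub (α : SeqHom F Q) (β : SeqHom E Q) (i : ℕ) :
    Submodule (ZMod d) ((F.term i).prod (E.term i)).V :=
  ((α.φ i).coprod (-β.φ i)).ker

theorem mem_pullbackSub {α : SeqHom F Q} {β : SeqHom E Q} {i : ℕ}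
    {x : ((F.term i).prod (E.term i)).V} :
    x ∈ pullbackSub α β i ↔ α.φ i x.1 = β.φ i x.2 := by
  change α.φ i x.1 + -β.φ i x.2 = 0 ↔ _
  rw [← sub_eq_add_neg, sub_eq_zero]

/-- The fibre product of `α : F → Q` and `β : E → Q` is exact if `F ⊕ E → Q` is surjective. -/
def GalExactSeq.pullback (α : SeqHom F Q) (β : SeqHom E Q) (M : ℕ)
    (hsurj : ∀ i z, ∃ x y, α.φ i x - β.φ i y = z) (hF : N' ≤ M) (hE : N'' ≤ M) :
    GalExactSeq Γ d M := by
  have hρ : ∀ i γ, ∀ x ∈ pullbackSub α β i,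
      ((F.term i).prod (E.term i)).ρ γ x ∈ pullbackSub α β i := by
    intro i γ x h
    refine mem_pullbackSub.2 ?_
    change α.φ i (F.ρ i γ x.1) = β.φ i (E.ρ i γ x.2)
    exact (α.equivariant i γ x.1).trans ((congrArg (Q.ρ i γ) (mem_pullbackSub.1 h)).trans
      (β.equivariant i γ x.2).symm)
  have hf : ∀ i, ∀ x ∈ pullbackSub α β i,
      ((F.f i).prodMap (E.f i)) x ∈ pullbackSub α β (i + 1) := by
    intro i x h
    refine mem_pullbackSub.2 ?_
    change α.φ (i + 1) (F.f i x.1) = β.φ (i + 1) (E.f i x.2)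
    exact (α.comm i x.1).trans ((congrArg (Q.f i) (mem_pullbackSub.1 h)).trans
      (β.comm i x.2).symm)
  exact GalExactSeq.ofTerms M
    (fun i => ((F.term i).prod (E.term i)).sub (pullbackSub α β i) (hρ i))
    (fun i => ((F.f i).prodMap (E.f i)).restrict (hf i))
    (fun i γ x => Subtype.ext (Prod.ext (F.equivariant i γ x.1.1) (E.equivariant i γ x.1.2)))
    (fun x h => by
      have h' := congrArg Subtype.val h
      exact Subtype.ext (Prod.ext (F.f_zero_eq_zero (congrArg Prod.fst h'))
        (E.f_zero_eq_zero (congrArg Prod.snd h'))))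
    (fun i x => Subtype.ext (Prod.ext (F.f_f i x.1.1) (E.f_f i x.1.2)))
    (fun i x h => by
      have h' := congrArg Subtype.val h
      obtain ⟨x', hx'⟩ := F.exists_f (i := i) (x := x.1.1) (congrArg Prod.fst h')
      obtain ⟨y', hy'⟩ := E.exists_f (i := i) (x := x.1.2) (congrArg Prod.snd h')
      have hx := mem_pullbackSub.1 x.2
      have h0 : Q.f i (α.φ i x' - β.φ i y') = 0 := by
        rw [map_sub, ← α.comm, ← β.comm, hx', hy', hx, sub_self]
      -- correct `(x', y')` by a boundary
      obtain ⟨x'', y'', h1, h2, h3⟩ : ∃ (x'' : F.X i) (y'' : E.X i), F.f i x'' = 0 ∧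
          E.f i y'' = 0 ∧ α.φ i x'' - β.φ i y'' = α.φ i x' - β.φ i y' := by
        cases i with
        | zero => exact ⟨0, 0, map_zero _, map_zero _, by
            rw [Q.f_zero_eq_zero h0, map_zero, map_zero, sub_zero]⟩
        | succ i =>
          obtain ⟨q, hq⟩ := Q.exists_f h0
          obtain ⟨u, v, rfl⟩ := hsurj i q
          exact ⟨F.f i u, E.f i v, F.f_f i u, E.f_f i v, by rw [← hq, map_sub, α.comm, β.comm]⟩
      refine ⟨⟨(x' - x'', y' - y''), mem_pullbackSub.2 ?_⟩, Subtype.ext (Prod.ext ?_ ?_)⟩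
      · change α.φ i (x' - x'') = β.φ i (y' - y'')
        rw [map_sub, map_sub, sub_eq_sub_iff_sub_eq_sub, ← h3]
      · change F.f i (x' - x'') = x.1.1
        rw [map_sub, h1, sub_zero, hx']
      · change E.f i (y' - y'') = x.1.2
        rw [map_sub, h2, sub_zero, hy'])
    (fun i hi => by
      have := F.subsingleton i (by omega)
      have := E.subsingleton i (by omega)
      have : Subsingleton ((F.term i).prod (E.term i)).V :=
        inferInstanceAs (Subsingleton (F.X i × E.X i))
      exact inferInstanceAs (Subsingleton (pullbackSub α β i)))

variable (α : SeqHom F Q) (β : SeqHom E Q) (M : ℕ)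
  (hsurj : ∀ i z, ∃ x y, α.φ i x - β.φ i y = z) (hF : N' ≤ M) (hE : N'' ≤ M)

/-- The first projection from the fibre product. -/
def SeqHom.pullbackFst : SeqHom (GalExactSeq.pullback α β M hsurj hF hE) F where
  φ := fun i => (LinearMap.fst (ZMod d) (F.X i) (E.X i)).comp (pullbackSub α β i).subtype
  equivariant := fun _ _ _ => rfl
  comm := fun _ _ => rfl

/-- The second projection from the fibre product. -/
def SeqHom.pullbackSnd : SeqHom (GalExactSeq.pullback α β M hsurj hF hE) E where
  φ := fun i => (LinearMap.snd (ZMod d) (F.X i) (E.X i)).comp (pullbackSub α β i).subtype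
  equivariant := fun _ _ _ => rfl
  comm := fun _ _ => rfl

/-- The morphism to the fibre product with given components. -/
def SeqHom.pullbackLift {L : ℕ} {G : GalExactSeq Γ d L} (a : SeqHom G F) (b : SeqHom G E)
    (h : ∀ i x, α.φ i (a.φ i x) = β.φ i (b.φ i x)) :
    SeqHom G (GalExactSeq.pullback α β M hsurj hF hE) where
  φ := fun i => ((a.φ i).prod (b.φ i)).codRestrict (pullbackSub α β i)
    fun x => mem_pullbackSub.2 (h i x)
  equivariant := fun i γ x => Subtype.ext (Prod.ext (a.equivariant i γ x) (b.equivariant i γ x))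
  comm := fun i x => Subtype.ext (Prod.ext (a.comm i x) (b.comm i x))

theorem SeqHom.pullbackFst_bijective {i : ℕ} (h : Function.Bijective (β.φ i)) :
    Function.Bijective ((SeqHom.pullbackFst α β M hsurj hF hE).φ i) := by
  constructor
  · rintro ⟨x, hx⟩ ⟨y, hy⟩ hxy
    have h1 : x.1 = y.1 := hxy
    have h2 := mem_pullbackSub.1 hx
    have h3 := mem_pullbackSub.1 hy
    exact Subtype.ext (Prod.ext h1 (h.1 (by rw [← h2, ← h3, h1])))
  · intro x
    obtain ⟨y, hy⟩ := h.2 (α.φ i x)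
    exact ⟨⟨(x, y), mem_pullbackSub.2 hy.symm⟩, rfl⟩

theorem SeqHom.pullbackSnd_bijective {i : ℕ} (h : Function.Bijective (α.φ i)) :
    Function.Bijective ((SeqHom.pullbackSnd α β M hsurj hF hE).φ i) := by
  constructor
  · rintro ⟨x, hx⟩ ⟨y, hy⟩ hxy
    have h1 : x.2 = y.2 := hxy
    have h2 := mem_pullbackSub.1 hx
    have h3 := mem_pullbackSub.1 hy
    exact Subtype.ext (Prod.ext (h.1 (by rw [h2, h3, h1])) h1)
  · intro y
    obtain ⟨x, hx⟩ := h.2 (β.φ i y)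
    exact ⟨⟨(x, y), mem_pullbackSub.2 hx⟩, rfl⟩

end Pullback

end GaloisSequences

/-! ### Extensions which come from shorter ones -/

section Shortening

variable {Γ : Type u} [Group Γ] [TopologicalSpace Γ] [IsTopologicalGroup Γ] {d n N N' : ℕ}

theorem GalMod.subsingleton_cond {P : Prop} (hP : ¬ P) (V : GalMod Γ d) :
    Subsingleton (GalMod.cond P V).V :=
  haveI : IsEmpty (PLift P) := ⟨fun h => hP h.down⟩
  inferInstanceAs (Subsingleton (PLift P → V.V))

/-- The canonical map from `V` to `GalMod.cond P V`. -/
def GalMod.toCond (P : Prop) (V : GalMod Γ d) : V.V →ₗ[ZMod d] (GalMod.cond P V).V :=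
  LinearMap.pi fun _ => LinearMap.id

theorem GalMod.toCond_bijective {P : Prop} (hP : P) (V : GalMod Γ d) :
    Function.Bijective (GalMod.toCond P V) :=
  ⟨fun _ _ h => congrFun h ⟨hP⟩, fun x => ⟨x ⟨hP⟩, rfl⟩⟩

/-- The isomorphism from `GalMod.cond P V` to `V` if `P` holds. -/
def GalMod.evalCond {P : Prop} (hP : P) (V : GalMod Γ d) : (GalMod.cond P V).V →ₗ[ZMod d] V.V :=
  LinearMap.proj (φ := fun _ : PLift P => V.V) ⟨hP⟩

open Classical in
/-- The map from `GalMod.cond P V` to `V`, which is zero if `P` does not hold. -/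
def GalMod.ofCond (P : Prop) (V : GalMod Γ d) : (GalMod.cond P V).V →ₗ[ZMod d] V.V :=
  if h : P then GalMod.evalCond h V else 0

theorem GalMod.ofCond_apply {P : Prop} (hP : P) (V : GalMod Γ d) (x : PLift P → V.V) :
    GalMod.ofCond P V x = x ⟨hP⟩ := by
  rw [GalMod.ofCond, dif_pos hP]; rfl

theorem GalMod.ofCond_bijective {P : Prop} (hP : P) (V : GalMod Γ d) :
    Function.Bijective (GalMod.ofCond P V) := by
  constructor
  · intro x y h
    exact funext fun _ => (GalMod.ofCond_apply hP V x).symm.trans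
      (h.trans (GalMod.ofCond_apply hP V y))
  · exact fun v => ⟨fun _ => v, GalMod.ofCond_apply hP V _⟩

theorem GalMod.ofCond_equivariant (P : Prop) (V : GalMod Γ d) (γ : Γ) (x : (GalMod.cond P V).V) :
    GalMod.ofCond P V ((GalMod.cond P V).ρ γ x) = V.ρ γ (GalMod.ofCond P V x) := by
  by_cases hP : P
  · exact (GalMod.ofCond_apply hP V _).trans
      (congrArg (V.ρ γ) (GalMod.ofCond_apply hP V x)).symm
  · rw [GalMod.ofCond, dif_neg hP]
    exact (map_zero (V.ρ γ)).symm

/-- The map induced on `GalMod.cond P`. -/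
def GalMod.condMap (P : Prop) {V W : GalMod Γ d} (t : V.V →ₗ[ZMod d] W.V) :
    (GalMod.cond P V).V →ₗ[ZMod d] (GalMod.cond P W).V :=
  LinearMap.pi fun h => t.comp (LinearMap.proj h)

theorem subsingleton_cond_prod {P Q : Prop} (hP : ¬ P) (hQ : ¬ Q) (V W : GalMod Γ d) :
    Subsingleton ((GalMod.cond P V).prod (GalMod.cond Q W)).V :=
  haveI := GalMod.subsingleton_cond hP V
  haveI := GalMod.subsingleton_cond hQ W
  inferInstanceAs (Subsingleton ((GalMod.cond P V).V × (GalMod.cond Q W).V))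

theorem bijective_of_subsingleton {α β : Type*} [Zero α] [Subsingleton α] [Subsingleton β]
    (f : α → β) : Function.Bijective f :=
  ⟨fun _ _ _ => Subsingleton.elim _ _, fun _ => ⟨0, Subsingleton.elim _ _⟩⟩

theorem bijective_pair {α β γ : Type*} {f : α → β} (g : α → γ) [Subsingleton γ]
    (hf : Function.Bijective f) : Function.Bijective fun x => (f x, g x) :=
  ⟨fun _ _ h => hf.1 (congrArg Prod.fst h), fun y =>
    ⟨(hf.2 y.1).choose, Prod.ext (hf.2 y.1).choose_spec (Subsingleton.elim _ _)⟩⟩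

theorem bijective_pair' {α β γ : Type*} (f : α → β) {g : α → γ} [Subsingleton β]
    (hg : Function.Bijective g) : Function.Bijective fun x => (f x, g x) :=
  ⟨fun _ _ h => hg.1 (congrArg Prod.snd h), fun y =>
    ⟨(hg.2 y.2).choose, Prod.ext (Subsingleton.elim _ _) (hg.2 y.2).choose_spec⟩⟩

theorem GalExactSeq.f_surjective (E : GalExactSeq Γ d (N + 1)) : Function.Surjective (E.f N) :=
  fun _ => E.exists_f ((E.subsingleton (N + 1 + 1) (by omega)).elim _ _)

/-- The contractible sequence with the term `V` in the positions `p` and `p - 1`. -/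
abbrev GalExactSeq.coneAt (M p : ℕ) (V : ℕ → GalMod Γ d) (h0 : p ≠ 0) (hp : p ≤ M) :
    GalExactSeq Γ d M :=
  GalExactSeq.cone M (fun i => GalMod.cond (i = p) (V i)) (GalMod.subsingleton_cond h0.symm _)
    (fun _ hi => GalMod.subsingleton_cond (by omega) _)

theorem GalExactSeq.subsingleton_coneAt {M p : ℕ} {V : ℕ → GalMod Γ d} (h0 : p ≠ 0) (hp : p ≤ M)
    {i : ℕ} (h1 : i ≠ p) (h2 : i + 1 ≠ p) :
    Subsingleton ((GalExactSeq.coneAt M p V h0 hp).X i) :=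
  subsingleton_cond_prod h1 h2 _ _

/-- The morphism of contractible sequences induced by morphisms of their constituents. -/
def SeqHom.coneMap {M : ℕ} {W W' : ℕ → GalMod Γ d} {h0 : Subsingleton (W 0).V}
    {hW : ∀ i, M < i → Subsingleton (W i).V} {h0' : Subsingleton (W' 0).V}
    {hW' : ∀ i, M < i → Subsingleton (W' i).V}
    (t : ∀ i, (W i).V →ₗ[ZMod d] (W' i).V) (ht : ∀ i γ x, t i ((W i).ρ γ x) = (W' i).ρ γ (t i x)) :
    SeqHom (GalExactSeq.cone M W h0 hW) (GalExactSeq.cone M W' h0' hW') where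
  φ := fun i => (t i).prodMap (t (i + 1))
  equivariant := fun i γ x => Prod.ext (ht i γ x.1) (ht (i + 1) γ x.2)
  comm := fun i _ => Prod.ext rfl (map_zero (t (i + 2)))

/-- The morphism `E → coneAt p E_p`, which is an isomorphism in position `p` if `E_{p+1} = 0`. -/
def SeqHom.toConeAt (E : GalExactSeq Γ d N) {M p : ℕ} (h0 : p ≠ 0) (hp : p ≤ M) :
    SeqHom E (GalExactSeq.coneAt M p E.term h0 hp) :=
  SeqHom.toCone E (fun i => GalMod.toCond (i = p) (E.term i)) fun _ _ _ => rfl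

theorem SeqHom.toConeAt_bijective (E : GalExactSeq Γ d N) {M p : ℕ} (h0 : p ≠ 0) (hp : p ≤ M) :
    Function.Bijective ((SeqHom.toConeAt E h0 hp).φ p) :=
  haveI : Subsingleton (GalMod.cond (p + 1 = p) (E.term (p + 1))).V :=
    GalMod.subsingleton_cond (by omega) _
  bijective_pair _ (GalMod.toCond_bijective rfl (E.term p))

/-- An exact sequence `0 → E_0 → ⋯ → E_{n+1} → 0` comes from a shorter one if it maps to an exact
sequence `0 → F_0 → ⋯ → F_n → 0`, with `E_0 = F_0` and `E_n = F_n`. This happens if and only if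
the class of the corresponding `n`-extension vanishes. -/
def IsShortenable (E : GalExactSeq Γ d (n + 1)) : Prop :=
  ∃ (F : GalExactSeq Γ d n) (φ : SeqHom E F),
    Function.Bijective (φ.φ 0) ∧ Function.Bijective (φ.φ n)

section Thicken

variable {E : GalExactSeq Γ d (n + 1)} {F : GalExactSeq Γ d n} (φ : SeqHom E F)
  (V : ℕ → GalMod Γ d) (s : ∀ i, E.X i →ₗ[ZMod d] (V i).V)
  (hs : ∀ i γ x, s i (E.ρ i γ x) = (V i).ρ γ (s i x))

/-- The contractible sequence whose constituents are the `V_i`, `2 ≤ i < n`. -/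
abbrev middleCone (n : ℕ) (V : ℕ → GalMod Γ d) : GalExactSeq Γ d n :=
  GalExactSeq.cone n (fun i => GalMod.cond (2 ≤ i ∧ i < n) (V i))
    (GalMod.subsingleton_cond (by omega) _) fun _ _ => GalMod.subsingleton_cond (by omega) _

theorem subsingleton_middleCone {i : ℕ} (hi : i = 0 ∨ n ≤ i) :
    Subsingleton ((middleCone n V).X i) :=
  subsingleton_cond_prod (by omega) (by omega) _ _

/-- Addition of a contractible sequence to the target of a morphism. -/
def SeqHom.thicken : SeqHom E (F.prod (middleCone n V) n le_rfl le_rfl) :=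
  φ.prod (SeqHom.toCone E (fun i => (GalMod.toCond (2 ≤ i ∧ i < n) (V i)).comp (s i))
    fun i γ x => funext fun _ => hs i γ x) le_rfl le_rfl

theorem SeqHom.thicken_bijective {i : ℕ} (hi : i = 0 ∨ n ≤ i)
    (h : Function.Bijective (φ.φ i)) : Function.Bijective ((φ.thicken V s hs).φ i) :=
  haveI := subsingleton_middleCone (n := n) V hi
  bijective_pair (γ := (middleCone n V).X i) _ h

/-- Injectivity has to be checked only on the kernel of `E_i → V_i ⊕ V_{i+1}`, which is zero for
`2 ≤ i < n`, and consists of cycles for `i = 1`. -/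
theorem SeqHom.thicken_injective (hn : 2 ≤ n) (h0 : Function.Bijective (φ.φ 0))
    (hlast : Function.Bijective (φ.φ n)) (hinj : ∀ i, Function.Injective (s i)) (i : ℕ)
    (hi : i ≤ n) : Function.Injective ((φ.thicken V s hs).φ i) := by
  rcases Nat.eq_zero_or_pos i with rfl | hi0
  · exact (φ.thicken_bijective V s hs (.inl rfl) h0).1
  rcases hi.eq_or_lt with rfl | hin
  · exact (φ.thicken_bijective V s hs (.inr le_rfl) hlast).1
  refine (injective_iff_map_eq_zero _).2 fun x hx => ?_
  have h1 : φ.φ i x = 0 := congrArg (fun y : F.X i × (middleCone n V).X i => y.1) hx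
  have h2 : ∀ _ : PLift (2 ≤ i ∧ i < n), s i x = 0 := fun h =>
    congrFun (congrArg (fun y : F.X i × ((PLift (2 ≤ i ∧ i < n) → (V i).V) ×
      (PLift (2 ≤ i + 1 ∧ i + 1 < n) → (V (i + 1)).V)) => y.2.1) hx) h
  have h3 : ∀ _ : PLift (2 ≤ i + 1 ∧ i + 1 < n), s (i + 1) (E.f i x) = 0 := fun h =>
    congrFun (congrArg (fun y : F.X i × ((PLift (2 ≤ i ∧ i < n) → (V i).V) ×
      (PLift (2 ≤ i + 1 ∧ i + 1 < n) → (V (i + 1)).V)) => y.2.2) hx) h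
  by_cases hi2 : 2 ≤ i
  · exact (injective_iff_map_eq_zero _).1 (hinj i) x (h2 ⟨hi2, hin⟩)
  obtain rfl : i = 1 := by omega
  -- in position `1`, the kernel is contained in the image of `E_0`
  have h4 : E.f 1 x = 0 := by
    by_cases hn2 : 2 < n
    · exact (injective_iff_map_eq_zero _).1 (hinj 2) _ (h3 ⟨by omega, by omega⟩)
    · obtain rfl : n = 2 := by omega
      exact (injective_iff_map_eq_zero _).1 hlast.1 _ (by rw [φ.comm, h1, map_zero])
  obtain ⟨y, rfl⟩ := E.exists_f h4
  rw [φ.comm] at h1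
  rw [(injective_iff_map_eq_zero _).1 h0.1 y (F.f_zero_eq_zero h1), map_zero]

end Thicken

/-- The morphism to the shorter sequence can be made injective by addition of a contractible
sequence to its target. -/
theorem IsShortenable.exists_injective (hn : 2 ≤ n) {E : GalExactSeq Γ d (n + 1)}
    (h : IsShortenable E) : ∃ (F : GalExactSeq Γ d n) (φ : SeqHom E F),
      Function.Bijective (φ.φ 0) ∧ Function.Bijective (φ.φ n) ∧
      ∀ i, i ≤ n → Function.Injective (φ.φ i) := by
  obtain ⟨F, φ, h0, hlast⟩ := h
  exact ⟨_, φ.thicken E.term (fun _ => LinearMap.id) fun _ _ _ => rfl,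
    φ.thicken_bijective _ _ _ (.inl rfl) h0, φ.thicken_bijective _ _ _ (.inr le_rfl) hlast,
    φ.thicken_injective _ _ _ hn h0 hlast fun _ => Function.injective_id⟩

/-- Pullback of shorter sequences along a morphism. -/
theorem IsShortenable.of_hom (hn : 2 ≤ n) {E E' : GalExactSeq Γ d (n + 1)} (u : SeqHom E E')
    (hu : Function.Bijective (u.φ 0)) (h : IsShortenable E') : IsShortenable E := by
  obtain ⟨F, φ, h0, hlast⟩ := h
  have hn0 : n ≠ 0 := by omega
  -- the sequence `F` is pulled back along `E_n → F_n`
  let α : SeqHom F (GalExactSeq.coneAt n n F.term hn0 le_rfl) := SeqHom.toConeAt F hn0 le_rfl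
  let β : SeqHom (GalExactSeq.coneAt n n E.term hn0 le_rfl)
      (GalExactSeq.coneAt n n F.term hn0 le_rfl) :=
    SeqHom.coneMap (fun i => GalMod.condMap (V := E.term i) (W := F.term i) (i = n)
      ((φ.comp u).φ i)) fun i γ (x : PLift (i = n) → E.X i) =>
        funext fun h => (φ.comp u).equivariant i γ (x h)
  have hsurj : ∀ i z, ∃ x y, α.φ i x - β.φ i y = z := by
    intro i z
    suffices h : ∃ x, α.φ i x = z by
      obtain ⟨x, hx⟩ := h
      exact ⟨x, 0, by rw [map_zero, sub_zero, hx]⟩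
    by_cases hi : i = n
    · subst hi
      exact (SeqHom.toConeAt_bijective F hn0 le_rfl).2 z
    by_cases hi' : i + 1 = n
    · subst hi'
      obtain ⟨x, hx⟩ := F.f_surjective (z.2 ⟨rfl⟩)
      refine ⟨x, Prod.ext ?_ (funext fun _ => hx)⟩
      exact (GalMod.subsingleton_cond hi (F.term i)).elim _ _
    · exact ⟨0, (GalExactSeq.subsingleton_coneAt hn0 le_rfl hi hi').elim _ _⟩
  refine ⟨GalExactSeq.pullback α β n hsurj le_rfl le_rfl,
    SeqHom.pullbackLift α β n hsurj le_rfl le_rfl (φ.comp u) (SeqHom.toConeAt E hn0 le_rfl)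
      fun _ _ => Prod.ext rfl (funext fun _ => ?_), ?_, ?_⟩
  · exact ((φ.comp u).comm _ _).symm
  · have h1 := SeqHom.pullbackFst_bijective α β n hsurj le_rfl le_rfl (i := 0) (by
      have := GalExactSeq.subsingleton_coneAt (V := E.term) hn0 le_rfl (i := 0) (by omega)
        (by omega)
      have := GalExactSeq.subsingleton_coneAt (V := F.term) hn0 le_rfl (i := 0) (by omega)
        (by omega)
      exact bijective_of_subsingleton _)
    exact (Function.Bijective.of_comp_iff' h1 _).1 (h0.comp hu)
  · have h1 := SeqHom.pullbackSnd_bijective α β n hsurj le_rfl le_rfl (i := n)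
      (SeqHom.toConeAt_bijective F hn0 le_rfl)
    exact (Function.Bijective.of_comp_iff' h1 _).1 (SeqHom.toConeAt_bijective E hn0 le_rfl)

/-- Pushout of shorter sequences along a morphism. -/
theorem IsShortenable.map (hn : 2 ≤ n) {E E' : GalExactSeq Γ d (n + 1)} (u : SeqHom E E')
    (hu : Function.Bijective (u.φ (n + 1))) (h : IsShortenable E) :
    IsShortenable E' := by
  obtain ⟨F, φ, h0, hlast, hinj⟩ := h.exists_injective hn
  have h1 : ∀ i x, φ.φ i x = 0 → u.φ i x = 0 → x = 0 := by
    intro i x hx hx'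
    rcases le_or_gt i n with hi | hi
    · exact (injective_iff_map_eq_zero _).1 (hinj i hi) x hx
    rcases (Nat.succ_le_of_lt hi).eq_or_lt with rfl | hi
    · exact (injective_iff_map_eq_zero _).1 hu.1 x hx'
    · exact (E.subsingleton i hi).elim _ _
  have h2 : ∀ i, n < i → ∀ (x : F.X i) (y : E'.X i), ∃ z, φ.φ i z = x ∧ u.φ i z = -y := by
    intro i hi x y
    have := F.subsingleton i hi
    rcases (Nat.succ_le_of_lt hi).eq_or_lt with rfl | hi
    · obtain ⟨z, hz⟩ := hu.2 (-y)
      exact ⟨z, Subsingleton.elim _ _, hz⟩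
    · exact ⟨0, Subsingleton.elim _ _, (E'.subsingleton i hi).elim _ _⟩
  exact ⟨GalExactSeq.pushout φ u n h1 h2, SeqHom.pushoutInr φ u n h1 h2,
    SeqHom.pushoutInr_bijective φ u n h1 h2 h0, SeqHom.pushoutInr_bijective φ u n h1 h2 hlast⟩

/-- If `T_0 → T_1` is bijective, then `T` maps to the shorter sequence with `T_0 = T_1` on the left
and `T_n = T_n` on the right. -/
theorem isShortenable_of_bijective (hn : 2 ≤ n) (T : GalExactSeq Γ d (n + 1))
    (hT : Function.Bijective (T.f 0)) : IsShortenable T := by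
  refine ⟨GalExactSeq.cone n (fun i => GalMod.cond (i = 1 ∨ i = n) (T.term i))
    (GalMod.subsingleton_cond (by omega) _) (fun _ _ => GalMod.subsingleton_cond (by omega) _),
    SeqHom.toCone T (fun i => GalMod.toCond (i = 1 ∨ i = n) (T.term i)) fun _ _ _ => rfl, ?_, ?_⟩
  · have := GalMod.subsingleton_cond (P := 0 = 1 ∨ 0 = n) (by omega) (T.term 0)
    exact bijective_pair' _ ((GalMod.toCond_bijective (.inl rfl) (T.term 1)).comp hT)
  · have := GalMod.subsingleton_cond (P := n + 1 = 1 ∨ n + 1 = n) (by omega) (T.term (n + 1))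
    exact bijective_pair _ (GalMod.toCond_bijective (.inr rfl) (T.term n))

/-- A sequence which comes from a shorter one is equivalent to a trivial one. If `E` maps to `F`,
both `E` and the trivial sequence with the terms `F_0 = F_0` and `E_{n+1} = E_{n+1}` map to the
sequence `G`, the direct sum of `F` and `E_{n+1} = E_{n+1}`. -/
theorem IsShortenable.exists_trivial (hn : 2 ≤ n) {E : GalExactSeq Γ d (n + 1)}
    (h : IsShortenable E) : ∃ (G T : GalExactSeq Γ d (n + 1)) (u : SeqHom E G) (v : SeqHom T G),
      Function.Bijective (u.φ 0) ∧ Function.Bijective (u.φ (n + 1)) ∧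
      Function.Bijective (v.φ 0) ∧ Function.Bijective (v.φ (n + 1)) ∧
      Function.Bijective (T.f 0) ∧ (∀ i, 2 ≤ i → i < n → Subsingleton (T.X i)) ∧
      Function.Bijective (T.f n) := by
  obtain ⟨F, φ, h0, -⟩ := h
  have hn0 : n + 1 ≠ 0 := by omega
  let C := GalExactSeq.coneAt (n + 1) (n + 1) E.term hn0 le_rfl
  let G := F.prod C (n + 1) (by omega) le_rfl
  let W : ℕ → GalMod Γ d := fun i =>
    (GalMod.cond (i = 1) (F.term (i - 1))).prod (GalMod.cond (i = n + 1) (E.term i))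
  have hW : ∀ i, i ≠ 1 → i ≠ n + 1 → Subsingleton (W i).V := fun i h1 h2 =>
    subsingleton_cond_prod h1 h2 _ _
  let T := GalExactSeq.cone (n + 1) W (hW 0 (by omega) (by omega))
    fun i hi => hW i (by omega) (by omega)
  have hC0 : Subsingleton (C.X 0) :=
    GalExactSeq.subsingleton_coneAt hn0 le_rfl (by omega) (by omega)
  have hF : Subsingleton (F.X (n + 1)) := F.subsingleton (n + 1) (by omega)
  let v : SeqHom T G := SeqHom.ofCone G
    (fun i => ((GalMod.ofCond (i + 1 = 1) (F.term i)).comp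
        (LinearMap.fst (ZMod d) (GalMod.cond (i + 1 = 1) (F.term i)).V
          (GalMod.cond (i + 1 = n + 1) (E.term (i + 1))).V)).prod
      ((LinearMap.inr (ZMod d) (GalMod.cond (i = n + 1) (E.term i)).V
          (GalMod.cond (i + 1 = n + 1) (E.term (i + 1))).V).comp
        (LinearMap.snd (ZMod d) (GalMod.cond (i + 1 = 1) (F.term i)).V
          (GalMod.cond (i + 1 = n + 1) (E.term (i + 1))).V)))
    fun i γ x => Prod.ext (GalMod.ofCond_equivariant _ _ γ x.1)
      (Prod.ext (map_zero ((GalMod.cond (i = n + 1) (E.term i)).ρ γ)).symm rfl)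
  refine ⟨G, T, φ.prod (SeqHom.toConeAt E hn0 le_rfl) _ _, v, bijective_pair (γ := C.X 0) _ h0,
    bijective_pair' (β := F.X (n + 1)) _ (SeqHom.toConeAt_bijective E hn0 le_rfl),
    ?_, ?_, ?_, ?_, ?_⟩
  · have s0 := hW 0 (by omega) (by omega)
    have s1 := GalMod.subsingleton_cond (P := 0 + 1 = n + 1) (by omega) (E.term (0 + 1))
    have hb := GalMod.ofCond_bijective (P := 0 + 1 = 1) rfl (F.term 0)
    constructor
    · rintro ⟨x, y, z⟩ ⟨x', y', z'⟩ h
      exact Prod.ext (s0.elim _ _) (Prod.ext (hb.1 (congrArg Prod.fst h)) (s1.elim _ _))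
    · rintro ⟨y, c⟩
      obtain ⟨x, rfl⟩ := hb.2 y
      exact ⟨(0, (x, 0)), Prod.ext rfl (hC0.elim _ _)⟩
  · have s2 := hW (n + 2) (by omega) (by omega)
    have s1 := GalMod.subsingleton_cond (P := n + 1 = 1) (by omega) (F.term n)
    have s3 := GalMod.subsingleton_cond (P := n + 1 + 1 = n + 1) (by omega) (E.term (n + 1 + 1))
    constructor
    · rintro ⟨⟨x, y⟩, z⟩ ⟨⟨x', y'⟩, z'⟩ h
      refine Prod.ext (Prod.ext (s1.elim _ _) ?_) (s2.elim _ _)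
      have h' := congrArg (fun c => c.2.1) h
      exact (add_zero y).symm.trans (h'.trans (add_zero y'))
    · rintro ⟨x, y, z⟩
      exact ⟨((0, y), 0), Prod.ext (hF.elim _ _) (Prod.ext (add_zero y) (s3.elim _ _))⟩
  · have s0 := hW 0 (by omega) (by omega)
    have s2 := hW 2 (by omega) (by omega)
    constructor
    · rintro ⟨x, y⟩ ⟨x', y'⟩ h
      exact Prod.ext (s0.elim _ _) (congrArg Prod.fst h)
    · rintro ⟨x, y⟩
      exact ⟨(0, x), Prod.ext rfl (s2.elim _ _)⟩
  · intro i h2 hi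
    have := hW i (by omega) (by omega)
    have := hW (i + 1) (by omega) (by omega)
    exact inferInstanceAs (Subsingleton ((W i).V × (W (i + 1)).V))
  · have s0 := hW n (by omega) (by omega)
    have s2 := hW (n + 2) (by omega) (by omega)
    constructor
    · rintro ⟨x, y⟩ ⟨x', y'⟩ h
      exact Prod.ext (s0.elim _ _) (congrArg Prod.fst h)
    · rintro ⟨x, y⟩
      exact ⟨(0, x), Prod.ext rfl (s2.elim _ _)⟩

section Classes

variable {A B : GalMod Γ d}

/-- The structure of an extension is transported along a morphism of sequences. -/
def YExtension.map (E : YExtension n A B) {E' : GalExactSeq Γ d (n + 1)}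
    (u : SeqHom E.toGalExactSeq E') (h0 : Function.Bijective (u.φ 0))
    (h1 : Function.Bijective (u.φ (n + 1))) : YExtension n A B where
  toGalExactSeq := E'
  left := E.left.trans (LinearEquiv.ofBijective (u.φ 0) h0)
  left_equivariant := fun γ b => by
    change u.φ 0 (E.left (B.ρ γ b)) = E'.ρ 0 γ (u.φ 0 (E.left b))
    rw [E.left_equivariant, u.equivariant]
  right := (LinearEquiv.ofBijective (u.φ (n + 1)) h1).symm.trans E.right
  right_equivariant := fun γ x => by
    obtain ⟨x, rfl⟩ := h1.2 x
    rw [← u.equivariant]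
    change E.right ((LinearEquiv.ofBijective (u.φ (n + 1)) h1).symm
      (LinearEquiv.ofBijective (u.φ (n + 1)) h1 _)) =
      A.ρ γ (E.right ((LinearEquiv.ofBijective (u.φ (n + 1)) h1).symm
        (LinearEquiv.ofBijective (u.φ (n + 1)) h1 _)))
    rw [LinearEquiv.symm_apply_apply, LinearEquiv.symm_apply_apply, E.right_equivariant]

theorem YExtension.cls_map (E : YExtension n A B) {E' : GalExactSeq Γ d (n + 1)}
    (u : SeqHom E.toGalExactSeq E') (h0 : Function.Bijective (u.φ 0))
    (h1 : Function.Bijective (u.φ (n + 1))) : (E.map u h0 h1).cls = E.cls :=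
  (Quot.sound ⟨u.φ, u.equivariant, u.comm, fun _ => rfl, fun x =>
    congrArg E.right ((LinearEquiv.ofBijective (u.φ (n + 1)) h1).symm_apply_apply x)⟩).symm

/-- The structure of an extension is pulled back along a morphism of sequences. -/
def YExtension.comap (E : YExtension n A B) {E' : GalExactSeq Γ d (n + 1)}
    (u : SeqHom E' E.toGalExactSeq) (h0 : Function.Bijective (u.φ 0))
    (h1 : Function.Bijective (u.φ (n + 1))) : YExtension n A B where
  toGalExactSeq := E'
  left := E.left.trans (LinearEquiv.ofBijective (u.φ 0) h0).symm
  left_equivariant := fun γ b => by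
    apply h0.1
    rw [u.equivariant]
    change LinearEquiv.ofBijective (u.φ 0) h0 ((LinearEquiv.ofBijective (u.φ 0) h0).symm
      (E.left (B.ρ γ b))) = E.ρ 0 γ (LinearEquiv.ofBijective (u.φ 0) h0
        ((LinearEquiv.ofBijective (u.φ 0) h0).symm (E.left b)))
    rw [LinearEquiv.apply_symm_apply, LinearEquiv.apply_symm_apply, E.left_equivariant]
  right := (LinearEquiv.ofBijective (u.φ (n + 1)) h1).trans E.right
  right_equivariant := fun γ x => by
    change E.right (u.φ (n + 1) (E'.ρ (n + 1) γ x)) = A.ρ γ (E.right (u.φ (n + 1) x))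
    rw [u.equivariant, E.right_equivariant]

theorem YExtension.cls_comap (E : YExtension n A B) {E' : GalExactSeq Γ d (n + 1)}
    (u : SeqHom E' E.toGalExactSeq) (h0 : Function.Bijective (u.φ 0))
    (h1 : Function.Bijective (u.φ (n + 1))) : (E.comap u h0 h1).cls = E.cls :=
  Quot.sound ⟨u.φ, u.equivariant, u.comm, fun b =>
    (LinearEquiv.ofBijective (u.φ 0) h0).apply_symm_apply (E.left b), fun _ => rfl⟩

/-- The class of an extension vanishes if and only if the extension comes from a shorter sequence:
this property is invariant under the morphisms which generate the equivalence relation, and the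
trivial extension has it. -/
theorem YExtension.isZero_cls_iff (hn : 2 ≤ n) (E : YExtension n A B) :
    E.cls.IsZero ↔ IsShortenable E.toGalExactSeq := by
  constructor
  · rintro ⟨T, hT, hTE⟩
    have key : ∀ E E' : YExtension n A B, Relation.EqvGen YExtension.Rel E E' →
        (IsShortenable E.toGalExactSeq ↔ IsShortenable E'.toGalExactSeq) := by
      intro E E' h
      induction h with
      | rel E E' h =>
        obtain ⟨φ, h1, h2, h3, h4⟩ := h
        let u : SeqHom E.toGalExactSeq E'.toGalExactSeq := ⟨φ, h1, h2⟩
        have hu0 : Function.Bijective (u.φ 0) := by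
          rw [← Function.Bijective.of_comp_iff _ E.left.bijective]
          exact (funext h3 : φ 0 ∘ E.left = E'.left) ▸ E'.left.bijective
        have hu1 : Function.Bijective (u.φ (n + 1)) := by
          rw [← Function.Bijective.of_comp_iff' E'.right.bijective]
          exact (funext h4 : E'.right ∘ φ (n + 1) = E.right) ▸ E.right.bijective
        exact ⟨IsShortenable.map hn u hu1, IsShortenable.of_hom hn u hu0⟩
      | refl => exact Iff.rfl
      | symm _ _ _ ih => exact ih.symm
      | trans _ _ _ _ _ ih1 ih2 => exact ih1.trans ih2
    exact (key T E (Quot.eqvGen_exact hTE)).1 (isShortenable_of_bijective hn _ hT.1)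
  · intro h
    obtain ⟨G, T, u, v, hu0, hu1, hv0, hv1, hT⟩ := h.exists_trivial hn
    exact ⟨(E.map u hu0 hu1).comap v hv0 hv1, hT,
      ((E.map u hu0 hu1).cls_comap v hv0 hv1).trans (E.cls_map u hu0 hu1)⟩

end Classes

end Shortening

/-! ### Pontryagin duality for exact sequences -/

section Duality

variable {Γ : Type u} [Group Γ] [TopologicalSpace Γ] [IsTopologicalGroup Γ] {d n N : ℕ}

theorem GalExactSeq.ρ_inv_apply (E : GalExactSeq Γ d N) (j : ℕ) (γ : Γ) (v : E.X j) :
    E.ρ j γ⁻¹ (E.ρ j γ v) = v := by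
  rw [map_inv]; exact (E.ρ j γ).symm_apply_apply v

/-- A family over `{j // i + j = N}` with a given value at its only index `j`. -/
theorem exists_family {X : ℕ → Type*} {i j N : ℕ} (h : i + j = N) (x : X j) :
    ∃ ξ : ∀ j : {j // i + j = N}, X j.1, ξ ⟨j, h⟩ = x :=
  ⟨fun j' => (show j = j'.1 by omega) ▸ x, rfl⟩

/-- The term in position `i` of the dual sequence, encoded as the product of the duals of
the terms in the positions `j` with `i + j = N` (there is at most one). -/
def GalExactSeq.dualTerm (E : GalExactSeq Γ d N) [NeZero d] (i : ℕ) : GalMod Γ d :=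
  haveI : Finite {j // i + j = N} := Finite.of_injective (fun _ => ())
    fun j j' _ => Subtype.ext (by omega)
  GalMod.ofEnd (∀ j : {j // i + j = N}, E.X j.1 →ₗ[ZMod d] ZMod d)
    { toFun := fun γ => LinearMap.pi fun j =>
        (LinearMap.lcomp (ZMod d) (ZMod d) (E.ρ j.1 γ⁻¹).toLinearMap).comp (LinearMap.proj j)
      map_one' := by
        refine LinearMap.ext fun x => funext fun j => LinearMap.ext fun v => congrArg (x j) ?_
        rw [inv_one]; exact (E.term j.1).ρ_one_apply v
      map_mul' := fun γ γ' => by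
        refine LinearMap.ext fun x => funext fun j => LinearMap.ext fun v => congrArg (x j) ?_
        rw [mul_inv_rev]; exact (E.term j.1).ρ_mul_apply _ _ v }
    {γ | ∀ (j : Fin (N + 1)) (v : E.X j), E.ρ j γ v = v}
    (by
      rw [Set.ofPred_forall]
      exact isOpen_iInter_of_finite fun j => (E.term j.1).isOpen_ker)
    (fun j => (E.term j.1).ρ_one_apply) fun γ hγ x => by
      refine funext fun j => LinearMap.ext fun v => congrArg (x j) ?_
      have h : E.ρ j.1 γ⁻¹ (E.ρ j.1 γ v) = v := E.ρ_inv_apply j.1 γ v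
      exact (congrArg (E.ρ j.1 γ⁻¹) (hγ ⟨j.1, by omega⟩ v).symm).trans h

variable [NeZero d]

/-- The dual of an exact sequence. -/
def GalExactSeq.dual (E : GalExactSeq Γ d (N + 1)) : GalExactSeq Γ d (N + 1) :=
  GalExactSeq.ofTerms (N + 1) E.dualTerm
    (fun i => LinearMap.pi fun j => (LinearMap.lcomp (ZMod d) (ZMod d) (E.f j.1)).comp
      (LinearMap.proj (⟨j.1 + 1, by omega⟩ : {j // i + j = N + 1})))
    (fun i γ x => funext fun j => LinearMap.ext fun v => by
      change x ⟨j.1 + 1, _⟩ (E.ρ (j.1 + 1) γ⁻¹ (E.f j.1 v)) =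
        x ⟨j.1 + 1, _⟩ (E.f j.1 (E.ρ j.1 γ⁻¹ v))
      rw [E.equivariant])
    (fun x h => funext fun j => by
      obtain ⟨j, hj⟩ := j
      obtain rfl : j = N + 1 := by omega
      refine LinearMap.ext fun v => ?_
      obtain ⟨w, rfl⟩ := E.f_surjective v
      exact LinearMap.congr_fun (congrFun h ⟨N, by omega⟩) w)
    (fun i x => funext fun j => LinearMap.ext fun v =>
      (congrArg (x ⟨j.1 + 1 + 1, by omega⟩) (E.f_f j.1 v)).trans (map_zero _))
    (fun i x h => by
      by_cases hi : i + 1 ≤ N + 1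
      · obtain ⟨j, hj⟩ : ∃ j, i + 1 + j = N + 1 := ⟨N - i, by omega⟩
        obtain ⟨g, hg⟩ := exists_extend (E.f j) (x ⟨j, hj⟩) (fun v hv => by
          cases j with
          | zero => rw [E.f_zero_eq_zero hv, map_zero]
          | succ m =>
            obtain ⟨y, rfl⟩ := E.exists_f hv
            exact LinearMap.congr_fun (congrFun h ⟨m, by omega⟩) y) baer_zmod
        obtain ⟨y, hy⟩ := exists_family (X := fun j => E.X j →ₗ[ZMod d] ZMod d)
          (show i + (j + 1) = N + 1 by omega) g
        refine ⟨y, funext fun j' => LinearMap.ext fun w => ?_⟩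
        obtain ⟨j', hj'⟩ := j'
        obtain rfl : j' = j := by omega
        exact (LinearMap.congr_fun hy _).trans (hg w)
      · have : IsEmpty {j // i + 1 + j = N + 1} := ⟨fun j => by omega⟩
        exact ⟨0, funext fun j => isEmptyElim j⟩)
    (fun i hi => by
      have : IsEmpty {j // i + j = N + 1} := ⟨fun j => by omega⟩
      exact inferInstanceAs (Subsingleton (∀ j : {j // i + j = N + 1}, E.X j.1 →ₗ[ZMod d] ZMod d)))

/-- The dual of a morphism. -/
def SeqHom.dual {E F : GalExactSeq Γ d (N + 1)} (u : SeqHom E F) : SeqHom F.dual E.dual where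
  φ := fun _ => LinearMap.pi fun j =>
    (LinearMap.lcomp (ZMod d) (ZMod d) (u.φ j.1)).comp (LinearMap.proj j)
  equivariant := fun i γ (x : ∀ j : {j // i + j = N + 1}, F.X j.1 →ₗ[ZMod d] ZMod d) =>
    funext fun j => LinearMap.ext fun v => congrArg (x j) (u.equivariant j.1 γ⁻¹ v).symm
  comm := fun i (x : ∀ j : {j // i + j = N + 1}, F.X j.1 →ₗ[ZMod d] ZMod d) =>
    funext fun j => LinearMap.ext fun v =>
      congrArg (x ⟨j.1 + 1, by omega⟩) (u.comm j.1 v).symm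

theorem SeqHom.dual_bijective {E F : GalExactSeq Γ d (N + 1)} (u : SeqHom E F) {i j : ℕ}
    (h : i + j = N + 1) (hu : Function.Bijective (u.φ j)) : Function.Bijective (u.dual.φ i) := by
  have hj : ∀ j' : {j // i + j = N + 1}, Function.Bijective (u.φ j'.1) := fun j' => by
    have h1 : j'.1 = j := by omega
    rw [h1]; exact hu
  constructor
  · refine fun x y hxy => funext fun j' => LinearMap.ext fun v => ?_
    obtain ⟨w, rfl⟩ := (hj j').2 v
    exact LinearMap.congr_fun (congrFun hxy j') w
  · intro x
    refine ⟨fun j' => (x j').comp (LinearEquiv.ofBijective (u.φ j'.1) (hj j')).symm.toLinearMap,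
      funext fun j' => LinearMap.ext fun v => ?_⟩
    exact congrArg (x j') ((LinearEquiv.ofBijective (u.φ j'.1) (hj j')).symm_apply_apply v)

theorem GalExactSeq.dual_f_bijective (E : GalExactSeq Γ d (N + 1)) {i j : ℕ}
    (h : i + 1 + j = N + 1) (hu : Function.Bijective (E.f j)) :
    Function.Bijective (E.dual.f i) := by
  have hj : ∀ j' : {j // i + 1 + j = N + 1}, Function.Bijective (E.f j'.1) := fun j' => by
    have h1 : j'.1 = j := by omega
    rw [h1]; exact hu
  constructor
  · refine fun x y hxy => funext fun j' => ?_
    obtain ⟨j', hj'⟩ := j'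
    obtain rfl : j' = j + 1 := by omega
    refine LinearMap.ext fun v => ?_
    obtain ⟨w, rfl⟩ := hu.2 v
    exact LinearMap.congr_fun (congrFun hxy ⟨j, h⟩) w
  · intro x
    obtain ⟨y, hy⟩ := exists_family (X := fun j => E.X j →ₗ[ZMod d] ZMod d)
      (show i + (j + 1) = N + 1 by omega)
      ((x ⟨j, h⟩).comp (LinearEquiv.ofBijective (E.f j) hu).symm.toLinearMap)
    refine ⟨y, funext fun j' => ?_⟩
    obtain ⟨j', hj'⟩ := j'
    obtain rfl : j' = j := by omega
    refine LinearMap.ext fun w => (LinearMap.congr_fun hy _).trans ?_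
    exact congrArg (x ⟨j', h⟩) ((LinearEquiv.ofBijective (E.f j') hu).symm_apply_apply w)

/-- The morphism to the bidual. -/
def SeqHom.evalDual (E : GalExactSeq Γ d (N + 1)) : SeqHom E E.dual.dual where
  φ := fun i => LinearMap.pi fun j =>
    (LinearMap.lcomp (ZMod d) (ZMod d)
      (LinearMap.proj (φ := fun i' : {i // j.1 + i = N + 1} => E.X i'.1 →ₗ[ZMod d] ZMod d)
        (⟨i, by omega⟩ : {i // j.1 + i = N + 1}))).comp (YonedaSplitting.evalDual (E.X i))
  equivariant := fun i γ x => funext fun j => LinearMap.ext fun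
    (ξ : ∀ i' : {i // j.1 + i = N + 1}, E.X i'.1 →ₗ[ZMod d] ZMod d) =>
    congrArg (fun γ' => ξ ⟨i, by omega⟩ (E.ρ i γ' x)) (inv_inv γ).symm
  comm := fun _ _ => rfl

theorem SeqHom.evalDual_bijective (E : GalExactSeq Γ d (N + 1)) (i : ℕ) :
    Function.Bijective ((SeqHom.evalDual E).φ i) := by
  by_cases hi : i ≤ N + 1
  swap
  · have := E.subsingleton i (by omega)
    have := E.dual.dual.subsingleton i (by omega)
    exact bijective_of_subsingleton _
  obtain ⟨j, hj⟩ : ∃ j, i + j = N + 1 := ⟨N + 1 - i, by omega⟩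
  constructor
  · intro x y hxy
    refine evalDual_injective (d := d) (LinearMap.ext fun l => ?_)
    obtain ⟨ξ, rfl⟩ := exists_family (X := fun j => E.X j →ₗ[ZMod d] ZMod d)
      (show j + i = N + 1 by omega) l
    exact LinearMap.congr_fun (congrFun hxy ⟨j, hj⟩) ξ
  · intro η
    -- the bidual term is identified with the bidual of the term
    let P : (E.X i →ₗ[ZMod d] ZMod d) →ₗ[ZMod d]
        ∀ i' : {i' // j + i' = N + 1}, E.X i'.1 →ₗ[ZMod d] ZMod d :=
      LinearMap.pi fun i' => LinearMap.lcomp (ZMod d) (ZMod d)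
        (LinearEquiv.cast (R := ZMod d) (M := E.X) (show i'.1 = i by omega)).toLinearMap
    obtain ⟨x, hx⟩ := (YonedaSplitting.evalDual_bijective (d := d) (N := E.X i)).2
      ((η ⟨j, hj⟩).comp P)
    refine ⟨x, funext fun j' => ?_⟩
    obtain ⟨j', hj'⟩ := j'
    obtain rfl : j' = j := by omega
    refine LinearMap.ext fun (ξ : ∀ i' : {i' // j' + i' = N + 1}, E.X i'.1 →ₗ[ZMod d] ZMod d) => ?_
    have h1 : P (ξ ⟨i, by omega⟩) = ξ := funext fun i' => by
      obtain ⟨i', hi'⟩ := i'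
      obtain rfl : i' = i := by omega
      rfl
    have h2 := LinearMap.congr_fun hx (ξ ⟨i, by omega⟩)
    exact h2.trans (congrArg (η ⟨j', hj⟩) h1)

/-- A sequence is Pontryagin dual to its dual. -/
theorem GalExactSeq.isPontryaginDual_dual (E : GalExactSeq Γ d (N + 1)) :
    E.dual.IsPontryaginDual E := by
  let P : ∀ i j, i + j = N + 1 → E.dual.X i →ₗ[ZMod d] E.X j →ₗ[ZMod d] ZMod d := fun i j h =>
    LinearMap.proj (φ := fun i' : {j // i + j = N + 1} => E.X i'.1 →ₗ[ZMod d] ZMod d) ⟨j, h⟩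
  have hP : ∀ {i j : ℕ} (h : i + j = N + 1),
      (if h : i + j = N + 1 then P i j h else 0) = P i j h := fun h => dif_pos h
  refine ⟨fun i j => if h : i + j = N + 1 then P i j h else 0, fun i j h => ?_, fun i j h => ?_,
    fun i j h => ?_⟩
  · simp only [hP h]
    -- the map to the dual of the dual term is the biduality isomorphism
    have hb := SeqHom.evalDual_bijective E j
    constructor
    · refine fun x y hxy => hb.1 (funext fun i' => ?_)
      obtain ⟨i', hi'⟩ := i'
      obtain rfl : i' = i := by omega
      exact hxy
    · intro η
      obtain ⟨η', rfl⟩ := exists_family (X := fun i => E.dual.X i →ₗ[ZMod d] ZMod d)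
        (show j + i = N + 1 by omega) η
      obtain ⟨x, rfl⟩ := hb.2 η'
      exact ⟨x, rfl⟩
  · intro γ ξ x
    simp only [hP h]
    refine congrArg (ξ ⟨j, h⟩) ?_
    exact E.ρ_inv_apply j γ x
  · intro x y
    simp only [hP h, hP (show i + (j + 1) = N + 1 by omega)]
    rfl

/-- The property is symmetric, although its definition is not: a sequence which comes from a shorter
one is equivalent to a trivial sequence, and the dual of a trivial sequence is trivial. -/
theorem IsShortenable.dual (hn : 2 ≤ n) {E : GalExactSeq Γ d (n + 1)} (h : IsShortenable E) :
    IsShortenable E.dual := by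
  obtain ⟨G, T, u, v, hu0, hu1, hv0, hv1, -, -, hT⟩ := h.exists_trivial hn
  have h1 : IsShortenable T.dual :=
    isShortenable_of_bijective hn _ (T.dual_f_bijective (j := n) (by omega) hT)
  have h2 := h1.of_hom hn v.dual (v.dual_bijective (zero_add _) hv1)
  exact h2.map hn u.dual (u.dual_bijective (j := 0) (add_zero _) hu0)

theorem isShortenable_dual_iff (hn : 2 ≤ n) {E : GalExactSeq Γ d (n + 1)} :
    IsShortenable E.dual ↔ IsShortenable E :=
  ⟨fun h => (h.dual hn).of_hom hn (SeqHom.evalDual E) (SeqHom.evalDual_bijective E 0),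
    fun h => h.dual hn⟩

/-- The dual commutes with the restriction to another group. -/
theorem isShortenable_res_dual_iff (hn : 2 ≤ n) {Γ' : Type u} [Group Γ'] [TopologicalSpace Γ']
    [IsTopologicalGroup Γ'] (r : Γ' →ₜ* Γ) {E : GalExactSeq Γ d (n + 1)} :
    IsShortenable (E.dual.res r) ↔ IsShortenable (E.res r) := by
  rw [← isShortenable_dual_iff hn (E := E.res r)]
  have hr : ∀ γ, (r γ)⁻¹ = r γ⁻¹ := fun γ => (map_inv r.toMonoidHom γ).symm
  let u : SeqHom (E.res r).dual (E.dual.res r) :=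
    { φ := fun _ => LinearMap.id
      equivariant := fun i γ (x : ∀ j : {j // i + j = n + 1}, E.X j.1 →ₗ[ZMod d] ZMod d) =>
        funext fun j => LinearMap.ext fun v =>
        congrArg (fun γ' => x j (E.ρ j.1 γ' v)) (hr γ).symm
      comm := fun _ _ => rfl }
  exact ⟨fun h => h.of_hom hn u Function.bijective_id, fun h => h.map hn u Function.bijective_id⟩

end Duality

/-! ### Free terms -/

section Free

variable {Γ : Type u} [Group Γ] [TopologicalSpace Γ] [IsTopologicalGroup Γ] {d n N : ℕ} [NeZero d]

/-- The map from the free module on the set `V` to `V`. -/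
def GalMod.ofFreeOn (V : GalMod Γ d) : V.freeOn.V →ₗ[ZMod d] V.V :=
  letI := Fintype.ofFinite V.V
  Fintype.linearCombination (ZMod d) (id : V.V → V.V)

theorem GalMod.ofFreeOn_apply (V : GalMod Γ d) [hV : Fintype V.V] (x : V.V → ZMod d) :
    V.ofFreeOn x = ∑ v : V.V, x v • v := by
  obtain rfl : hV = Fintype.ofFinite V.V := Subsingleton.elim _ _
  let := Fintype.ofFinite V.V
  exact Fintype.linearCombination_apply (ZMod d) (id : V.V → V.V) x

theorem GalMod.ofFreeOn_equivariant (V : GalMod Γ d) (γ : Γ) (x : V.freeOn.V) :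
    V.ofFreeOn (V.freeOn.ρ γ x) = V.ρ γ (V.ofFreeOn x) := by
  let := Fintype.ofFinite V.V
  have h1 : ∀ x : V.V → ZMod d, V.ofFreeOn x = ∑ v : V.V, x v • v := V.ofFreeOn_apply
  refine (h1 _).trans (Eq.trans ?_ (congrArg (V.ρ γ) (h1 x)).symm)
  rw [map_sum]
  refine (Equiv.sum_comp (V.ρ γ).toEquiv _).symm.trans (Finset.sum_congr rfl fun v _ => ?_)
  rw [map_smul]
  change x (V.ρ γ⁻¹ (V.ρ γ v)) • V.ρ γ v = _
  rw [← V.ρ_mul_apply, inv_mul_cancel, V.ρ_one_apply]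

theorem GalMod.ofFreeOn_surjective (V : GalMod Γ d) : Function.Surjective V.ofFreeOn := by
  classical
  let := Fintype.ofFinite V.V
  intro v
  refine ⟨(Pi.single v 1 : V.V → ZMod d), (V.ofFreeOn_apply _).trans ?_⟩
  simp [Pi.single_apply]

/-- A sequence is equivalent to one whose term in position `n` is free, by pullback along a
surjection from a free module to `E_n`. This changes only the terms in the positions `n - 1` and
`n`. -/
theorem exists_free_last (hn : 2 ≤ n) (E : GalExactSeq Γ d (n + 1)) :
    ∃ (E' : GalExactSeq Γ d (n + 1)) (u : SeqHom E' E), Function.Bijective (u.φ 0) ∧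
      Function.Bijective (u.φ (n + 1)) ∧ Module.Free (ZMod d) (E'.X n) := by
  have hn0 : n ≠ 0 := by omega
  let α : SeqHom E (GalExactSeq.coneAt n n E.term hn0 le_rfl) := SeqHom.toConeAt E hn0 le_rfl
  let β : SeqHom (GalExactSeq.coneAt n n (fun i => (E.term i).freeOn) hn0 le_rfl)
      (GalExactSeq.coneAt n n E.term hn0 le_rfl) :=
    SeqHom.coneMap (fun i => GalMod.condMap (V := (E.term i).freeOn) (W := E.term i) (i = n)
      (E.term i).ofFreeOn) fun i γ (x : PLift (i = n) → (E.term i).freeOn.V) =>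
        funext fun h => (E.term i).ofFreeOn_equivariant γ (x h)
  have hβ : ∀ i (z : (GalMod.cond (i = n) (E.term i)).V),
      ∃ y : (GalMod.cond (i = n) (E.term i).freeOn).V,
        GalMod.condMap (V := (E.term i).freeOn) (W := E.term i) (i = n) (E.term i).ofFreeOn y = z :=
    fun i z => ⟨fun h => ((E.term i).ofFreeOn_surjective (z h)).choose,
      funext fun h => ((E.term i).ofFreeOn_surjective (z h)).choose_spec⟩
  have hsurj : ∀ i z, ∃ x y, α.φ i x - β.φ i y = z := by
    intro i z
    obtain ⟨y, hy⟩ := hβ i (-z).1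
    obtain ⟨y', hy'⟩ := hβ (i + 1) (-z).2
    have h0 : β.φ i (y, y') = -z := Prod.ext hy hy'
    refine ⟨0, (y, y'), ?_⟩
    rw [map_zero, zero_sub, h0, neg_neg]
  have hb : ∀ i, i ≠ n → i + 1 ≠ n → Function.Bijective (β.φ i) := fun i h1 h2 => by
    have := GalExactSeq.subsingleton_coneAt (V := E.term) hn0 le_rfl h1 h2
    have := GalExactSeq.subsingleton_coneAt (V := fun i => (E.term i).freeOn) hn0 le_rfl h1 h2
    exact bijective_of_subsingleton _
  have hn1 : n ≤ n + 1 := n.le_succ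
  have h0 := SeqHom.pullbackFst_bijective α β (n + 1) hsurj le_rfl hn1 (i := 0)
    (hb 0 (by omega) (by omega))
  have hlast := SeqHom.pullbackFst_bijective α β (n + 1) hsurj le_rfl hn1 (i := n + 1)
    (hb (n + 1) (by omega) (by omega))
  refine ⟨_, _, h0, hlast, ?_⟩
  have h1 := SeqHom.pullbackSnd_bijective α β (n + 1) hsurj le_rfl hn1 (i := n)
    (SeqHom.toConeAt_bijective E hn0 le_rfl)
  have : Subsingleton (GalMod.cond (n + 1 = n) (E.term (n + 1)).freeOn).V :=
    GalMod.subsingleton_cond (by omega) _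
  have h2 : Function.Bijective (fun x : (PLift (n = n) → (E.X n → ZMod d)) ×
      (GalMod.cond (n + 1 = n) (E.term (n + 1)).freeOn).V => x.1 ⟨rfl⟩) := by
    constructor
    · rintro ⟨x, y⟩ ⟨x', y'⟩ h
      exact Prod.ext (funext fun _ => h) (Subsingleton.elim _ _)
    · exact fun x => ⟨(fun _ => x, 0), rfl⟩
  let e2 : ((GalExactSeq.coneAt n n (fun i => (E.term i).freeOn) hn0 le_rfl).X n) ≃ₗ[ZMod d]
      (E.X n → ZMod d) := LinearEquiv.ofBijective
    ((LinearMap.proj (R := ZMod d) (φ := fun _ : PLift (n = n) => E.X n → ZMod d) ⟨rfl⟩).comp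
      (LinearMap.fst (ZMod d) (PLift (n = n) → (E.X n → ZMod d))
      (GalMod.cond (n + 1 = n) (E.term (n + 1)).freeOn).V)) h2
  have := Fintype.ofFinite (E.X n)
  exact Module.Free.of_equiv ((LinearEquiv.ofBijective _ h1).trans e2).symm

end Free

/-! ### Shortening and lifting of automorphisms -/

section Lifting

variable {Γ : Type u} [Group Γ] [TopologicalSpace Γ] [IsTopologicalGroup Γ] {d n N : ℕ} [NeZero d]

/-- The term in position `p`, with `0 < p < n`, can be made free by a pushout which
changes only the terms in the positions `p` and `p + 1`. -/
theorem exists_free_term (F : GalExactSeq Γ d n) (p : ℕ) (hpn : p + 1 ≤ n) :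
    ∃ (F' : GalExactSeq Γ d n) (u : SeqHom F F'),
      (∀ i, i ≠ p → i ≠ p + 1 → Function.Bijective (u.φ i)) ∧ Module.Free (ZMod d) (F'.X p) := by
  let W : ℕ → GalMod Γ d := fun i => F.term (i - 1)
  let W' : ℕ → GalMod Γ d := fun i => (F.term (i - 1)).funDual
  let K := GalExactSeq.coneAt n (p + 1) W (Nat.succ_ne_zero p) hpn
  let K' := GalExactSeq.coneAt n (p + 1) W' (Nat.succ_ne_zero p) hpn
  let α : SeqHom K K' := SeqHom.coneMap
    (fun i => GalMod.condMap (V := W i) (W := W' i) (i = p + 1) (toFunDual (F.X (i - 1))))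
    fun _ _ _ => rfl
  let β : SeqHom K F := SeqHom.ofCone F (fun i => GalMod.ofCond (i + 1 = p + 1) (F.term i))
    fun i => GalMod.ofCond_equivariant (i + 1 = p + 1) (F.term i)
  have hα : ∀ i x, α.φ i x = 0 → x = 0 := fun i x hx => Prod.ext
    (funext fun h => (injective_iff_map_eq_zero _).1 (toFunDual_injective (d := d)) _
      (congrFun (congrArg Prod.fst hx) h))
    (funext fun h => (injective_iff_map_eq_zero _).1 (toFunDual_injective (d := d)) _
      (congrFun (congrArg Prod.snd hx) h))
  have hsub : ∀ i, i ≠ p → i ≠ p + 1 → Subsingleton (K'.X i) := fun i h1 h2 =>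
    GalExactSeq.subsingleton_coneAt _ hpn h2 (by omega)
  have hsub' : ∀ i, i ≠ p → i ≠ p + 1 → Subsingleton (K.X i) := fun i h1 h2 =>
    GalExactSeq.subsingleton_coneAt _ hpn h2 (by omega)
  have h1 : ∀ i x, α.φ i x = 0 → β.φ i x = 0 → x = 0 := fun i x h _ => hα i x h
  have h2 : ∀ i, n < i → ∀ (x : K'.X i) (y : F.X i), ∃ z, α.φ i z = x ∧ β.φ i z = -y := by
    intro i hi x y
    exact ⟨0, (hsub i (by omega) (by omega)).elim _ _, (F.subsingleton i hi).elim _ _⟩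
  refine ⟨GalExactSeq.pushout α β n h1 h2, SeqHom.pushoutInr α β n h1 h2, fun i hi hi' => ?_, ?_⟩
  · have := hsub i hi hi'
    have := hsub' i hi hi'
    exact SeqHom.pushoutInr_bijective α β n h1 h2 (bijective_of_subsingleton _)
  · have hβ : Function.Bijective (β.φ p) := by
      have hb := GalMod.ofCond_bijective (P := p + 1 = p + 1) rfl (F.term p)
      have hs : Subsingleton (GalMod.cond (p = p + 1) (W p)).V :=
        GalMod.subsingleton_cond (by omega) _
      cases p with
      | zero =>
        constructor
        · rintro ⟨x, y⟩ ⟨x', y'⟩ h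
          exact Prod.ext (hs.elim _ _) (hb.1 h)
        · intro y
          obtain ⟨x, rfl⟩ := hb.2 y
          exact ⟨(0, x), rfl⟩
      | succ p =>
        have h0 : ∀ x y, β.φ (p + 1) (x, y) = GalMod.ofCond (p + 2 = p + 2) (F.term (p + 1)) y := by
          intro x y
          obtain rfl : x = 0 := hs.elim _ _
          have h1 : F.f p (GalMod.ofCond (p + 1 = p + 2) (F.term p) 0) = 0 :=
            (congrArg (F.f p) (map_zero (GalMod.ofCond _ _))).trans (map_zero _)
          let c : F.X (p + 1) := GalMod.ofCond (p + 2 = p + 2) (F.term (p + 1)) y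
          exact (congrArg (fun t : F.X (p + 1) => t + c) h1).trans (zero_add c)
        constructor
        · rintro ⟨x, y⟩ ⟨x', y'⟩ h
          rw [h0, h0] at h
          exact Prod.ext (hs.elim _ _) (hb.1 h)
        · intro y
          obtain ⟨x, rfl⟩ := hb.2 y
          exact ⟨(0, x), h0 0 x⟩
    have h3 := SeqHom.pushoutInl_bijective α β n h1 h2 hβ
    have hs : Subsingleton (GalMod.cond (p = p + 1) (W' p)).V :=
      GalMod.subsingleton_cond (by omega) _
    have h4 : Function.Bijective
        (fun x : (GalMod.cond (p = p + 1) (W' p)).V ×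
          (PLift (p + 1 = p + 1) → ((F.X p →ₗ[ZMod d] ZMod d) → ZMod d)) => x.2 ⟨rfl⟩) := by
      constructor
      · rintro ⟨x, y⟩ ⟨x', y'⟩ h
        exact Prod.ext (hs.elim _ _) (funext fun _ => h)
      · exact fun x => ⟨(0, fun _ => x), rfl⟩
    let e : K'.X p ≃ₗ[ZMod d] ((F.X p →ₗ[ZMod d] ZMod d) → ZMod d) := LinearEquiv.ofBijective
      ((LinearMap.proj (R := ZMod d)
        (φ := fun _ : PLift (p + 1 = p + 1) => (F.X p →ₗ[ZMod d] ZMod d) → ZMod d) ⟨rfl⟩).comp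
        (LinearMap.snd (ZMod d) (GalMod.cond (p = p + 1) (W' p)).V
          (PLift (p + 1 = p + 1) → ((F.X p →ₗ[ZMod d] ZMod d) → ZMod d)))) h4
    have := Fintype.ofFinite (F.X p →ₗ[ZMod d] ZMod d)
    exact Module.Free.of_equiv (e.symm.trans (LinearEquiv.ofBijective _ h3))

/-- The terms in the positions `1, …, n - 2` can be made free. -/
theorem exists_free_terms (F : GalExactSeq Γ d n) (h0 : Module.Free (ZMod d) (F.X 0)) (q : ℕ)
    (hq : q + 2 ≤ n) : ∃ (F' : GalExactSeq Γ d n) (u : SeqHom F F'),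
      Function.Bijective (u.φ 0) ∧ Function.Bijective (u.φ n) ∧
      ∀ i, i ≤ q → Module.Free (ZMod d) (F'.X i) := by
  induction q with
  | zero =>
    refine ⟨F, SeqHom.id F, Function.bijective_id, Function.bijective_id, fun i hi => ?_⟩
    obtain rfl : i = 0 := by omega
    exact h0
  | succ q ih =>
    obtain ⟨F', u, hu0, hun, hF'⟩ := ih (by omega)
    obtain ⟨F'', v, hv, hF''⟩ := exists_free_term F' (q + 1) (by omega)
    refine ⟨F'', v.comp u, (hv 0 (by omega) (by omega)).comp hu0,
      (hv n (by omega) (by omega)).comp hun, fun i hi => ?_⟩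
    rcases hi.eq_or_lt with rfl | hi
    · exact hF''
    · have := hF' i (by omega)
      exact Module.Free.of_equiv (LinearEquiv.ofBijective _ (hv i (by omega) (by omega)))

/-- The identification of `R^r ⊕ R^s` with `R^{r+s}`. -/
def finFunProd (r s : ℕ) : ((Fin r → ZMod d) × (Fin s → ZMod d)) ≃ₗ[ZMod d]
    (Fin (r + s) → ZMod d) :=
  (LinearEquiv.sumArrowLequivProdArrow (Fin r) (Fin s) (ZMod d) (ZMod d)).symm.trans
    (LinearEquiv.funCongrLeft (ZMod d) (ZMod d) finSumFinEquiv.symm)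

theorem exists_equiv_fin (M : Type*) [AddCommGroup M] [Module (ZMod d) M] [Finite M]
    [Module.Free (ZMod d) M] : ∃ r, Nonempty (M ≃ₗ[ZMod d] (Fin r → ZMod d)) := by
  have : Module.Finite (ZMod d) M := Module.Finite.of_finite
  exact ⟨_, ⟨(Module.Free.chooseBasis (ZMod d) M).equivFun.trans
    (LinearEquiv.funCongrLeft (ZMod d) (ZMod d) (Fintype.equivFin _).symm)⟩⟩

/-- In an exact sequence with free terms in the positions `< n - 1`, all the kernels in
positions `< n` are free. -/
theorem exists_ker_equiv (F : GalExactSeq Γ d n)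
    (hF : ∀ i, i + 2 ≤ n → Module.Free (ZMod d) (F.X i)) (i : ℕ) (hi : i < n) :
    ∃ r, Nonempty ((F.f i).ker ≃ₗ[ZMod d] (Fin r → ZMod d)) := by
  induction i with
  | zero =>
    have : Subsingleton (F.f 0).ker := by
      rw [LinearMap.ker_eq_bot.2 F.injective_zero]; infer_instance
    exact ⟨0, ⟨LinearEquiv.ofSubsingleton _ _⟩⟩
  | succ i ih =>
    obtain ⟨r, ⟨e⟩⟩ := ih (by omega)
    have := hF i (by omega)
    obtain ⟨s, ⟨e'⟩⟩ := exists_equiv_fin (d := d) (F.X i)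
    obtain ⟨t, ⟨e''⟩⟩ := exists_quotient_equiv e' ((F.f i).ker.subtype.comp e.symm.toLinearMap)
      (Subtype.val_injective.comp e.symm.injective)
    have h1 : ((F.f i).ker.subtype.comp e.symm.toLinearMap).range = (F.f i).ker := by
      rw [LinearMap.range_comp_of_range_eq_top _ (LinearMap.range_eq_top.2 e.symm.surjective),
        Submodule.range_subtype]
    have h2 : (F.f (i + 1)).ker = (F.f i).range := LinearMap.exact_iff.1 (F.exact i)
    exact ⟨t, ⟨(LinearEquiv.ofEq _ _ h2).trans ((F.f i).quotKerEquivRange.symm.trans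
      ((Submodule.quotEquivOfEq _ _ h1.symm).trans e''))⟩⟩

/-- The kernels of the direct sum of `F` and of a contractible sequence. -/
theorem nonempty_ker_thicken_equiv (F : GalExactSeq Γ d n) (V : ℕ → GalMod Γ d) (i : ℕ)
    {M : Type} [AddCommGroup M] [Module (ZMod d) M]
    (e : ((F.f i).ker × (GalMod.cond (2 ≤ i ∧ i < n) (V i)).V) ≃ₗ[ZMod d] M) :
    Nonempty (((F.prod (middleCone n V) n le_rfl le_rfl).f i).ker ≃ₗ[ZMod d] M) := by
  let W : ℕ → GalMod Γ d := fun i => GalMod.cond (2 ≤ i ∧ i < n) (V i)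
  let g : ((F.f i).ker × (W i).V) →ₗ[ZMod d]
      ((F.prod (middleCone n V) n le_rfl le_rfl).f i).ker :=
    LinearMap.codRestrict _
      ((F.f i).ker.subtype.prodMap (LinearMap.inl (ZMod d) (W i).V (W (i + 1)).V))
      fun x => Prod.ext x.1.2 rfl
  refine ⟨(LinearEquiv.ofBijective g ⟨?_, ?_⟩).symm.trans e⟩
  · intro x y h
    have h' := congrArg Subtype.val h
    exact Prod.ext (Subtype.ext (congrArg Prod.fst h')) (congrArg (fun z => z.2.1) h')
  · rintro ⟨⟨x, y, z⟩, h⟩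
    refine ⟨(⟨x, congrArg Prod.fst h⟩, y), Subtype.ext (Prod.ext rfl (Prod.ext rfl ?_))⟩
    exact (congrArg (fun z => z.2.1) h).symm

variable {a b : ℕ}

/-- If `E` comes from a shorter sequence, it comes from a sequence which is
isomorphic, as a sequence of modules under `E`, to a given standard free extension of large
parameter. -/
theorem IsShortenable.exists_std (hn : 3 ≤ n) {E : GalExactSeq Γ d (n + 1)} (h : IsShortenable E)
    (e₀ : E.X 0 ≃ₗ[ZMod d] (Fin b → ZMod d)) :
    ∃ m₁, ∀ m, m₁ ≤ m → ∀ D : Diagram E.toExactSeq (std d n a b m (Nat.le_of_succ_le hn)),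
      D.IsInjective → ∃ (F : GalExactSeq Γ d n) (φ : SeqHom E F)
        (θ : ∀ i, F.X i ≃ₗ[ZMod d] (std d n a b m (Nat.le_of_succ_le hn)).X i),
        (∀ i x, θ (i + 1) (F.f i x) = (std d n a b m (Nat.le_of_succ_le hn)).f i (θ i x)) ∧
        ∀ i x, θ i (φ.φ i x) = D.φ i x := by
  obtain ⟨F₀, φ₀, h0, hlast⟩ := h
  obtain ⟨F, u, hu0, hun, hF⟩ := exists_free_terms F₀
    (Module.Free.of_equiv (e₀.symm.trans (LinearEquiv.ofBijective _ h0))) (n - 2) (by omega)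
  have hker : ∀ i, ∃ r, i < n → Nonempty ((F.f i).ker ≃ₗ[ZMod d] (Fin r → ZMod d)) := fun i => by
    by_cases hi : i < n
    · obtain ⟨r, hr⟩ := exists_ker_equiv F (fun i hi => hF i (by omega)) i hi
      exact ⟨r, fun _ => hr⟩
    · exact ⟨0, fun h => absurd h hi⟩
  choose r hr using hker
  have hfun : ∀ i, ∃ s, Nonempty (((E.X i →ₗ[ZMod d] ZMod d) → ZMod d) ≃ₗ[ZMod d]
      (Fin s → ZMod d)) := fun i => by
    have := Fintype.ofFinite (E.X i →ₗ[ZMod d] ZMod d)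
    exact exists_equiv_fin _
  choose s hs using hfun
  refine ⟨(Finset.range n).sup fun i => r i + s i, fun m hm D hD => ?_⟩
  have hm' : ∀ i, i < n → r i + s i ≤ m := fun i hi =>
    (Finset.le_sup (f := fun i => r i + s i) (Finset.mem_range.2 hi)).trans hm
  -- the summand `V_i` contains `E_i`, and brings the rank of the cycles in position `i` up to `m`
  let V : ℕ → GalMod Γ d := fun i => (E.term i).funDual.prod (GalMod.triv Γ d (m - (r i + s i)))
  let t : ∀ i, E.X i →ₗ[ZMod d] (V i).V := fun i =>
    (toFunDual (E.X i)).prod (0 : E.X i →ₗ[ZMod d] (Fin (m - (r i + s i)) → ZMod d))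
  have ht : ∀ i γ x, t i (E.ρ i γ x) = (V i).ρ γ (t i x) := fun _ _ _ => rfl
  let φ := (u.comp φ₀).thicken V t ht
  let D' : Diagram E.toExactSeq (F.prod (middleCone n V) n le_rfl le_rfl).toExactSeq :=
    { φ := φ.φ
      comm := φ.comm
      bijective_zero := SeqHom.thicken_bijective _ V t ht (.inl rfl) (hu0.comp h0)
      bijective_last := SeqHom.thicken_bijective _ V t ht (.inr le_rfl) (hun.comp hlast) }
  have hD' : D'.IsInjective := SeqHom.thicken_injective _ V t ht (by omega) (hu0.comp h0)
    (hun.comp hlast) fun i x y h => toFunDual_injective (congrArg Prod.fst h)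
  obtain ⟨θ, hθ, hθ'⟩ := D'.exists_equiv_std hD' D hD fun i hi => by
    by_cases hi2 : 2 ≤ i
    · obtain ⟨e1⟩ := hr i hi
      obtain ⟨e2⟩ := hs i
      refine nonempty_ker_thicken_equiv F V i ?_
      have h1 : stdRank n a b m i = r i + (s i + (m - (r i + s i))) := by
        have := hm' i hi
        rw [stdRank, if_neg (by omega), if_neg (by omega), if_pos hi]; omega
      let e3 : (GalMod.cond (2 ≤ i ∧ i < n) (V i)).V ≃ₗ[ZMod d] (V i).V :=
        (LinearEquiv.ofBijective _ (GalMod.toCond_bijective ⟨hi2, hi⟩ (V i))).symm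
      rw [h1]
      exact (e1.prodCongr (e3.trans ((e2.prodCongr (LinearEquiv.refl _ _)).trans
        (finFunProd _ _)))).trans (finFunProd _ _)
    have hs : Subsingleton (GalMod.cond (2 ≤ i ∧ i < n) (V i)).V :=
      GalMod.subsingleton_cond (by omega) _
    rcases Nat.eq_zero_or_pos i with rfl | hi0
    · have := subsingleton_fin_fun (d := d) (stdRank_zero (n := n) (a := a) (b := b) (m := m))
      have : Subsingleton (F.f 0).ker := by
        rw [LinearMap.ker_eq_bot.2 F.injective_zero]; infer_instance
      exact nonempty_ker_thicken_equiv F V 0 (LinearEquiv.ofSubsingleton _ _)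
    · obtain rfl : i = 1 := by omega
      have h1 : stdRank n a b m 1 = b := by rw [stdRank, if_neg (by omega), if_pos rfl]
      have h2 : (F.f 1).ker = (F.f 0).range := LinearMap.exact_iff.1 (F.exact 0)
      have e1 : (F.f 1).ker ≃ₗ[ZMod d] (Fin b → ZMod d) :=
        (LinearEquiv.ofEq _ _ h2).trans ((LinearEquiv.ofInjective _ F.injective_zero).symm.trans
          ((LinearEquiv.ofBijective ((u.comp φ₀).φ 0) (hu0.comp h0)).symm.trans e₀))
      rw [h1]
      let : Unique (GalMod.cond (2 ≤ 1 ∧ 1 < n) (V 1)).V := ⟨⟨0⟩, fun _ => hs.elim _ _⟩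
      let e2 : ((F.f 1).ker × (GalMod.cond (2 ≤ 1 ∧ 1 < n) (V 1)).V) ≃ₗ[ZMod d] (F.f 1).ker :=
        LinearEquiv.prodUnique
      exact nonempty_ker_thicken_equiv F V 1 (e2.trans e1)
  exact ⟨_, φ, θ, hθ, hθ'⟩

/-- Let `D_m` be a sequence of injective diagrams from `E` to the standard free extensions. Then
`E` comes from a shorter sequence if and only if the homomorphism `Γ → Aut(E)` lifts
to some `Aut(D_m)`. -/
theorem isShortenable_iff_exists_lift (hn : 3 ≤ n) (E : GalExactSeq Γ d (n + 1))
    (e₀ : E.X 0 ≃ₗ[ZMod d] (Fin b → ZMod d)) (m₀ : ℕ)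
    (D : ∀ m, Diagram E.toExactSeq (std d n a b (m₀ + m) (Nat.le_of_succ_le hn)))
    (hD : ∀ m, (D m).IsInjective) :
    IsShortenable E ↔ ∃ (m : ℕ) (q : Γ →* (D m).Aut), IsOpen (q.ker : Set Γ) ∧
      (D m).autHom.comp q = E.toAut := by
  constructor
  · intro h
    obtain ⟨m₁, hm₁⟩ := h.exists_std hn (a := a) e₀
    obtain ⟨F, φ, θ, hθ, hθ'⟩ := hm₁ (m₀ + m₁) (by omega) (D m₁) (hD m₁)
    have hθs : ∀ i x, F.f i ((θ i).symm x) = (θ (i + 1)).symm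
        ((std d n a b (m₀ + m₁) (Nat.le_of_succ_le hn)).f i x) := fun i x => by
      rw [LinearEquiv.eq_symm_apply, hθ, LinearEquiv.apply_symm_apply]
    -- the action on `F`, transported along the isomorphism `θ`
    let q₁ : Γ →* (std d n a b (m₀ + m₁) (Nat.le_of_succ_le hn)).Aut :=
      { toFun := fun γ => ⟨fun i => (θ i).symm.trans ((F.ρ i γ).trans (θ i)), fun i x => by
          change _ = θ (i + 1) (F.ρ (i + 1) γ ((θ (i + 1)).symm _))
          rw [← hθs, ← F.equivariant, hθ]; rfl⟩
        map_one' := Subtype.ext <| funext fun i => LinearEquiv.ext fun x => by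
          change θ i (F.ρ i 1 ((θ i).symm x)) = x
          rw [map_one]; exact (θ i).apply_symm_apply x
        map_mul' := fun γ γ' => Subtype.ext <| funext fun i => LinearEquiv.ext fun x => by
          change θ i (F.ρ i (γ * γ') ((θ i).symm x)) =
            θ i (F.ρ i γ ((θ i).symm (θ i (F.ρ i γ' ((θ i).symm x)))))
          rw [(θ i).symm_apply_apply, map_mul]; rfl }
    let q : Γ →* (D m₁).Aut := (E.toAut.prod q₁).codRestrict _ fun γ i x => by
      change (D m₁).φ i (E.ρ i γ x) = θ i (F.ρ i γ ((θ i).symm ((D m₁).φ i x)))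
      rw [← hθ', ← hθ', (θ i).symm_apply_apply, φ.equivariant]
    refine ⟨m₁, q, ?_, rfl⟩
    refine Subgroup.isOpen_of_mem_nhds _ (g := 1) (Filter.mem_of_superset
      (x := (⋂ i : Fin (n + 2), {γ | ∀ x, E.ρ i γ x = x}) ∩
        ⋂ i : Fin (n + 2), {γ | ∀ x, F.ρ i γ x = x}) (IsOpen.mem_nhds ?_ ?_) ?_)
    · exact (isOpen_iInter_of_finite fun i : Fin (n + 2) => (E.term i).isOpen_ker).inter
        (isOpen_iInter_of_finite fun i : Fin (n + 2) => (F.term i).isOpen_ker)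
    · exact ⟨Set.mem_iInter.2 fun i : Fin (n + 2) => (E.term i).ρ_one_apply,
        Set.mem_iInter.2 fun i : Fin (n + 2) => (F.term i).ρ_one_apply⟩
    · rintro γ ⟨h1, h2⟩
      refine Subtype.ext (Prod.ext (Subtype.ext (funext fun i => LinearEquiv.ext fun x => ?_))
        (Subtype.ext (funext fun i => LinearEquiv.ext fun x => ?_)))
      · by_cases hi : i < n + 2
        · exact Set.mem_iInter.1 h1 ⟨i, hi⟩ x
        · exact (E.subsingleton i (by omega)).elim _ _
      · by_cases hi : i < n + 2
        · exact (congrArg (θ i) (Set.mem_iInter.1 h2 ⟨i, hi⟩ _)).trans ((θ i).apply_symm_apply x)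
        · exact ((std d n a b (m₀ + m₁) (Nat.le_of_succ_le hn)).subsingleton i
            (by omega)).elim _ _
  · rintro ⟨m, q, hq, hqE⟩
    -- the lift defines an action on the standard free extension for which `D m` is equivariant
    let F : GalExactSeq Γ d n :=
      { toExactSeq := std d n a b (m₀ + m) (Nat.le_of_succ_le hn)
        ρ := fun i => (Pi.evalMonoidHom _ i).comp ((Subgroup.subtype _).comp
          ((MonoidHom.snd _ _).comp ((D m).Aut.subtype.comp q)))
        isOpen_stabilizer := fun i x => isOpen_stabilizer_of_mem _ x _ hq (one_mem q.ker)
          fun γ hγ => by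
            have h1 : q γ = 1 := hγ
            change (q γ).1.2.1 i x = x
            rw [h1]; rfl
        equivariant := fun i γ x => (q γ).1.2.2 i x }
    refine ⟨F, ⟨(D m).φ, fun i γ x => ?_, (D m).comm⟩, (D m).bijective_zero, (D m).bijective_last⟩
    have h1 := DFunLike.congr_fun hqE γ
    have h2 : (q γ).1.1 = E.toAut γ := h1
    have h3 := (q γ).2 i x
    rw [h2] at h3
    exact h3

end Lifting

/-! ### Galois algebras -/

section GaloisAlgebras

open TensorProduct

variable {H : Type} [Group H] [Finite H]

/-- An `R`-algebra `B` with an action of the finite group `H` is a Galois algebra if it has an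
`R`-basis `(b_j)`, indexed by `H`, such that the matrix `(h b_j)` is invertible over `B`. -/
def IsGal {R B : Type*} [CommRing R] [CommRing B] [Algebra R B] (ρ : H →* (B →ₐ[R] B)) : Prop :=
  ∃ b : Module.Basis H R B, ∃ M : Matrix H H B,
    letI := Fintype.ofFinite H
    letI := Classical.decEq H
    M * Matrix.of (fun h j => ρ h (b j)) = 1

section Ring

variable {R B : Type*} [CommRing R] [CommRing B] [Algebra R B] {ρ : H →* (B →ₐ[R] B)}

theorem IsGal.exists_basis [i₁ : Fintype H] [i₂ : DecidableEq H] (hρ : IsGal ρ) :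
    ∃ b : Module.Basis H R B, IsUnit (Matrix.of fun h j => ρ h (b j)).det := by
  obtain ⟨b, M, hM⟩ := hρ
  refine ⟨b, ?_⟩
  obtain rfl : i₁ = Fintype.ofFinite H := Subsingleton.elim _ _
  obtain rfl : i₂ = Classical.decEq H := Subsingleton.elim _ _
  let := Fintype.ofFinite H
  let := Classical.decEq H
  exact Matrix.isUnit_det_of_left_inverse hM

theorem isGal_of_isUnit [Fintype H] [DecidableEq H] (b : Module.Basis H R B)
    (hb : IsUnit (Matrix.of fun h j => ρ h (b j)).det) : IsGal ρ := by
  refine ⟨b, (Matrix.of fun h j => ρ h (b j))⁻¹, ?_⟩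
  convert Matrix.nonsing_inv_mul _ hb

/-- Base change of the action. -/
def baseChangeAction (C : Type*) [CommRing C] [Algebra R C] (ρ : H →* (B →ₐ[R] B)) :
    H →* (C ⊗[R] B →ₐ[C] C ⊗[R] B) where
  toFun h := Algebra.TensorProduct.map (AlgHom.id C C) (ρ h)
  map_one' := by
    rw [map_one]
    exact Algebra.TensorProduct.ext (by ext) (by ext; rfl)
  map_mul' h h' := by
    rw [map_mul]
    exact Algebra.TensorProduct.ext (by ext) (by ext; simp)

@[simp]
theorem baseChangeAction_tmul (C : Type*) [CommRing C] [Algebra R C] (ρ : H →* (B →ₐ[R] B)) (h : H)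
    (c : C) (b : B) : baseChangeAction C ρ h (c ⊗ₜ b) = c ⊗ₜ ρ h b := rfl

theorem IsGal.baseChange (hρ : IsGal ρ) (C : Type*) [CommRing C] [Algebra R C] :
    IsGal (baseChangeAction C ρ) := by
  classical
  let := Fintype.ofFinite H
  obtain ⟨b, hb⟩ := hρ.exists_basis
  refine isGal_of_isUnit (b.baseChange C) ?_
  have h := hb.map (Algebra.TensorProduct.includeRight : B →ₐ[R] C ⊗[R] B)
  rw [AlgHom.map_det] at h
  convert h
  ext h j
  simp

theorem IsGal.free (hρ : IsGal ρ) : Module.Free R B := by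
  obtain ⟨b, -⟩ := hρ
  exact Module.Free.of_basis b

theorem IsGal.finite (hρ : IsGal ρ) : Module.Finite R B := by
  obtain ⟨b, -⟩ := hρ
  exact Module.Finite.of_basis b

/-- The determinant identity `N(b) = ∏ h b`. -/
theorem IsGal.algebraMap_norm [Fintype H] (hρ : IsGal ρ) (x : B) :
    algebraMap R B (Algebra.norm R x) = ∏ h, ρ h x := by
  classical
  obtain ⟨b, hb⟩ := hρ.exists_basis
  set N := Matrix.of fun h j => ρ h (b j) with hN
  have h1 : N * (Algebra.leftMulMatrix b x).map (algebraMap R B) =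
      Matrix.diagonal (fun h => ρ h x) * N := by
    ext h j
    rw [Matrix.mul_apply, Matrix.diagonal_mul, hN]
    simp only [Matrix.of_apply, Matrix.map_apply]
    rw [← map_mul, ← b.sum_repr (x * b j), map_sum]
    refine Finset.sum_congr rfl fun i _ => ?_
    rw [map_smul, Algebra.smul_def, mul_comm, Algebra.leftMulMatrix_eq_repr_mul]
  have h2 := congrArg Matrix.det h1
  rw [Matrix.det_mul, Matrix.det_mul, Matrix.det_diagonal, mul_comm _ N.det] at h2
  rw [Algebra.norm_eq_matrix_det b, ← hb.mul_right_inj, ← h2, RingHom.map_det]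
  rfl

/-- The homomorphism `B ⊗ B → ∏ B`, `x ⊗ y ↦ (x h(y))`. -/
def tensorToPi (ρ : H →* (B →ₐ[R] B)) : B ⊗[R] B →ₐ[B] (H → B) :=
  Algebra.TensorProduct.lift (Algebra.ofId B (H → B)) (AlgHom.pi fun h => ρ h)
    fun _ _ => mul_comm _ _

@[simp]
theorem tensorToPi_tmul (ρ : H →* (B →ₐ[R] B)) (x y : B) (h : H) :
    tensorToPi ρ (x ⊗ₜ y) h = x * ρ h y := rfl

/-- The tensor square of a Galois algebra `B` is the product of copies of `B` indexed by `H`. -/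
theorem IsGal.bijective_tensorToPi (hρ : IsGal ρ) : Function.Bijective (tensorToPi ρ) := by
  classical
  let := Fintype.ofFinite H
  obtain ⟨b, hb⟩ := hρ.exists_basis
  have h : LinearMap.toMatrix (b.baseChange B) (Pi.basisFun B H) (tensorToPi ρ).toLinearMap =
      Matrix.of fun h j => ρ h (b j) := by
    ext h j
    simp [LinearMap.toMatrix_apply]
  rw [← h] at hb
  exact (LinearEquiv.ofIsUnitDet hb).bijective

/-- Converse: an algebra which is free of rank `|H|` is a Galois algebra if its tensor square is
a product. -/
theorem isGal_of_bijective (b : Module.Basis H R B) (hb : Function.Bijective (tensorToPi ρ)) :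
    IsGal ρ := by
  classical
  let := Fintype.ofFinite H
  have h : LinearMap.toMatrix (b.baseChange B) (Pi.basisFun B H) (tensorToPi ρ).toLinearMap =
      Matrix.of fun h j => ρ h (b j) := by
    ext h j
    simp [LinearMap.toMatrix_apply]
  refine isGal_of_isUnit b ?_
  rw [← h]
  exact LinearEquiv.isUnit_det (LinearEquiv.ofBijective (tensorToPi ρ).toLinearMap hb) _ _

/-- The image of the matrix of conjugates in a nontrivial ring is invertible, so that its rows are
distinct. -/
theorem IsGal.comp_injective (hρ : IsGal ρ) {Ω : Type*} [CommRing Ω] [Nontrivial Ω] (c : B →+* Ω)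
    {h h' : H} (hh : ∀ x, c (ρ h x) = c (ρ h' x)) : h = h' := by
  classical
  let := Fintype.ofFinite H
  obtain ⟨b, hb⟩ := hρ.exists_basis
  by_contra hne
  have h1 := hb.map c
  rw [RingHom.map_det, Matrix.det_zero_of_row_eq hne (funext fun j => hh (b j))] at h1
  exact not_isUnit_zero h1

/-- A Galois algebra from an element with invertible matrix of conjugates, over the subring of
invariants. -/
theorem isGal_of_invariants [Fintype H] [DecidableEq H] (hinv : ∀ x, (∀ h, ρ h x = x) →
    ∃ c, algebraMap R B c = x) (hinj : Function.Injective (algebraMap R B)) (b : H → B)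
    (hb : IsUnit (Matrix.of fun h j => ρ h (b j)).det) : IsGal ρ := by
  set N := Matrix.of fun h j => ρ h (b j) with hN
  have hN' : IsUnit N := (Matrix.isUnit_iff_isUnit_det _).2 hb
  have hli : LinearIndependent R b := by
    rw [Fintype.linearIndependent_iff]
    intro g hg j
    apply hinj
    rw [map_zero]
    refine congrFun (Matrix.mulVec_injective_of_isUnit hN' (a₁ := fun j => algebraMap R B (g j))
      (a₂ := 0) (funext fun h => ?_)) j
    rw [Matrix.mulVec_zero]
    have h1 := congrArg (ρ h) hg
    rw [map_zero, map_sum] at h1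
    refine Eq.trans (Finset.sum_congr rfl fun j _ => ?_) h1
    rw [map_smul, Algebra.smul_def, mul_comm]; rfl
  have hspan : ⊤ ≤ Submodule.span R (Set.range b) := by
    intro x _
    obtain ⟨y, hy⟩ : ∃ y, N.mulVec y = fun h => ρ h x := ⟨N⁻¹.mulVec fun h => ρ h x, by
      rw [Matrix.mulVec_mulVec, Matrix.mul_nonsing_inv _ hb, Matrix.one_mulVec]⟩
    -- the solution of an equivariant system of equations is invariant
    have hy' : ∀ h j, ρ h (y j) = y j := fun h => congrFun <|
      Matrix.mulVec_injective_of_isUnit hN' <| hy.symm ▸ funext fun g => by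
        have h1 := congrArg (ρ h) (congrFun hy (h⁻¹ * g))
        rw [← AlgHom.mul_apply, ← map_mul, mul_inv_cancel_left] at h1
        rw [← h1]
        simp only [Matrix.mulVec, dotProduct]
        rw [map_sum]
        refine Finset.sum_congr rfl fun j _ => ?_
        rw [map_mul, hN, Matrix.of_apply, Matrix.of_apply, ← AlgHom.mul_apply, ← map_mul,
          mul_inv_cancel_left]
    choose c hc using fun j => hinv (y j) fun h => hy' h j
    have hx : x = ∑ j, c j • b j := by
      have h1 := congrFun hy 1
      simp only [map_one, AlgHom.one_apply] at h1
      rw [← h1]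
      refine Finset.sum_congr rfl fun j _ => ?_
      rw [Algebra.smul_def, hc, mul_comm]
      change y j * ρ 1 (b j) = _
      rw [map_one, AlgHom.one_apply]
    rw [hx]
    exact Submodule.sum_mem _ fun j _ => Submodule.smul_mem _ _ (Submodule.subset_span ⟨j, rfl⟩)
  refine isGal_of_isUnit (Module.Basis.mk hli hspan) ?_
  simpa only [Module.Basis.mk_apply] using hb

end Ring

section Field

variable {K L : Type*} [Field K] [CommRing L] [Algebra K L] {ρ : H →* (L →ₐ[K] L)}

/-- The invariants of a Galois algebra over a field are the scalars. -/
theorem IsGal.exists_algebraMap_eq (hρ : IsGal ρ) (x : L) (hx : ∀ h, ρ h x = x) :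
    ∃ c, algebraMap K L c = x := by
  classical
  let := Fintype.ofFinite H
  obtain ⟨b, hb⟩ := hρ.exists_basis
  have : Nontrivial L := ⟨b 1, 0, b.ne_zero 1⟩
  -- both `x` and `1` have coordinates, and the coordinates of `x * 1` are unique over `L`
  have h1 : ∀ j, algebraMap K L (b.repr x j) = x * algebraMap K L (b.repr 1 j) := by
    have h2 : (Matrix.of fun h j => ρ h (b j)).mulVec (fun j => algebraMap K L (b.repr x j)) =
        (Matrix.of fun h j => ρ h (b j)).mulVec (fun j => x * algebraMap K L (b.repr 1 j)) := by
      have h3 : ∀ y h, ∑ j, ρ h (b j) * algebraMap K L (b.repr y j) = ρ h y := fun y h => by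
        conv_rhs => rw [← b.sum_repr y, map_sum]
        exact Finset.sum_congr rfl fun j _ => by rw [map_smul, Algebra.smul_def, mul_comm]
      ext h
      simp only [Matrix.mulVec, dotProduct, Matrix.of_apply]
      rw [h3, hx]
      simp only [mul_left_comm _ x]
      rw [← Finset.mul_sum, h3, map_one, mul_one]
    exact fun j => congrFun (Matrix.mulVec_injective_of_isUnit
      ((Matrix.isUnit_iff_isUnit_det _).2 hb) h2) j
  obtain ⟨j, hj⟩ : ∃ j, b.repr 1 j ≠ 0 := by
    by_contra! h
    exact one_ne_zero (b.repr.map_eq_zero_iff.1 (Finsupp.ext h))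
  refine ⟨b.repr x j * (b.repr 1 j)⁻¹, ?_⟩
  rw [map_mul, h1, mul_assoc, ← map_mul, mul_inv_cancel₀ hj, map_one, mul_one]

variable {Ω : Type*} [Field Ω] [Algebra K Ω]

/-- Two homomorphisms to a field differ by an element of the group, because the conjugates of one of
them span the space of linear maps `L → Ω`, and distinct homomorphisms are linearly independent. -/
theorem IsGal.exists_comp_eq (hρ : IsGal ρ) (c c' : L →ₐ[K] Ω) : ∃ h, c' = c.comp (ρ h) := by
  classical
  let := Fintype.ofFinite H
  obtain ⟨b, hb⟩ := hρ.exists_basis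
  by_contra! hne
  have hinj : Function.Injective fun h => c.comp (ρ h) := fun h h' hh =>
    hρ.comp_injective (c : L →+* Ω) fun x => DFunLike.congr_fun hh x
  have hinj' : Function.Injective fun o : Option H => o.elim c' fun h => c.comp (ρ h) := by
    rintro (_ | h) (_ | h') hh
    · rfl
    · exact absurd hh (hne h')
    · exact absurd hh.symm (hne h)
    · exact congrArg some (hinj hh)
  have hli := (linearIndependent_algHom_toLinearMap K L Ω).comp _ hinj'
  have hb' := hb.map c
  rw [AlgHom.map_det] at hb'
  -- `c'` is a linear combination of the `c ∘ h`
  obtain ⟨y, hy⟩ : ∃ y, (c.mapMatrix (Matrix.of fun h j => ρ h (b j))).vecMul y =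
      fun j => c' (b j) := ⟨(c.mapMatrix (Matrix.of fun h j => ρ h (b j)))⁻¹.vecMul
        fun j => c' (b j), by
      rw [Matrix.vecMul_vecMul, Matrix.nonsing_inv_mul _ hb', Matrix.vecMul_one]⟩
  have h0 : ∑ o : Option H, (o.elim (-1) y : Ω) •
      (o.elim c' fun h => c.comp (ρ h) : L →ₐ[K] Ω).toLinearMap = 0 := by
    refine b.ext fun j => ?_
    rw [Fintype.sum_option]
    simp only [Option.elim_none, Option.elim_some, LinearMap.add_apply, LinearMap.smul_apply,
      LinearMap.sum_apply, AlgHom.toLinearMap_apply, LinearMap.zero_apply, ← congrFun hy j]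
    simp [Matrix.vecMul, dotProduct]
  have h1 := Fintype.linearIndependent_iff.1 hli _ h0 none
  simp at h1

end Field

end GaloisAlgebras

/-! ### The generic normal element -/

section NormalElements

open TensorProduct

variable {H : Type} [Group H] [Finite H]

/-- The determinant of the matrix `(ξ_{gh})`. If `ξ_h = h z` for an element `z` of an algebra with
an action of `H`, it is a unit if and only if the conjugates of `z` are a normal basis. -/
def conjDet {C : Type*} [CommRing C] (ξ : H → C) : C :=
  letI := Fintype.ofFinite H
  letI := Classical.decEq H
  (Matrix.of fun g h => ξ (g * h)).det

section ConjDet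

variable {C D : Type*} [CommRing C] [CommRing D]

theorem conjDet_eq [i₁ : Fintype H] [i₂ : DecidableEq H] (ξ : H → C) :
    conjDet ξ = (Matrix.of fun g h => ξ (g * h)).det := by
  obtain rfl : i₁ = Fintype.ofFinite H := Subsingleton.elim _ _
  obtain rfl : i₂ = Classical.decEq H := Subsingleton.elim _ _
  rfl

theorem map_conjDet (f : C →+* D) (ξ : H → C) : f (conjDet ξ) = conjDet fun h => f (ξ h) := by
  classical
  let := Fintype.ofFinite H
  rw [conjDet_eq, conjDet_eq, RingHom.map_det]
  rfl

/-- The determinant is a unit if and only if `ξ`, as an element of the group algebra, is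
invertible. -/
theorem isUnit_conjDet_iff [Fintype H] [DecidableEq H] (ξ : H → C) : IsUnit (conjDet ξ) ↔
    ∃ y : H → C, ∀ g, ∑ h, ξ (g * h) * y h = if g = 1 then 1 else 0 := by
  rw [conjDet_eq]
  constructor
  · intro h
    refine ⟨fun i => (Matrix.of fun g h => ξ (g * h))⁻¹ i 1, fun g => ?_⟩
    have h1 := congrFun (congrFun (Matrix.mul_nonsing_inv _ h) g) 1
    rw [Matrix.mul_apply, Matrix.one_apply] at h1
    exact h1
  · rintro ⟨y, hy⟩
    refine Matrix.isUnit_det_of_right_inverse (B := Matrix.of fun h g => y (g * h)) ?_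
    ext g g'
    rw [Matrix.mul_apply, Matrix.one_apply]
    have h1 := hy (g * g'⁻¹)
    rw [← Equiv.sum_comp (Equiv.mulLeft g')] at h1
    simp only [Equiv.coe_mulLeft, mul_inv_eq_one] at h1
    simpa [mul_assoc] using h1

theorem isUnit_conjDet_translate {ξ : H → C} (h : IsUnit (conjDet ξ)) (g : H) :
    IsUnit (conjDet fun h => ξ (g * h)) := by
  classical
  let := Fintype.ofFinite H
  rw [isUnit_conjDet_iff] at h ⊢
  obtain ⟨y, hy⟩ := h
  refine ⟨fun h => y (g * h), fun g' => ?_⟩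
  have h1 := hy (g * g' * g⁻¹)
  rw [← Equiv.sum_comp (Equiv.mulLeft g)] at h1
  simp only [Equiv.coe_mulLeft, mul_inv_eq_one] at h1
  simpa [mul_assoc] using h1

/-- Extension by zero to a larger group preserves invertibility of the determinant. -/
theorem isUnit_conjDet_extend {H' : Type} [Group H'] [Finite H'] (j : H →* H')
    (hj : Function.Injective j) {ξ : H → C} (h : IsUnit (conjDet ξ)) :
    IsUnit (conjDet (Function.extend j ξ 0)) := by
  classical
  let := Fintype.ofFinite H
  let := Fintype.ofFinite H'
  rw [isUnit_conjDet_iff] at h ⊢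
  obtain ⟨y, hy⟩ := h
  refine ⟨Function.extend j y 0, fun g => ?_⟩
  have h0 : ∀ F : H' → C, (∀ x, x ∉ Set.range j → F x = 0) → ∑ x, F x = ∑ x, F (j x) :=
    fun F hF => (Finset.sum_subset (Finset.subset_univ (Finset.univ.map ⟨j, hj⟩))
      (fun x _ hx => hF x (by simpa using hx))).symm.trans (Finset.sum_map _ _ _)
  rw [h0 _ fun x hx => by rw [Function.extend_apply' _ _ _ hx, Pi.zero_apply, mul_zero]]
  simp only [hj.extend_apply]
  by_cases hg : g ∈ Set.range j
  · obtain ⟨g, rfl⟩ := hg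
    simp only [← map_mul, hj.extend_apply, hy, map_eq_one_iff j hj]
  · rw [if_neg (by rintro rfl; exact hg ⟨1, map_one j⟩)]
    refine Finset.sum_eq_zero fun x _ => ?_
    rw [Function.extend_apply', Pi.zero_apply, zero_mul]
    rintro ⟨y, hy⟩
    exact hg ⟨y * x⁻¹, by rw [map_mul, hy, map_inv, mul_inv_cancel_right]⟩

theorem conjDet_single [DecidableEq H] : IsUnit (conjDet (Pi.single 1 1 : H → C)) := by
  classical
  let := Fintype.ofFinite H
  refine (isUnit_conjDet_iff _).2 ⟨Pi.single 1 1, fun g => ?_⟩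
  rw [Finset.sum_eq_single 1 (fun h _ hh => by simp [hh]) (by simp)]
  simp [Pi.single_apply]

end ConjDet

variable (A : Type*) [CommRing A] (H) (N : ℕ)

/-- The generic determinant. -/
def genDet : MvPolynomial (H ⊕ Fin N) A := conjDet fun h => MvPolynomial.X (Sum.inl h)

/-- The ring obtained from `A` by adjunction of the conjugates `x_h`, `h ∈ H`, of a generic normal
element and of further indeterminates `y_1, …, y_N`. -/
abbrev NormalRing : Type _ := Localization.Away (genDet H A N)

namespace NormalRing

variable {A H N}

/-- The conjugates of the generic normal element. -/
def x (h : H) : NormalRing H A N := algebraMap (MvPolynomial (H ⊕ Fin N) A) _ (.X (.inl h))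

/-- The further indeterminates. -/
def y (i : Fin N) : NormalRing H A N := algebraMap (MvPolynomial (H ⊕ Fin N) A) _ (.X (.inr i))

theorem algebraMap_genDet :
    algebraMap (MvPolynomial (H ⊕ Fin N) A) (NormalRing H A N) (genDet H A N) = conjDet x :=
  map_conjDet _ _

theorem isUnit_conjDet_x : IsUnit (conjDet (x : H → NormalRing H A N)) := by
  rw [← algebraMap_genDet]
  exact IsLocalization.Away.algebraMap_isUnit _

variable {C : Type*} [CommRing C]

/-- The universal property. -/
def lift (c : A →+* C) (ξ : H → C) (η : Fin N → C) (hξ : IsUnit (conjDet ξ)) :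
    NormalRing H A N →+* C :=
  IsLocalization.Away.lift (genDet H A N) (g := MvPolynomial.eval₂Hom c (Sum.elim ξ η)) (by
    rw [genDet, map_conjDet]
    simpa using hξ)

variable (c : A →+* C) (ξ : H → C) (η : Fin N → C) (hξ : IsUnit (conjDet ξ))

theorem lift_algebraMap' (P : MvPolynomial (H ⊕ Fin N) A) :
    lift c ξ η hξ (algebraMap _ _ P) = MvPolynomial.eval₂ c (Sum.elim ξ η) P :=
  IsLocalization.Away.lift_eq _ _ _

@[simp]
theorem lift_algebraMap (a : A) : lift c ξ η hξ (algebraMap A _ a) = c a := by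
  rw [IsScalarTower.algebraMap_apply A (MvPolynomial (H ⊕ Fin N) A), lift_algebraMap']
  simp [MvPolynomial.algebraMap_eq]

@[simp]
theorem lift_x (h : H) : lift c ξ η hξ (x h) = ξ h := by
  rw [x, lift_algebraMap']; simp

@[simp]
theorem lift_y (i : Fin N) : lift c ξ η hξ (y i) = η i := by
  rw [y, lift_algebraMap']; simp

variable {c ξ η hξ}

theorem hom_ext {f g : NormalRing H A N →+* C} (h1 : ∀ a : A, f (algebraMap A _ a) =
    g (algebraMap A _ a)) (h2 : ∀ h, f (x h) = g (x h)) (h3 : ∀ i, f (y i) = g (y i)) : f = g := by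
  refine IsLocalization.ringHom_ext (Submonoid.powers (genDet H A N)) ?_
  refine MvPolynomial.ringHom_ext (fun a => ?_) fun i => ?_
  · have := h1 a
    rwa [IsScalarTower.algebraMap_apply A (MvPolynomial (H ⊕ Fin N) A)] at this
  · rcases i with h | i
    · exact h2 h
    · exact h3 i

section Action

variable {k : Type*} [CommRing k] [Algebra k A]

/-- The universal property, for homomorphisms of algebras. -/
def liftAlg [Algebra k C] (c : A →ₐ[k] C) (ξ : H → C) (η : Fin N → C) (hξ : IsUnit (conjDet ξ)) :
    NormalRing H A N →ₐ[k] C :=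
  { lift (c : A →+* C) ξ η hξ with
    commutes' := fun r => by
      change lift (c : A →+* C) ξ η hξ _ = _
      rw [IsScalarTower.algebraMap_apply k A, lift_algebraMap]
      exact c.commutes r }

theorem liftAlg_coe [Algebra k C] (c : A →ₐ[k] C) (ξ : H → C) (η : Fin N → C)
    (hξ : IsUnit (conjDet ξ)) (b : NormalRing H A N) :
    liftAlg c ξ η hξ b = lift (c : A →+* C) ξ η hξ b := rfl

@[simp]
theorem liftAlg_algebraMap [Algebra k C] (c : A →ₐ[k] C) (ξ : H → C) (η : Fin N → C)
    (hξ : IsUnit (conjDet ξ)) (a : A) : liftAlg c ξ η hξ (algebraMap A _ a) = c a :=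
  lift_algebraMap _ _ _ hξ a

@[simp]
theorem liftAlg_x [Algebra k C] (c : A →ₐ[k] C) (ξ : H → C) (η : Fin N → C)
    (hξ : IsUnit (conjDet ξ)) (h : H) : liftAlg c ξ η hξ (x h) = ξ h :=
  lift_x _ _ _ hξ h

@[simp]
theorem liftAlg_y [Algebra k C] (c : A →ₐ[k] C) (ξ : H → C) (η : Fin N → C)
    (hξ : IsUnit (conjDet ξ)) (i : Fin N) : liftAlg c ξ η hξ (y i) = η i :=
  lift_y _ _ _ hξ i

theorem algHom_ext [Algebra k C] {f g : NormalRing H A N →ₐ[k] C} (h1 : ∀ a : A,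
    f (algebraMap A _ a) = g (algebraMap A _ a)) (h2 : ∀ h, f (x h) = g (x h))
    (h3 : ∀ i, f (y i) = g (y i)) : f = g :=
  AlgHom.coe_ringHom_injective (hom_ext (f := (f : NormalRing H A N →+* C)) (g := g) h1 h2 h3)

/-- The action of `H`, which extends a given action on `A`, with `g x_h = x_{gh}` and
`g y_i = y_i`. -/
def action (α : H →* (A →ₐ[k] A)) : H →* (NormalRing H A N →ₐ[k] NormalRing H A N) where
  toFun g := liftAlg ((IsScalarTower.toAlgHom k A _).comp (α g)) (fun h => x (g * h)) y
    (isUnit_conjDet_translate isUnit_conjDet_x g)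
  map_one' := algHom_ext (fun a => by simp) (fun h => by simp) (fun i => by simp)
  map_mul' g g' := algHom_ext (fun a => by simp) (fun h => by simp [mul_assoc])
    (fun i => by simp)

variable (α : H →* (A →ₐ[k] A))

@[simp]
theorem action_algebraMap (g : H) (a : A) :
    action (N := N) α g (algebraMap A _ a) = algebraMap A _ (α g a) := by simp [action]

@[simp]
theorem action_x (g h : H) : action (N := N) α g (x h) = x (g * h) := by simp [action]

@[simp]
theorem action_y (g : H) (i : Fin N) : action α g (y i) = y i := by simp [action]

end Action

end NormalRing

end NormalElements

/-! ### The ring of invariants -/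

section Invariants

open TensorProduct

variable {H : Type} [Group H] [Finite H]

section General

variable {k B : Type*} [CommRing k] [CommRing B] [Algebra k B] (ρ : H →* (B →ₐ[k] B))

/-- The subalgebra of invariants. -/
def invariants : Subalgebra k B where
  carrier := {b | ∀ h, ρ h b = b}
  mul_mem' := fun ha hb h => by rw [map_mul, ha, hb]
  add_mem' := fun ha hb h => by rw [map_add, ha, hb]
  algebraMap_mem' := fun c h => (ρ h).commutes c

/-- The action is linear over the invariants. -/
def invAction : H →* (B →ₐ[invariants ρ] B) where
  toFun h := { (ρ h : B →+* B) with commutes' := fun c => c.2 h }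
  map_one' := AlgHom.ext fun b => by
    change ρ 1 b = b
    rw [map_one]; rfl
  map_mul' h h' := AlgHom.ext fun b => by
    change ρ (h * h') b = ρ h (ρ h' b)
    rw [map_mul]; rfl

end General

variable {k A : Type*} [CommRing k] [CommRing A] [Algebra k A] {N : ℕ} (α : H →* (A →ₐ[k] A))

namespace NormalRing

/-- The conjugates of the generic normal element have an invertible matrix of conjugates. -/
theorem isGal : IsGal (invAction (action (N := N) α)) := by
  classical
  let := Fintype.ofFinite H
  refine isGal_of_invariants (fun b hb => ⟨⟨b, hb⟩, rfl⟩) Subtype.val_injective x ?_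
  have h := isUnit_conjDet_x (H := H) (A := A) (N := N)
  rw [conjDet_eq] at h
  have e : (Matrix.of fun g h => invAction (action (N := N) α) g (x h)) =
      Matrix.of fun g h => x (g * h) := by
    ext g h : 2
    exact action_x α g h
  rw [e]
  exact h

theorem finiteType_invariants {k A : Type*} [Field k] [CommRing A] [Algebra k A]
    [Algebra.FiniteType k A] (α : H →* (A →ₐ[k] A)) :
    Algebra.FiniteType k (invariants (action (N := N) α)) := by
  have h1 : Algebra.FiniteType k (NormalRing H A N) :=
    Algebra.FiniteType.trans (S := A) inferInstance inferInstance
  have h2 := (isGal (N := N) α).finite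
  exact ⟨fg_of_fg_of_fg k (invariants (action (N := N) α)) (NormalRing H A N) h1.1 h2.1
    Subtype.val_injective⟩

/-- A common denominator of finitely many elements. -/
theorem exists_mul_pow {ι : Type*} (s : Finset ι) (r : ι → NormalRing H A N) :
    ∃ (n : ℕ) (p : ι → MvPolynomial (H ⊕ Fin N) A), ∀ i ∈ s,
      r i * conjDet x ^ n = algebraMap _ _ (p i) := by
  obtain ⟨⟨_, n, rfl⟩, hb⟩ := IsLocalization.exist_integer_multiples
    (Submonoid.powers (genDet H A N)) s r
  have h : ∀ i, ∃ p, i ∈ s → algebraMap _ _ p = genDet H A N ^ n • r i := fun i => by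
    by_cases hi : i ∈ s
    · obtain ⟨p, hp⟩ := hb i hi
      exact ⟨p, fun _ => hp⟩
    · exact ⟨0, fun h => absurd h hi⟩
  choose p hp using h
  refine ⟨n, p, fun i hi => ?_⟩
  rw [hp i hi, Algebra.smul_def, map_pow, algebraMap_genDet, mul_comm]

end NormalRing

variable {k A : Type*} [Field k] [CommRing A] [Algebra k A] {G : Type} [Group G] [Finite G]

/-- Elements of a Galois algebra whose conjugates satisfy a linear relation, with linearly
independent coefficients in an extension of the base field, vanish. -/
theorem IsGal.eq_zero_of_sum_eq_zero {α : G →* (A →ₐ[k] A)} (hα : IsGal α) {K' : Type*} [Field K']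
    [Algebra k K'] (c : A →ₐ[k] K') {ι : Type*} {l : ι → K'} (hl : LinearIndependent k l)
    (s : Finset ι) (a : ι → A) (ha : ∀ g, ∑ i ∈ s, l i * c (α g (a i)) = 0) :
    ∀ i ∈ s, a i = 0 := by
  classical
  let := Fintype.ofFinite G
  obtain ⟨b, hb⟩ := hα.exists_basis
  have hb' := hb.map c
  rw [AlgHom.map_det] at hb'
  have h1 : ∀ j, ∑ i ∈ s, b.repr (a i) j • l i = 0 := by
    refine fun j => congrFun (Matrix.mulVec_injective_of_isUnit
      ((Matrix.isUnit_iff_isUnit_det _).2 hb') (a₁ := fun j => ∑ i ∈ s, b.repr (a i) j • l i)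
      (a₂ := 0) (funext fun g => ?_)) j
    rw [Matrix.mulVec_zero, Pi.zero_apply, ← ha g]
    simp only [Matrix.mulVec, dotProduct, AlgHom.mapMatrix_apply, Matrix.map_apply,
      Matrix.of_apply, Finset.mul_sum]
    rw [Finset.sum_comm]
    refine Finset.sum_congr rfl fun i _ => ?_
    conv_rhs => rw [← b.sum_repr (a i), map_sum, map_sum, Finset.mul_sum]
    refine Finset.sum_congr rfl fun j _ => ?_
    rw [map_smul, map_smul, mul_smul_comm, mul_smul_comm, mul_comm]
  intro i hi
  refine b.repr.map_eq_zero_iff.1 (Finsupp.ext fun j => ?_)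
  exact linearIndependent_iff'.1 hl s _ (h1 j) i hi

namespace NormalRing

theorem genDet_ne_zero (K : Type*) [CommRing K] [Nontrivial K] : genDet H K N ≠ 0 := by
  classical
  intro h
  have h1 := congrArg (MvPolynomial.eval (Sum.elim (Pi.single 1 1) 0 : H ⊕ Fin N → K)) h
  rw [genDet, map_conjDet, map_zero] at h1
  have h2 : IsUnit (conjDet (Pi.single 1 1 : H → K)) := conjDet_single
  simp only [MvPolynomial.eval_X, Sum.elim_inl] at h1
  rw [h1] at h2
  exact not_isUnit_zero h2

theorem algebraMap_injective (K : Type*) [CommRing K] [IsDomain K] :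
    Function.Injective (algebraMap (MvPolynomial (H ⊕ Fin N) K) (NormalRing H K N)) :=
  IsLocalization.injective _ (powers_le_nonZeroDivisors_of_noZeroDivisors (genDet_ne_zero K))

instance (K : Type*) [CommRing K] [IsDomain K] : IsDomain (NormalRing H K N) :=
  IsLocalization.isDomain_localization
    (powers_le_nonZeroDivisors_of_noZeroDivisors (genDet_ne_zero K))

/-- A linear combination of values of elements of `NormalRing`, cleared of the common denominator,
is a value of a polynomial. -/
theorem sum_mul_conjDet_pow {A : Type*} [CommRing A] {K' Ω : Type*} [CommRing K'] [CommRing Ω]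
    [Algebra K' Ω] (c : A →+* K') {ξ : H → Ω} {η : Fin N → Ω} (hξ : IsUnit (conjDet ξ)) {ι : Type*}
    {s : Finset ι} (l : ι → K') {r : ι → NormalRing H A N} {n : ℕ}
    {p : ι → MvPolynomial (H ⊕ Fin N) A}
    (hp : ∀ i ∈ s, r i * conjDet x ^ n = algebraMap _ _ (p i)) :
    (∑ i ∈ s, algebraMap K' Ω (l i) * lift ((algebraMap K' Ω).comp c) ξ η hξ (r i)) *
      conjDet ξ ^ n = MvPolynomial.aeval (Sum.elim ξ η) (∑ i ∈ s, l i • (p i).map c) := by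
  rw [Finset.sum_mul, map_sum]
  refine Finset.sum_congr rfl fun i hi => ?_
  have h1 := congrArg (lift ((algebraMap K' Ω).comp c) ξ η hξ) (hp i hi)
  rw [map_mul, map_pow, map_conjDet, lift_algebraMap'] at h1
  simp only [lift_x] at h1
  rw [mul_assoc, h1, map_smul, Algebra.smul_def, MvPolynomial.aeval_def, MvPolynomial.eval₂_map]

theorem aeval_x_y {K : Type*} [CommRing K] (P : MvPolynomial (H ⊕ Fin N) K) :
    MvPolynomial.aeval (Sum.elim x y) P = algebraMap _ (NormalRing H K N) P := by
  have h : (MvPolynomial.aeval (Sum.elim x y) : _ →ₐ[K] NormalRing H K N) =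
      IsScalarTower.toAlgHom K _ (NormalRing H K N) := by
    refine MvPolynomial.algHom_ext fun i => ?_
    rcases i with i | i
    · rw [MvPolynomial.aeval_X]; rfl
    · rw [MvPolynomial.aeval_X]; rfl
  exact DFunLike.congr_fun h P

/-- The action of `h` on the coefficients can be compensated by a change of variables. -/
theorem lift_action {k A : Type*} [CommRing k] [CommRing A] [Algebra k A] {K' : Type*}
    [CommRing K'] (α : H →* (A →ₐ[k] A)) (c : A →+* K') (h : H) (b : NormalRing H A N) :
    lift ((algebraMap K' (NormalRing H K' N)).comp c) x y isUnit_conjDet_x (action α h b) =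
      action (N := N) (1 : H →* (K' →ₐ[K'] K')) h (lift ((algebraMap K' (NormalRing H K' N)).comp
        (c.comp (α h : A →+* A))) x y isUnit_conjDet_x b) := by
  have e : (lift ((algebraMap K' (NormalRing H K' N)).comp c) x y isUnit_conjDet_x).comp
      (action (N := N) α h : NormalRing H A N →+* NormalRing H A N) =
      (action (N := N) (1 : H →* (K' →ₐ[K'] K')) h : NormalRing H K' N →+* NormalRing H K' N).comp
        (lift ((algebraMap K' (NormalRing H K' N)).comp (c.comp (α h : A →+* A))) x y
          isUnit_conjDet_x) := by
    refine hom_ext (fun a => ?_) (fun h' => ?_) (fun i => ?_)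
    · simp
    · simp
    · simp
  exact DFunLike.congr_fun e b

/-- A nonzero function `z` on the base change to `K` of the spectrum of the ring of invariants is
nonzero at the points where a certain nonzero polynomial `P` does not vanish. The points are those
induced by points of the spectrum of `NormalRing` over a fixed point `c` of the spectrum of `A`.

The polynomial `P` is the numerator of the restriction of `z` to the fibre over `c`. If it
vanishes, then the restrictions to the fibres over all conjugates of `c` vanish, because `z` is
invariant under `H` and `H → G` is surjective. As `A` is a Galois algebra, this implies that
`z = 0`. -/
theorem exists_polynomial {k A : Type*} [Field k] [CommRing A] [Algebra k A] {G : Type} [Group G]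
    [Finite G] {α : G →* (A →ₐ[k] A)} (hα : IsGal α) {φ : H →* G} (hφ : Function.Surjective φ)
    {K : Type*} {K' : Type v} [Field K] [Field K'] [Algebra k K] [Algebra k K'] [Algebra K K']
    [IsScalarTower k K K'] (c : A →ₐ[k] K')
    (z : K ⊗[k] invariants (action (N := N) (α.comp φ))) (hz : z ≠ 0) :
    ∃ P : MvPolynomial (H ⊕ Fin N) K', P ≠ 0 ∧ ∀ (Ω : Type v) [CommRing Ω] [Algebra K' Ω]
      (ξ : H → Ω) (η : Fin N → Ω) (hξ : IsUnit (conjDet ξ)) (Θ : K ⊗[k]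
        invariants (action (N := N) (α.comp φ)) →+* Ω),
      (∀ t r, Θ (t ⊗ₜ r) = algebraMap K' Ω (algebraMap K K' t) *
        lift ((algebraMap K' Ω).comp (c : A →+* K')) ξ η hξ r) → Θ z = 0 →
      MvPolynomial.aeval (Sum.elim ξ η) P = 0 := by
  classical
  let bK := Module.Basis.ofVectorSpace k K
  obtain ⟨r, rfl⟩ := (TensorProduct.equivFinsuppOfBasisLeft bK).symm.surjective z
  rw [TensorProduct.equivFinsuppOfBasisLeft_symm_apply] at hz ⊢
  obtain ⟨n, p, hp⟩ := exists_mul_pow r.support fun i => (r i : NormalRing H A N)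
  let l : _ → K' := fun i => algebraMap K K' (bK i)
  have hl : LinearIndependent k l := by
    have := bK.linearIndependent.map' (IsScalarTower.toAlgHom k K K').toLinearMap
      (LinearMap.ker_eq_bot.2 (algebraMap K K').injective)
    exact this
  refine ⟨∑ i ∈ r.support, l i • (p i).map (c : A →+* K'), fun hP => hz ?_,
    fun Ω _ _ ξ η hξ Θ hΘ h0 => ?_⟩
  · have hr : ∀ i ∈ r.support, ∀ h, action (N := N) (α.comp φ) h (r i) = r i :=
      fun i _ => (r i).2
    have key : ∀ g, ∑ i ∈ r.support,
        l i • (p i).map ((c : A →+* K').comp (α g : A →+* A)) = 0 := by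
      intro g
      obtain ⟨h, rfl⟩ := hφ g
      apply algebraMap_injective (H := H) (N := N) K'
      have e1 := sum_mul_conjDet_pow (Ω := NormalRing H K' N) (c : A →+* K') (ξ := x) (η := y)
        isUnit_conjDet_x l hp
      have e2 := sum_mul_conjDet_pow (Ω := NormalRing H K' N)
        ((c : A →+* K').comp (α (φ h) : A →+* A)) (ξ := x) (η := y) isUnit_conjDet_x l hp
      rw [map_zero, ← aeval_x_y, ← e2]
      rw [hP, map_zero] at e1
      have e4 := (isUnit_conjDet_x.pow n).mul_left_eq_zero.1 e1
      -- the action of `h` on the coefficients can be compensated by a change of variables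
      let τ := action (N := N) (1 : H →* (K' →ₐ[K'] K'))
      have e6 : Function.Injective (τ h) := Function.LeftInverse.injective (g := τ h⁻¹) fun b => by
        rw [← AlgHom.mul_apply, ← map_mul, inv_mul_cancel, map_one, AlgHom.one_apply]
      rw [(isUnit_conjDet_x.pow n).mul_left_eq_zero]
      apply e6
      rw [map_zero, map_sum, ← e4]
      refine Finset.sum_congr rfl fun i hi => ?_
      have e5 := lift_action (N := N) (α.comp φ) (c : A →+* K') h (r i)
      rw [hr i hi] at e5
      exact (map_mul (τ h) _ _).trans (congrArg₂ (· * ·) ((τ h).commutes _) e5.symm)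
    have hp0 : ∀ i ∈ r.support, p i = 0 := by
      intro i hi
      ext m
      rw [MvPolynomial.coeff_zero]
      refine hα.eq_zero_of_sum_eq_zero c hl r.support (fun i => (p i).coeff m) (fun g => ?_) i hi
      have := congrArg (MvPolynomial.coeff m) (key g)
      rw [MvPolynomial.coeff_sum, MvPolynomial.coeff_zero] at this
      rw [← this]
      exact Finset.sum_congr rfl fun i _ => by
        rw [MvPolynomial.coeff_smul, MvPolynomial.coeff_map]; rfl
    refine Finset.sum_eq_zero fun i hi => ?_
    have h1 := hp i hi
    rw [hp0 i hi, map_zero, (isUnit_conjDet_x.pow n).mul_left_eq_zero] at h1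
    rw [Subtype.ext (a1 := r i) (a2 := 0) h1]
    exact TensorProduct.tmul_zero _ _
  · rw [← sum_mul_conjDet_pow (c : A →+* K') hξ l hp]
    rw [Finsupp.sum, map_sum] at h0
    simp only [hΘ] at h0
    rw [h0, zero_mul]

end NormalRing

end Invariants

/-! ### Descent of smoothness along étale coverings -/

section Smooth

open TensorProduct Polynomial

variable {k R T : Type u} [CommRing k] [CommRing R] [CommRing T] [Algebra k R] [Algebra k T]
  [Algebra R T] [IsScalarTower k R T]

/-- Lift of a standard étale pair along a surjection. -/
theorem exists_standardEtalePair {P : Type*} [CommRing P] {π : P →+* R}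
    (hπ : Function.Surjective π) (p : StandardEtalePair R) :
    ∃ q : StandardEtalePair P, q.f.map π = p.f ∧ q.g.map π = p.g * derivative p.f := by
  have hl : ∀ r : R[X], r ∈ lifts π := fun r => by
    rw [lifts_iff_coeff_lifts]
    exact fun i => hπ _
  obtain ⟨f, hf, -, hm⟩ := lifts_and_natDegree_eq_and_monic (hl p.f) p.monic_f
  obtain ⟨g, hg⟩ := Polynomial.map_surjective π hπ p.g
  exact ⟨⟨f, hm, g * derivative f, g, 0, 1, by ring⟩, hf, by
    rw [Polynomial.map_mul, hg, ← derivative_map, hf]⟩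

/-- A standard étale `R`-algebra `T` lifts to an étale algebra over a polynomial ring with
quotient `R`. Hence the formation of `H₁` of the cotangent complex commutes with the base change
from `R` to `T`. -/
theorem nonempty_tensorH1Cotangent_equiv [Algebra.IsStandardEtale R T] :
    Nonempty (T ⊗[R] Algebra.H1Cotangent k R ≃ₗ[T] Algebra.H1Cotangent k T) := by
  obtain ⟨p⟩ := Algebra.IsStandardEtale.nonempty_standardEtalePresentation (R := R) (S := T)
  let P : Algebra.Extension.{u} k R := (Algebra.Generators.self k R).toExtension
  have hπ : Function.Surjective (algebraMap P.Ring R) := P.algebraMap_surjective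
  obtain ⟨q, hqf, hqg⟩ := exists_standardEtalePair hπ p.P
  let : Algebra P.Ring T := ((algebraMap R T).comp (algebraMap P.Ring R)).toAlgebra
  have : IsScalarTower P.Ring R T := .of_algebraMap_eq' rfl
  have : IsScalarTower k P.Ring T := .of_algebraMap_eq fun r => by
    rw [IsScalarTower.algebraMap_apply k R T, IsScalarTower.algebraMap_apply k P.Ring R]; rfl
  have hx : q.HasMap p.x := by
    refine ⟨?_, ?_⟩
    · rw [← aeval_map_algebraMap R, hqf]
      exact p.hasMap.1
    · rw [← aeval_map_algebraMap R, hqg, map_mul]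
      exact p.hasMap.2.mul p.hasMap.isUnit_derivative_f
  let : Algebra k q.Ring := ((algebraMap P.Ring q.Ring).comp (algebraMap k P.Ring)).toAlgebra
  have : IsScalarTower k P.Ring q.Ring := .of_algebraMap_eq' rfl
  let F : q.Ring →ₐ[P.Ring] T := q.lift p.x hx
  -- the quotient of `q.Ring` by the ideal generated by the kernel of `P.Ring → R` is `T`
  let J : Ideal q.Ring := P.ker.map (algebraMap P.Ring q.Ring)
  let c : R →+* q.Ring ⧸ J := (algebraMap P.Ring R).liftOfSurjective hπ
    ⟨(Ideal.Quotient.mk J).comp (algebraMap P.Ring q.Ring), fun a ha =>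
      Ideal.Quotient.eq_zero_iff_mem.2 (Ideal.mem_map_of_mem _ ha)⟩
  have hc : ∀ a, c (algebraMap P.Ring R a) = Ideal.Quotient.mk J (algebraMap P.Ring q.Ring a) :=
    fun a => RingHom.liftOfSurjective_comp_apply _ hπ _ a
  let : Algebra R (q.Ring ⧸ J) := c.toAlgebra
  have : IsScalarTower P.Ring R (q.Ring ⧸ J) := .of_algebraMap_eq fun a => (hc a).symm
  have hy : p.HasMap (Ideal.Quotient.mk J q.X) := by
    have h1 := (q.hasMap_X).map (Ideal.Quotient.mkₐ P.Ring J)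
    obtain ⟨h2, h3⟩ := h1
    rw [← aeval_map_algebraMap R, hqf] at h2
    rw [← aeval_map_algebraMap R, hqg, map_mul] at h3
    exact ⟨h2, isUnit_of_mul_isUnit_left h3⟩
  let G : T →ₐ[R] q.Ring ⧸ J := (p.lift _ hy).comp (p.equivRing : T →ₐ[R] p.Ring)
  have hG : G p.x = Ideal.Quotient.mk J q.X := by
    change p.lift _ hy (p.equivRing p.x) = _
    rw [p.equivRing_x, StandardEtalePair.lift_X]
  have hGF : (G.restrictScalars P.Ring).comp F = Ideal.Quotient.mkₐ P.Ring J := by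
    apply StandardEtalePair.hom_ext
    change G (q.lift p.x hx q.X) = _
    rw [StandardEtalePair.lift_X, hG]; rfl
  have hker : ∀ z, F z = 0 → z ∈ J := fun z hz => by
    have h1 := DFunLike.congr_fun hGF z
    change G (F z) = Ideal.Quotient.mk J z at h1
    rw [hz, map_zero] at h1
    exact Ideal.Quotient.eq_zero_iff_mem.1 h1.symm
  have hF : Function.Surjective F := by
    let F' : q.Ring ⧸ J →ₐ[P.Ring] T := Ideal.Quotient.liftₐ J F fun z hz => by
      have h1 : J ≤ RingHom.ker F := Ideal.map_le_iff_le_comap.2 fun a ha => by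
        rw [Ideal.mem_comap, RingHom.mem_ker, F.commutes, IsScalarTower.algebraMap_apply P.Ring R T,
          show algebraMap P.Ring R a = 0 from ha, map_zero]
      exact h1 hz
    let F'' : q.Ring ⧸ J →ₐ[R] T := { F' with
      commutes' := fun r => by
        obtain ⟨a, rfl⟩ := hπ r
        rw [← IsScalarTower.algebraMap_apply, ← IsScalarTower.algebraMap_apply]
        exact F'.commutes a }
    have h2 : F''.comp G = AlgHom.id R T := by
      apply p.hom_ext
      change F'' (G p.x) = p.x
      rw [hG]
      exact q.lift_X _ hx
    intro t
    obtain ⟨z, hz⟩ := Ideal.Quotient.mk_surjective (G t)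
    refine ⟨z, ?_⟩
    have h3 : F'' (G t) = t := DFunLike.congr_fun h2 t
    rw [← hz] at h3
    exact h3
  let Q : Algebra.Extension.{u} k T := .ofSurjective (F.restrictScalars k) hF
  let : Algebra P.Ring Q.Ring := (inferInstance : Algebra P.Ring q.Ring)
  let f : P.Hom Q :=
    { toRingHom := algebraMap P.Ring q.Ring
      toRingHom_algebraMap := fun x => (IsScalarTower.algebraMap_apply k P.Ring q.Ring x).symm
      algebraMap_toRingHom := fun x => F.commutes x }
  have : Algebra.Etale P.Ring Q.Ring := (inferInstance : Algebra.Etale P.Ring q.Ring)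
  have : Algebra.FormallySmooth k P.Ring :=
    (inferInstance : Algebra.FormallySmooth k (MvPolynomial R k))
  have : IsScalarTower k P.Ring Q.Ring := (inferInstance : IsScalarTower k P.Ring q.Ring)
  have : Algebra.FormallySmooth k Q.Ring := .comp k P.Ring Q.Ring
  have : Module.Flat P.Ring Q.Ring := inferInstance
  have : Module.Flat R T := inferInstance
  refine ⟨Algebra.Extension.tensorH1CotangentOfFormallyEtale f rfl ?_ ?_ ≪≫ₗ
    Algebra.Extension.equivH1CotangentOfFormallySmooth Q⟩
  · exact RingHom.formallyEtale_algebraMap.mpr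
      (inferInstance : Algebra.FormallyEtale P.Ring q.Ring)
  -- `J = q.Ring ⊗ ker (P.Ring → R)`, since `q.Ring` is flat over `P.Ring`
  · have hinc : ∀ z : Q.Ring ⊗[P.Ring] P.ker,
        (((f.mapKer rfl).liftBaseChange Q.Ring z : Q.ker) : Q.Ring) =
        TensorProduct.rid P.Ring Q.Ring (LinearMap.lTensor Q.Ring P.ker.subtype z) := by
      intro z
      induction z with
      | zero => simp
      | add x y hx hy => rw [map_add, map_add, map_add, ← hx, ← hy]; rfl
      | tmul a b =>
        rw [LinearMap.liftBaseChange_tmul, LinearMap.lTensor_tmul, TensorProduct.rid_tmul,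
          Algebra.smul_def, mul_comm]
        rfl
    constructor
    · intro z w hzw
      apply Module.Flat.lTensor_preserves_injective_linearMap P.ker.subtype
        P.ker.subtype_injective (M := Q.Ring)
      apply (TensorProduct.rid P.Ring Q.Ring).injective
      rw [← hinc, ← hinc, hzw]
    · rintro ⟨z, hz⟩
      have h1 : ∀ z : q.Ring, z ∈ J → ∃ w : Q.Ring ⊗[P.Ring] P.ker,
          (((f.mapKer rfl).liftBaseChange Q.Ring w : Q.ker) : Q.Ring) = z := by
        intro z hz
        refine Submodule.span_induction (R := q.Ring) (M := q.Ring)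
          (p := fun z _ => ∃ w : Q.Ring ⊗[P.Ring] P.ker,
          (((f.mapKer rfl).liftBaseChange Q.Ring w : Q.ker) : Q.Ring) = z) ?_ ?_ ?_ ?_ hz
        · rintro _ ⟨a, ha, rfl⟩
          refine ⟨1 ⊗ₜ ⟨a, ha⟩, ?_⟩
          rw [LinearMap.liftBaseChange_tmul, one_smul]; rfl
        · exact ⟨0, by rw [map_zero]; rfl⟩
        · rintro _ _ _ _ ⟨x, rfl⟩ ⟨y, rfl⟩
          exact ⟨x + y, by rw [map_add]; rfl⟩
        · rintro a _ _ ⟨x, rfl⟩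
          let a' : Q.Ring := a
          exact ⟨a' • x, by rw [map_smul]; rfl⟩
      have h2 := h1 z (hker z hz)
      obtain ⟨w, hw⟩ := h2
      exact ⟨w, Subtype.ext hw⟩

/-- Smoothness descends along étale coverings. The module of differentials commutes with étale base
change, so that it is flat over `R`, hence projective. The vanishing of `H₁` of the cotangent
complex may be checked after base change to standard étale algebras which cover the spectrum of
`B`. -/
theorem smooth_of_etale [IsNoetherianRing k] [Algebra.FiniteType k R] (B : Type u) [CommRing B]
    [Algebra k B] [Algebra R B] [IsScalarTower k R B] [Algebra.Etale R B]
    [Module.FaithfullyFlat R B] [Algebra.Smooth k B] : Algebra.Smooth k R := by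
  have hfp : Algebra.FinitePresentation k R :=
    Algebra.FinitePresentation.of_finiteType.1 inferInstance
  refine ⟨⟨?_, ?_⟩, hfp⟩
  · let e := KaehlerDifferential.tensorKaehlerEquivOfFormallyEtale k R B
    have : Module.Flat B (B ⊗[R] Ω[R⁄k]) := .of_linearEquiv e
    have : Module.Flat R Ω[R⁄k] := Module.Flat.of_flat_tensorProduct _ _ B
    exact Module.Flat.projective_of_finitePresentation
  · refine ⟨fun m m' => ?_⟩
    suffices h : ∀ m : Algebra.H1Cotangent k R, m = 0 from (h m).trans (h m').symm
    clear m m'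
    intro m
    refine (Module.FaithfullyFlat.one_tmul_eq_zero_iff R _ (A := B) m).1 ?_
    set w : B ⊗[R] Algebra.H1Cotangent k R := 1 ⊗ₜ m
    -- the annihilator of `w` is contained in no maximal ideal
    let I : Ideal B := Ideal.torsionOf B (B ⊗[R] Algebra.H1Cotangent k R) w
    suffices hI : I = ⊤ by
      have h1 : (1 : B) ∈ I := hI ▸ Submodule.mem_top
      rwa [Ideal.mem_torsionOf_iff, one_smul] at h1
    by_contra hI
    obtain ⟨𝔮, h𝔮, hle⟩ := I.exists_le_maximal hI
    have := h𝔮.isPrime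
    have : Algebra.IsEtaleAt R 𝔮 := by
      have : Algebra.FormallyEtale B (Localization.AtPrime 𝔮) := .of_isLocalization 𝔮.primeCompl
      exact Algebra.FormallyEtale.comp R B _
    obtain ⟨f, hf, hst⟩ := Algebra.IsEtaleAt.exists_isStandardEtale (R := R) 𝔮
    have : Algebra.Smooth k (Localization.Away f) :=
      have : Algebra.Smooth B (Localization.Away f) := .of_isLocalization_Away f
      .comp k B _
    obtain ⟨e⟩ := nonempty_tensorH1Cotangent_equiv (k := k) (R := R) (T := Localization.Away f)
    have h2 : Subsingleton (Localization.Away f ⊗[R] Algebra.H1Cotangent k R) := e.subsingleton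
    have h3 : Subsingleton (Localization.Away f ⊗[B] (B ⊗[R] Algebra.H1Cotangent k R)) :=
      (TensorProduct.AlgebraTensorModule.cancelBaseChange R B (Localization.Away f)
        (Localization.Away f) (Algebra.H1Cotangent k R)).subsingleton
    have h4 := Subsingleton.elim (TensorProduct.mk B (Localization.Away f) _ 1 w) 0
    rw [IsLocalizedModule.eq_zero_iff (Submonoid.powers f)] at h4
    obtain ⟨⟨_, n, rfl⟩, hn⟩ := h4
    exact hf (Ideal.IsPrime.mem_of_pow_mem inferInstance n
      (hle ((Ideal.mem_torsionOf_iff _ _).2 hn)))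

end Smooth

/-! ### Étaleness of Galois algebras and smoothness of the ring of invariants -/

section Etale

open TensorProduct

variable {H : Type} [Group H] [Finite H]

section Ring

variable {R B : Type u} [CommRing R] [CommRing B] [Algebra R B] {ρ : H →* (B →ₐ[R] B)}

theorem IsGal.nontrivial [Nontrivial R] (hρ : IsGal ρ) : Nontrivial B := by
  obtain ⟨b, -⟩ := hρ
  exact ⟨b 1, 0, b.ne_zero 1⟩

theorem IsGal.faithfullyFlat [Nontrivial R] (hρ : IsGal ρ) : Module.FaithfullyFlat R B := by
  have := hρ.nontrivial
  have := hρ.free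
  infer_instance

theorem IsGal.etale [Nontrivial R] (hρ : IsGal ρ) : Algebra.Etale R B := by
  have := hρ.faithfullyFlat
  have : Algebra.Etale B (B ⊗[R] B) :=
    .of_equiv (AlgEquiv.ofBijective (tensorToPi ρ) hρ.bijective_tensorToPi).symm
  exact .of_etale_tensorProduct_of_faithfullyFlat B

end Ring

/-- A Galois algebra over a field has points in every separably closed extension. -/
theorem IsGal.exists_algHom {k A : Type u} [Field k] [CommRing A] [Algebra k A]
    {α : H →* (A →ₐ[k] A)} (hα : IsGal α) (Ω : Type u) [Field Ω] [Algebra k Ω] [IsSepClosed Ω] :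
    Nonempty (A →ₐ[k] Ω) := by
  have := hα.nontrivial
  have := hα.etale
  obtain ⟨m, hm⟩ := Ideal.exists_maximal A
  let := Ideal.Quotient.field m
  have : Algebra.FormallyUnramified k (A ⧸ m) :=
    .of_surjective (Ideal.Quotient.mkₐ k m) (Ideal.Quotient.mkₐ_surjective k m)
  have : Algebra.FiniteType k (A ⧸ m) :=
    .of_surjective (Ideal.Quotient.mkₐ k m) (Ideal.Quotient.mkₐ_surjective k m)
  have := Algebra.FormallyUnramified.finite_of_free k (A ⧸ m)
  have : Algebra.IsSeparable k (A ⧸ m) := Algebra.FormallyUnramified.isSeparable k (A ⧸ m)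
  exact ⟨(IsSepClosed.lift : (A ⧸ m) →ₐ[k] Ω).comp (Ideal.Quotient.mkₐ k m)⟩

namespace NormalRing

variable {k A : Type u} [Field k] [CommRing A] [Algebra k A] {N : ℕ}

instance smooth [Algebra.Smooth k A] : Algebra.Smooth k (NormalRing H A N) := by
  have h1 : Algebra.Smooth A (MvPolynomial (H ⊕ Fin N) A) := ⟨inferInstance, inferInstance⟩
  have h2 : Algebra.Smooth (MvPolynomial (H ⊕ Fin N) A) (NormalRing H A N) :=
    .of_isLocalization_Away (genDet H A N)
  have h3 : Algebra.Smooth A (NormalRing H A N) := .comp A (MvPolynomial (H ⊕ Fin N) A) _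
  exact .comp k A _

instance nontrivial [Nontrivial A] : Nontrivial (NormalRing H A N) := by
  obtain ⟨m, hm⟩ := Ideal.exists_maximal A
  let := Ideal.Quotient.field m
  classical
  exact (lift (H := H) (N := N) (Ideal.Quotient.mk m) (Pi.single 1 1) 0
    conjDet_single).domain_nontrivial

theorem smooth_invariants [Nontrivial A] [Algebra.Smooth k A] (α : H →* (A →ₐ[k] A)) :
    Algebra.Smooth k (invariants (action (N := N) α)) := by
  have hG := isGal (N := N) α
  have := finiteType_invariants (N := N) α
  have := hG.faithfullyFlat
  have := hG.etale
  exact smooth_of_etale (NormalRing H A N)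

end NormalRing

end Etale

/-! ### Normal elements over infinite fields -/

section Generic

open TensorProduct

variable {H : Type} [Group H] [Finite H]

/-- A nonzero polynomial, evaluated at the conjugates of an element of a Galois algebra and at
elements of the base field `K`, is nonzero for some choice of these elements if `K` is infinite: the
conjugates are, up to an invertible linear substitution, the coordinates of the element in a
basis. -/
theorem IsGal.exists_eval_ne_zero {K L Ω : Type*} [Field K] [Infinite K] [CommRing L] [Algebra K L]
    {μ : H →* (L →ₐ[K] L)} (hμ : IsGal μ) [Field Ω] [Algebra K Ω] (σ : L →ₐ[K] Ω) {N : ℕ}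
    {P : MvPolynomial (H ⊕ Fin N) Ω} (hP : P ≠ 0) : ∃ (z : L) (u : Fin N → K),
      MvPolynomial.eval (Sum.elim (fun h => σ (μ h z)) fun i => algebraMap K Ω (u i)) P ≠ 0 := by
  classical
  let := Fintype.ofFinite H
  obtain ⟨b, hb⟩ := hμ.exists_basis
  have hb' := hb.map σ
  rw [AlgHom.map_det] at hb'
  set M : Matrix H H Ω := σ.mapMatrix (Matrix.of fun h j => μ h (b j)) with hM
  -- the linear change of variables given by the matrix of conjugates, and its inverse
  let s (M : Matrix H H Ω) : MvPolynomial (H ⊕ Fin N) Ω →ₐ[Ω] MvPolynomial (H ⊕ Fin N) Ω :=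
    MvPolynomial.aeval (Sum.elim (fun h => ∑ j, M h j • MvPolynomial.X (Sum.inl j))
      fun i => MvPolynomial.X (Sum.inr i))
  have hs : (s M⁻¹).comp (s M) = AlgHom.id _ _ := by
    refine MvPolynomial.algHom_ext fun i => ?_
    rcases i with h | i
    · simp only [s, AlgHom.comp_apply, MvPolynomial.aeval_X, Sum.elim_inl, map_sum, map_smul,
        AlgHom.id_apply, Finset.smul_sum, smul_smul]
      rw [Finset.sum_comm]
      simp only [← Finset.sum_smul, ← Matrix.mul_apply]
      rw [Matrix.mul_nonsing_inv _ hb', Finset.sum_eq_single h (fun j _ hj => by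
        rw [Matrix.one_apply_ne hj.symm, zero_smul]) (by simp), Matrix.one_apply_eq, one_smul]
    · simp [s]
  have hP' : s M P ≠ 0 := fun h => hP (by
    have h1 := DFunLike.congr_fun hs P
    rw [AlgHom.comp_apply, h, map_zero] at h1
    exact h1.symm)
  obtain ⟨t, ht⟩ : ∃ t : H ⊕ Fin N → K,
      MvPolynomial.eval (fun i => algebraMap K Ω (t i)) (s M P) ≠ 0 := by
    by_contra! h
    refine hP' (MvPolynomial.funext_set (fun _ => Set.range (algebraMap K Ω))
      (fun _ => Set.infinite_range_of_injective (algebraMap K Ω).injective) fun x hx => ?_)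
    choose t ht using fun i => hx i (Set.mem_univ i)
    obtain rfl : (fun i => algebraMap K Ω (t i)) = x := funext ht
    rw [h t, map_zero]
  refine ⟨∑ j, t (Sum.inl j) • b j, fun i => t (Sum.inr i), ?_⟩
  have e : (MvPolynomial.aeval (Sum.elim (fun h => σ (μ h (∑ j, t (Sum.inl j) • b j)))
      fun i => algebraMap K Ω (t (Sum.inr i))) : MvPolynomial (H ⊕ Fin N) Ω →ₐ[Ω] Ω) =
      (MvPolynomial.aeval fun i => algebraMap K Ω (t i)).comp (s M) := by
    refine MvPolynomial.algHom_ext fun i => ?_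
    rcases i with h | i
    · simp [s, hM, Algebra.smul_def, mul_comm]
    · simp [s]
  have e' := DFunLike.congr_fun e P
  rw [MvPolynomial.aeval_eq_eval, AlgHom.comp_apply, MvPolynomial.aeval_eq_eval] at e'
  exact fun h => ht (e'.symm.trans h)

/-- An element of a Galois algebra `L` over a field is a unit if none of its conjugates vanishes at
a given point of `L`. -/
theorem IsGal.isUnit_of_ne_zero {K L Ω : Type*} [Field K] [CommRing L] [Algebra K L]
    {μ : H →* (L →ₐ[K] L)} (hμ : IsGal μ) [Field Ω] (σ : L →+* Ω) {z : L}
    (hz : ∀ h, σ (μ h z) ≠ 0) : IsUnit z := by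
  classical
  let := Fintype.ofFinite H
  have h1 := hμ.algebraMap_norm z
  have h2 : Algebra.norm K z ≠ 0 := fun h => by
    rw [h, map_zero] at h1
    have h3 := congrArg σ h1
    rw [map_zero, map_prod] at h3
    exact Finset.prod_ne_zero_iff.2 (fun h _ => hz h) h3.symm
  have h3 : IsUnit (∏ h, μ h z) := h1 ▸ (h2.isUnit.map (algebraMap K L))
  have h4 : z ∣ ∏ h, μ h z := by
    have := Finset.dvd_prod_of_mem (fun h => μ h z) (Finset.mem_univ (1 : H))
    rwa [map_one, AlgHom.one_apply] at this
  exact isUnit_of_dvd_unit h4 h3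

/-- Galois algebras over infinite fields have normal bases, which may be chosen outside of the zero
locus of a given polynomial. -/
theorem IsGal.exists_isUnit_conjDet {K L Ω : Type*} [Field K] [Infinite K] [CommRing L]
    [Algebra K L] {μ : H →* (L →ₐ[K] L)} (hμ : IsGal μ) [Field Ω] [Algebra K Ω] (σ : L →ₐ[K] Ω)
    {N : ℕ} {P : MvPolynomial (H ⊕ Fin N) Ω} (hP : P ≠ 0) : ∃ (z : L) (u : Fin N → K),
      IsUnit (conjDet fun h => μ h z) ∧
      MvPolynomial.eval (Sum.elim (fun h => σ (μ h z)) fun i => algebraMap K Ω (u i)) P ≠ 0 := by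
  obtain ⟨z, u, hzu⟩ := hμ.exists_eval_ne_zero σ (mul_ne_zero hP (NormalRing.genDet_ne_zero Ω))
  rw [map_mul] at hzu
  refine ⟨z, u, ?_, left_ne_zero_of_mul hzu⟩
  have h1 := right_ne_zero_of_mul hzu
  rw [genDet, map_conjDet] at h1
  simp only [MvPolynomial.eval_X, Sum.elim_inl] at h1
  refine hμ.isUnit_of_ne_zero (σ : L →+* Ω) fun h => ?_
  have h2 := isUnit_conjDet_translate h1.isUnit h
  have h3 : (σ : L →+* Ω) (μ h (conjDet fun h => μ h z)) = conjDet fun h' => σ (μ (h * h') z) := by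
    change ((σ : L →+* Ω).comp (μ h : L →+* L)) _ = _
    rw [map_conjDet]
    congr 1
    ext h'
    change σ (μ h (μ h' z)) = _
    rw [map_mul]; rfl
  rw [h3]
  exact h2.ne_zero

namespace NormalRing

variable {k A : Type u} [Field k] [CommRing A] [Algebra k A] {N : ℕ} {G : Type} [Group G]
  [Finite G] {α : G →* (A →ₐ[k] A)} {φ : H →* G}

theorem map_lift {C D : Type*} [CommRing C] [CommRing D] (f : C →+* D) (c : A →+* C) (ξ : H → C)
    (η : Fin N → C) (hξ : IsUnit (conjDet ξ)) (hξ' : IsUnit (conjDet fun h => f (ξ h)))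
    (b : NormalRing H A N) :
    f (lift c ξ η hξ b) = lift (f.comp c) (fun h => f (ξ h)) (fun i => f (η i)) hξ' b := by
  have e : f.comp (lift c ξ η hξ) =
      lift (f.comp c) (fun h => f (ξ h)) (fun i => f (η i)) hξ' :=
    hom_ext (fun a => by simp) (fun h => by simp) (fun i => by simp)
  exact DFunLike.congr_fun e b

/-- The base change of the ring of invariants to any extension of the base field is a domain, since
the restriction of functions to the fibre over a geometric point of the spectrum of `A` is
injective. -/
theorem isDomain_tensorProduct (hα : IsGal α) (hφ : Function.Surjective φ) (K : Type u) [Field K]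
    [Algebra k K] : IsDomain (K ⊗[k] invariants (action (N := N) (α.comp φ))) := by
  let K' := AlgebraicClosure K
  obtain ⟨c⟩ := hα.exists_algHom K'
  let Θ : K ⊗[k] invariants (action (N := N) (α.comp φ)) →ₐ[K] NormalRing H K' N :=
    Algebra.TensorProduct.lift (Algebra.ofId K _)
      ((liftAlg ((IsScalarTower.toAlgHom k K' (NormalRing H K' N)).comp c) x y
        isUnit_conjDet_x).comp (Subalgebra.val _)) fun _ _ => mul_comm _ _
  have hΘ : Function.Injective Θ := by
    rw [injective_iff_map_eq_zero]
    intro z hz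
    by_contra hne
    obtain ⟨P, hP, h⟩ := exists_polynomial hα hφ c z hne
    refine hP (algebraMap_injective (H := H) (N := N) K' ?_)
    rw [map_zero, ← aeval_x_y]
    refine h _ x y isUnit_conjDet_x (Θ : _ →+* NormalRing H K' N) (fun t r => ?_) hz
    rfl
  exact hΘ.isDomain (Θ : _ →+* NormalRing H K' N)

section Point

variable {l L : Type u} [Field l] [Algebra k l] [CommRing L] [Algebra l L] [Algebra k L]
  [IsScalarTower k l L] {μ : H →* (L →ₐ[l] L)} (hμ : IsGal μ) (c : A →ₐ[k] L)
  (hc : ∀ h a, c (α (φ h) a) = μ h (c a))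

include hμ hc in
/-- A point of the ring of invariants, from an equivariant homomorphism to a Galois algebra and a
normal element. -/
theorem exists_point (z : L) (u : Fin N → l) (hz : IsUnit (conjDet fun h => μ h z)) :
    (∀ h b, liftAlg c (fun h => μ h z) (fun i => algebraMap l L (u i)) hz
      (action (α.comp φ) h b) =
      μ h (liftAlg c (fun h => μ h z) (fun i => algebraMap l L (u i)) hz b)) ∧
    ∃ p : invariants (action (N := N) (α.comp φ)) →ₐ[k] l, ∀ r, algebraMap l L (p r) =
      liftAlg c (fun h => μ h z) (fun i => algebraMap l L (u i)) hz r := by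
  have := hμ.nontrivial
  have h1 : ∀ h b, liftAlg c (fun h => μ h z) (fun i => algebraMap l L (u i)) hz
      (action (α.comp φ) h b) =
      μ h (liftAlg c (fun h => μ h z) (fun i => algebraMap l L (u i)) hz b) := by
    intro h b
    have e : (liftAlg c (fun h => μ h z) (fun i => algebraMap l L (u i)) hz).comp
        (action (N := N) (α.comp φ) h) = ((μ h).restrictScalars k).comp
          (liftAlg c (fun h => μ h z) (fun i => algebraMap l L (u i)) hz) :=
      algHom_ext (fun a => by simpa using hc h a) (fun h' => by simp) (fun i => by simp)
    exact DFunLike.congr_fun e b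
  refine ⟨h1, ?_⟩
  choose p hp using fun r : invariants (action (N := N) (α.comp φ)) =>
    hμ.exists_algebraMap_eq (liftAlg c (fun h => μ h z) (fun i => algebraMap l L (u i)) hz r)
      fun h => by rw [← h1, r.2 h]
  have hi := (algebraMap l L).injective
  exact ⟨{
    toFun := p
    map_one' := hi (by rw [hp, map_one]; exact map_one _)
    map_mul' := fun r s => hi (by rw [hp, map_mul, hp, hp]; exact map_mul _ _ _)
    map_zero' := hi (by rw [hp, map_zero]; exact map_zero _)
    map_add' := fun r s => hi (by rw [hp, map_add, hp, hp]; exact map_add _ _ _)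
    commutes' := fun r => hi (by
      rw [hp, ← IsScalarTower.algebraMap_apply]; exact AlgHom.commutes _ r) }, hp⟩

include hμ hc in
/-- The points of the preceding lemma are dense: some point does not lie in the zero locus of a
given nonzero function on the base change to `l`. -/
theorem exists_point_ne_zero [Infinite l] (hα : IsGal α) (hφ : Function.Surjective φ)
    (f : l ⊗[k] invariants (action (N := N) (α.comp φ))) (hf : f ≠ 0) :
    ∃ (z : L) (u : Fin N → l) (hz : IsUnit (conjDet fun h => μ h z))
      (p : invariants (action (N := N) (α.comp φ)) →ₐ[k] l),
      (∀ r, algebraMap l L (p r) =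
        liftAlg c (fun h => μ h z) (fun i => algebraMap l L (u i)) hz r) ∧
      Algebra.TensorProduct.lift (AlgHom.id l l) p (fun _ _ => mul_comm _ _) f ≠ 0 := by
  obtain ⟨σ⟩ := hμ.exists_algHom (AlgebraicClosure l)
  obtain ⟨P, hP, h⟩ := exists_polynomial hα hφ ((σ.restrictScalars k).comp c) f hf
  obtain ⟨z, u, hz, hzu⟩ := hμ.exists_isUnit_conjDet σ hP
  obtain ⟨-, p, hp⟩ := exists_point hμ c hc z u hz
  refine ⟨z, u, hz, p, hp, fun h0 => hzu ?_⟩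
  have hz' : IsUnit (conjDet fun h => (σ : L →+* AlgebraicClosure l) (μ h z)) := by
    rw [← map_conjDet]; exact hz.map _
  have h1 := h (AlgebraicClosure l) (fun h => σ (μ h z)) (fun i => algebraMap _ _ (u i)) hz'
    ((algebraMap l (AlgebraicClosure l)).comp (Algebra.TensorProduct.lift (AlgHom.id l l) p
      fun _ _ => mul_comm _ _ : _ →ₐ[l] l).toRingHom) (fun t r => ?_) ?_
  · rw [← h1, MvPolynomial.aeval_eq_eval]
  · have h2 := congrArg σ (hp r)
    rw [σ.commutes, liftAlg_coe] at h2
    have h3 := map_lift (σ : L →+* AlgebraicClosure l) (c : A →+* L) (fun h => μ h z)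
      (fun i => algebraMap l L (u i)) hz hz' (r : NormalRing H A N)
    change algebraMap l _ (t * p r) = _
    rw [map_mul, h2]
    congr 1
    have h5 : (fun i => (σ : L →+* AlgebraicClosure l) (algebraMap l L (u i))) =
        fun i => algebraMap l _ (u i) := funext fun i => σ.commutes _
    rw [h5] at h3
    exact h3
  · change algebraMap l _ (Algebra.TensorProduct.lift (AlgHom.id l l) p _ f) = 0
    rw [h0, map_zero]

include hμ hc in
theorem nonempty_point [Infinite l] (N : ℕ) :
    Nonempty (invariants (action (N := N) (α.comp φ)) →ₐ[k] l) := by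
  obtain ⟨σ⟩ := hμ.exists_algHom (AlgebraicClosure l)
  obtain ⟨z, u, hz, -⟩ := hμ.exists_isUnit_conjDet (N := N) σ (P := 1) one_ne_zero
  exact ⟨(exists_point hμ c hc z u hz).2.choose⟩

end Point

end NormalRing

end Generic

/-! ### Torsors over fields and homomorphisms from Galois groups -/

section TorsorAlgebra

open TensorProduct

variable {k : Type u} [Field k] {G : Type} [Group G] [Finite G] (p : Gal k →* G)

namespace torsorAlgebra

/-- The action of `G` on the algebra of equivariant functions: `a ∈ G` maps `h` to
`g ↦ h (g a)`. -/
def action : G →* (torsorAlgebra p →ₐ[k] torsorAlgebra p) where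
  toFun a := { trans p a⁻¹ with commutes' := fun _ => rfl }
  map_one' := AlgHom.ext fun h => Subtype.ext (funext fun g => congrArg h.1 (by simp))
  map_mul' a b := AlgHom.ext fun h => Subtype.ext (funext fun g => congrArg h.1 (by
    simp [mul_assoc]))

theorem coe_action (a : G) (h : torsorAlgebra p) (g : G) :
    (action p a h : G → SeparableClosure k) g = (h : G → SeparableClosure k) (g * a) :=
  congrArg h.1 (by simp)

theorem coe_action_inv (a : G) : (action p a⁻¹ : torsorAlgebra p →+* torsorAlgebra p) =
    trans p a :=
  RingHom.ext fun h => Subtype.ext (funext fun g => congrArg h.1 (by simp))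

variable {p}

/-- Galois correspondence for the open subgroup `ker p`. -/
theorem apply_eq_one (hp : IsOpen (p.ker : Set (Gal k))) {σ : Gal k}
    (hσ : ∀ m : SeparableClosure k, (∀ τ, p τ = 1 → τ m = m) → σ m = m) : p σ = 1 := by
  let K : ClosedSubgroup (Gal k) := ⟨p.ker, p.ker.isClosed_of_isOpen hp⟩
  have h1 := InfiniteGalois.fixingSubgroup_fixedField (k := k) (K := SeparableClosure k) K
  have h2 : σ ∈ (IntermediateField.fixedField K.1).fixingSubgroup := by
    rw [IntermediateField.mem_fixingSubgroup_iff]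
    intro m hm
    exact hσ m fun τ hτ => hm ⟨τ, hτ⟩
  rw [h1] at h2
  exact h2

/-- The equivariant function supported by the coset `p(Γ) g₀` with value `m` at `g₀`, for `m` in
the fixed field of the kernel of `p`. -/
theorem exists_function (m : SeparableClosure k) (hm : ∀ τ, p τ = 1 → τ m = m) (g₀ : G) :
    ∃ h : torsorAlgebra p, (∀ τ, (h : G → SeparableClosure k) (p τ * g₀) = τ m) ∧
      ∀ g, (∀ τ, g ≠ p τ * g₀) → (h : G → SeparableClosure k) g = 0 := by
  classical
  have hm' : ∀ τ τ', p τ = p τ' → τ m = τ' m := fun τ τ' h => by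
    have h1 := hm (τ⁻¹ * τ') (by rw [map_mul, map_inv, h, inv_mul_cancel])
    exact (congrArg τ h1.symm).trans (by
      rw [← AlgEquiv.mul_apply, mul_inv_cancel_left])
  let f : G → SeparableClosure k := fun g => if h : ∃ τ, g = p τ * g₀ then h.choose m else 0
  have hf : ∀ τ, f (p τ * g₀) = τ m := fun τ => by
    have h : ∃ τ', p τ * g₀ = p τ' * g₀ := ⟨τ, rfl⟩
    change dite _ _ _ = _
    rw [dif_pos h]
    exact hm' _ _ (mul_right_cancel h.choose_spec).symm
  have hf0 : ∀ g, (∀ τ, g ≠ p τ * g₀) → f g = 0 := fun g hg =>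
    dif_neg fun ⟨τ, h⟩ => hg τ h
  refine ⟨⟨f, fun σ g => ?_⟩, hf, hf0⟩
  by_cases h : ∃ τ, g = p τ * g₀
  · obtain ⟨τ, rfl⟩ := h
    rw [← mul_assoc, ← map_mul, hf, hf, AlgEquiv.mul_apply]
  · rw [hf0 g fun τ hτ => h ⟨τ, hτ⟩, map_zero]
    refine hf0 _ fun τ hτ => h ⟨σ⁻¹ * τ, ?_⟩
    rw [map_mul, mul_assoc, ← hτ, map_inv, inv_mul_cancel_left]

/-- The equivariant functions generate the vector space of all functions. A linear form which
vanishes on them gives, for each coset `p(Γ) g₀`, a linear relation between the embeddings of the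
fixed field of `ker p` in the separable closure. -/
theorem span_eq_top (hp : IsOpen (p.ker : Set (Gal k))) :
    Submodule.span (SeparableClosure k) (torsorAlgebra p : Set (G → SeparableClosure k)) = ⊤ := by
  classical
  let := Fintype.ofFinite G
  by_contra hne
  obtain ⟨f, hf, hker⟩ := Submodule.exists_le_ker_of_lt_top _ (lt_top_iff_ne_top.2 hne)
  let c : G → SeparableClosure k := fun g => f (Pi.single g 1)
  have hfc : ∀ h : G → SeparableClosure k, f h = ∑ g, h g * c g := fun h => by
    conv_lhs => rw [pi_eq_sum_univ' h, map_sum]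
    refine Finset.sum_congr rfl fun g _ => ?_
    rw [map_smul, smul_eq_mul]
  refine hf (LinearMap.ext fun h => ?_)
  rw [hfc]
  refine Finset.sum_eq_zero fun g₀ _ => ?_
  suffices c g₀ = 0 by rw [this, mul_zero]
  -- linear independence of the characters given by the elements of the image of `p`
  let M : Subfield (SeparableClosure k) :=
    (IntermediateField.fixedField p.ker : IntermediateField k (SeparableClosure k)).toSubfield
  have hM : ∀ m : M, ∀ τ, p τ = 1 → τ (m : SeparableClosure k) = m := fun m τ hτ => m.2 ⟨τ, hτ⟩
  let s : p.range → Gal k := fun q => q.2.choose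
  have hs : ∀ q, p (s q) = q := fun q => q.2.choose_spec
  let χ : p.range → (M →* SeparableClosure k) := fun q =>
    ((s q : SeparableClosure k →ₐ[k] SeparableClosure k) : SeparableClosure k →* _).comp
      (M.subtype : M →* SeparableClosure k)
  have hχ : Function.Injective χ := by
    intro q q' h
    have h1 : p ((s q')⁻¹ * s q) = 1 := apply_eq_one hp fun m hm => by
      have h2 : s q m = s q' m :=
        DFunLike.congr_fun h (⟨m, fun τ => hm τ.1 τ.2⟩ : M)
      rw [AlgEquiv.mul_apply, h2, ← AlgEquiv.mul_apply, inv_mul_cancel, AlgEquiv.one_apply]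
    rw [map_mul, map_inv, inv_mul_eq_one, hs, hs] at h1
    exact Subtype.ext h1.symm
  have hli := (linearIndependent_monoidHom M (SeparableClosure k)).comp χ hχ
  rw [Fintype.linearIndependent_iff] at hli
  have h1 := hli (fun q => c (q * g₀)) (funext fun m => ?_) 1
  · rwa [Subgroup.coe_one, one_mul] at h1
  · obtain ⟨h, h2, h3⟩ := exists_function (p := p) (m : SeparableClosure k) (hM m) g₀
    have h4 : f h = 0 := hker (Submodule.subset_span h.2)
    rw [hfc, ← Equiv.sum_comp (Equiv.mulRight g₀)] at h4
    rw [Finset.sum_apply, Pi.zero_apply, ← h4]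
    rw [← Finset.sum_subset (Finset.subset_univ (Finset.univ.filter (· ∈ p.range)))
      (fun g _ hg => ?_), Finset.sum_subtype (p := (· ∈ p.range)) _ (by simp)]
    · refine Finset.sum_congr rfl fun q _ => ?_
      have h5 := h2 (s q)
      rw [hs] at h5
      change c (q * g₀) * s q m = (h : G → SeparableClosure k) (q * g₀) * c (q * g₀)
      rw [h5, mul_comm]
    · change (h : G → SeparableClosure k) (g * g₀) * c (g * g₀) = 0
      rw [h3, zero_mul]
      intro τ hτ
      exact hg (by simpa using ⟨τ, (mul_right_cancel hτ).symm⟩)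

/-- The algebra of equivariant functions is a Galois algebra: it contains a basis of the space of
all functions, whose matrix of conjugates is invertible at every point of `G`. -/
theorem isGal (hp : IsOpen (p.ker : Set (Gal k))) : IsGal (action p) := by
  classical
  let := Fintype.ofFinite G
  let b₀ := Module.Basis.ofSpan (span_eq_top hp).ge
  let b := b₀.reindex (b₀.indexEquiv (Pi.basisFun (SeparableClosure k) G))
  have hb : ∀ j, b j ∈ torsorAlgebra p := fun j =>
    Module.Basis.ofSpan_subset (span_eq_top hp).ge (by
      rw [Module.Basis.reindex_apply]; exact ⟨_, rfl⟩)
  have hdet : IsUnit ((Matrix.of fun h j => b j h : Matrix G G (SeparableClosure k)).det) := by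
    have h1 := (Pi.basisFun (SeparableClosure k) G).isUnit_det b
    rw [Module.Basis.det_apply] at h1
    have e : (Matrix.of fun h j => b j h) = (Pi.basisFun (SeparableClosure k) G).toMatrix b :=
      Matrix.ext fun h j => rfl
    rw [e]
    exact h1
  refine isGal_of_invariants (fun x hx => ?_) (algebraMap k (torsorAlgebra p)).injective
    (fun j => ⟨b j, hb j⟩) ?_
  · have h1 : ∀ g, (x : G → SeparableClosure k) g = (x : G → SeparableClosure k) 1 := fun g => by
      have h2 := congrArg (fun y : torsorAlgebra p => (y : G → SeparableClosure k) 1) (hx g)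
      exact ((congrArg x.1 (one_mul g)).symm.trans (coe_action p g x 1).symm).trans h2
    obtain ⟨c, hc⟩ := (InfiniteGalois.mem_range_algebraMap_iff_fixed (k := k)
      ((x : G → SeparableClosure k) 1)).2 fun σ => by
        have h2 := x.2 σ 1
        rw [mul_one] at h2
        exact h2.symm.trans (h1 _)
    refine ⟨c, Subtype.ext (funext fun g => ?_)⟩
    rw [h1 g, ← hc]; rfl
  · set D := (Matrix.of fun h j => action p h ⟨b j, hb j⟩).det
    have hD : ∀ g, IsUnit ((D : G → SeparableClosure k) g) := fun g => by
      let ev : torsorAlgebra p →+* SeparableClosure k :=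
        (Pi.evalRingHom (fun _ => SeparableClosure k) g).comp
          (torsorAlgebra p).val.toRingHom
      have h1 : ev D = ((Matrix.of fun h j => b j h : Matrix G G (SeparableClosure k)).submatrix
          (Equiv.mulLeft g) id).det := by
        rw [RingHom.map_det]
        congr 1
        exact Matrix.ext fun h j => coe_action p h ⟨b j, hb j⟩ g
      change IsUnit (ev D)
      rw [h1, Matrix.det_permute]
      refine (IsUnit.map (Int.castRingHom _) (Units.isUnit _)).mul hdet
    refine IsUnit.of_mul_eq_one ⟨fun g => ((D : G → SeparableClosure k) g)⁻¹, fun σ g => ?_⟩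
      (Subtype.ext (funext fun g => mul_inv_cancel₀ (hD g).ne_zero))
    exact (congrArg _ (D.2 σ g)).trans (map_inv₀ σ _).symm

section Field

variable {l : Type u} [Field l] [Algebra k l] (ι : SeparableClosure k →ₐ[k] SeparableClosure l)

/-- The point of the spectrum of `torsorAlgebra p` given by `1 ∈ G` and an embedding of
separable closures. -/
def evalOne (p : Gal k →* G) : torsorAlgebra p →ₐ[k] SeparableClosure l :=
  ι.comp ((Pi.evalAlgHom k (fun _ : G => SeparableClosure k) 1).comp (torsorAlgebra p).val)

theorem evalOne_apply (p : Gal k →* G) (a : torsorAlgebra p) :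
    evalOne ι p a = ι ((a : G → SeparableClosure k) 1) := rfl

theorem apply_evalOne (p : Gal k →* G) (γ : Gal l) (a : torsorAlgebra p) :
    γ (evalOne ι p a) = evalOne ι p (action p (p (galRes ι γ)) a) := by
  rw [evalOne_apply, evalOne_apply, coe_action, one_mul]
  refine (galResHom_apply ι γ _).symm.trans (congrArg ι ?_)
  have := a.2 (galResHom ι γ) 1
  rw [mul_one] at this
  exact this.symm

variable {H : Type} [Group H] [Finite H]

/-- If `φ ∘ q` is the restriction of `p`, the functions `torsorAlgebra p` define functions on the
torsor given by `q`. -/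
def mapHom {p : Gal k →* G} {φ : H →* G} {q : Gal l →* H}
    (hq : ∀ γ, φ (q γ) = p (galRes ι γ)) : torsorAlgebra p →ₐ[k] torsorAlgebra q where
  toFun a := ⟨fun h => ι ((a : G → SeparableClosure k) (φ h)), fun σ h => by
    change ι ((a : G → SeparableClosure k) (φ (q σ * h))) =
      σ (ι ((a : G → SeparableClosure k) (φ h)))
    rw [map_mul, hq]
    exact (congrArg ι (a.2 _ _)).trans (galResHom_apply ι σ _)⟩
  map_one' := Subtype.ext (funext fun _ => map_one ι)
  map_mul' a b := Subtype.ext (funext fun _ => map_mul ι _ _)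
  map_zero' := Subtype.ext (funext fun _ => map_zero ι)
  map_add' a b := Subtype.ext (funext fun _ => map_add ι _ _)
  commutes' r := Subtype.ext (funext fun _ => (ι.commutes r).trans
    (IsScalarTower.algebraMap_apply k l (SeparableClosure l) r))

theorem mapHom_action {p : Gal k →* G} {φ : H →* G} {q : Gal l →* H}
    (hq : ∀ γ, φ (q γ) = p (galRes ι γ)) (h : H) (a : torsorAlgebra p) :
    mapHom ι hq (action p (φ h) a) = action q h (mapHom ι hq a) := by
  refine Subtype.ext (funext fun h' => ?_)
  rw [coe_action]
  change ι _ = ι _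
  rw [coe_action, map_mul]

end Field

end torsorAlgebra

/-- A point of a Galois algebra over a field with values in the separable closure defines a
homomorphism from the Galois group. -/
theorem IsGal.exists_hom {l L : Type u} [Field l] [CommRing L] [Algebra l L] {H : Type} [Group H]
    [Finite H] {μ : H →* (L →ₐ[l] L)} (hμ : IsGal μ) (s : L →ₐ[l] SeparableClosure l) :
    ∃ q : Gal l →* H, IsOpen (q.ker : Set (Gal l)) ∧ ∀ γ x, γ (s x) = s (μ (q γ) x) := by
  classical
  let := Fintype.ofFinite H
  choose q hq using fun γ : Gal l => hμ.exists_comp_eq s ((γ : _ →ₐ[l] SeparableClosure l).comp s)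
  have hq' : ∀ γ x, γ (s x) = s (μ (q γ) x) := fun γ x => DFunLike.congr_fun (hq γ) x
  have hinj : ∀ h h', (∀ x, s (μ h x) = s (μ h' x)) → h = h' := fun h h' hh =>
    hμ.comp_injective (s : L →+* SeparableClosure l) hh
  refine ⟨{ toFun := q, map_one' := ?_, map_mul' := ?_ }, ?_, hq'⟩
  · refine hinj _ _ fun x => ?_
    rw [← hq', map_one]; rfl
  · intro γ γ'
    refine hinj _ _ fun x => ?_
    rw [← hq', map_mul, AlgHom.mul_apply, ← hq' γ, ← hq' γ', AlgEquiv.mul_apply]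
  · obtain ⟨b, -⟩ := hμ.exists_basis
    have hopen : IsOpen (⋂ j, {γ : Gal l | γ (s (b j)) = s (b j)}) :=
      isOpen_iInter_of_finite fun j => stabilizer_isOpen_of_isIntegral (K := l) (s (b j))
    refine Subgroup.isOpen_of_mem_nhds _ (g := 1) (Filter.mem_of_superset
      (hopen.mem_nhds (Set.mem_iInter.2 fun j => rfl)) fun γ hγ => ?_)
    refine hinj _ _ fun x => ?_
    change s (μ (q γ) x) = s (μ 1 x)
    rw [← hq', map_one, AlgHom.one_apply]
    have h1 : (γ : _ →ₐ[l] SeparableClosure l).toLinearMap.comp s.toLinearMap = s.toLinearMap :=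
      b.ext fun j => Set.mem_iInter.1 hγ j
    exact LinearMap.congr_fun h1 x

/-- An equivariant homomorphism from `torsorAlgebra p` to a Galois algebra over an extension `l`
lifts the restriction of `p` to the Galois group of `l`. -/
theorem exists_lift_of_equivariant {l L : Type u} [Field l] [Algebra k l]
    [CommRing L] [Algebra l L] [Algebra k L] [IsScalarTower k l L] {H : Type} [Group H]
    [Finite H] {μ : H →* (L →ₐ[l] L)} (hμ : IsGal μ) {p : Gal k →* G}
    (hp : IsOpen (p.ker : Set (Gal k))) {φ : H →* G} (hφ : Function.Surjective φ)
    (c : torsorAlgebra p →ₐ[k] L) (hc : ∀ h a, c (torsorAlgebra.action p (φ h) a) = μ h (c a))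
    (ι : SeparableClosure k →ₐ[k] SeparableClosure l) :
    ∃ q : Gal l →* H, IsOpen (q.ker : Set (Gal l)) ∧ ∀ γ, φ (q γ) = p (galRes ι γ) := by
  have hα := torsorAlgebra.isGal hp
  obtain ⟨s₀⟩ := hμ.exists_algHom (SeparableClosure l)
  obtain ⟨g, hg⟩ := hα.exists_comp_eq ((s₀.restrictScalars k).comp c)
    (torsorAlgebra.evalOne ι p)
  obtain ⟨h, rfl⟩ := hφ g
  -- after a translation, the point `s` of `L` lies over the point `1` of `torsorAlgebra p`
  let s := s₀.comp (μ h)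
  have hs : ∀ a, s (c a) = torsorAlgebra.evalOne ι p a := fun a => by
    rw [hg]
    change s₀ (μ h (c a)) = s₀ (c (torsorAlgebra.action p (φ h) a))
    rw [hc]
  obtain ⟨q, hq, hqs⟩ := hμ.exists_hom s
  refine ⟨q, hq, fun γ => ?_⟩
  refine hα.comp_injective (torsorAlgebra.evalOne ι p : torsorAlgebra p →+* SeparableClosure l)
    fun a => ?_
  change torsorAlgebra.evalOne ι p _ = torsorAlgebra.evalOne ι p _
  rw [← torsorAlgebra.apply_evalOne, ← hs, ← hs, hc, hqs]

/-- The fibre of a Galois algebra at a point of its base gives a lift. -/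
theorem exists_lift_of_point {l R B : Type u} [Field l] [Algebra k l] [CommRing R] [CommRing B]
    [Algebra k R] [Algebra R B] [Algebra k B] [IsScalarTower k R B] {H : Type} [Group H]
    [Finite H] {ρ : H →* (B →ₐ[R] B)} (hρ : IsGal ρ) {p : Gal k →* G}
    (hp : IsOpen (p.ker : Set (Gal k))) {φ : H →* G} (hφ : Function.Surjective φ)
    (c : torsorAlgebra p →ₐ[k] B) (hc : ∀ h a, c (torsorAlgebra.action p (φ h) a) = ρ h (c a))
    (x : R →ₐ[k] l) (ι : SeparableClosure k →ₐ[k] SeparableClosure l) :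
    ∃ q : Gal l →* H, IsOpen (q.ker : Set (Gal l)) ∧ ∀ γ, φ (q γ) = p (galRes ι γ) := by
  let : Algebra R l := (x : R →+* l).toAlgebra
  have : IsScalarTower k R l := .of_algebraMap_eq fun r => (x.commutes r).symm
  refine exists_lift_of_equivariant (hρ.baseChange l) hp hφ
    (((Algebra.TensorProduct.includeRight : B →ₐ[R] l ⊗[R] B).restrictScalars k).comp c)
    (fun h a => ?_) ι
  exact congrArg (fun b => (1 : l) ⊗ₜ[R] b) (hc h a)

/-- Points of the ring of invariants correspond to lifts of `p`. -/
theorem NormalRing.nonempty_point_iff {l : Type u} [Field l] [Algebra k l] [Infinite l] {H : Type}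
    [Group H] [Finite H] {p : Gal k →* G} (hp : IsOpen (p.ker : Set (Gal k))) {φ : H →* G}
    (hφ : Function.Surjective φ) (N : ℕ) (ι : SeparableClosure k →ₐ[k] SeparableClosure l) :
    Nonempty (invariants (action (N := N) ((torsorAlgebra.action p).comp φ)) →ₐ[k] l) ↔
      ∃ q : Gal l →* H, IsOpen (q.ker : Set (Gal l)) ∧ ∀ γ, φ (q γ) = p (galRes ι γ) := by
  have hα := torsorAlgebra.isGal hp
  constructor
  · rintro ⟨x⟩
    exact exists_lift_of_point (isGal (N := N) ((torsorAlgebra.action p).comp φ)) hp hφ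
      (IsScalarTower.toAlgHom k (torsorAlgebra p) (NormalRing H (torsorAlgebra p) N))
      (fun h a => (action_algebraMap ((torsorAlgebra.action p).comp φ) h a).symm) x ι
  · rintro ⟨q, hq, hqp⟩
    exact nonempty_point (torsorAlgebra.isGal hq) (torsorAlgebra.mapHom ι hqp)
      (torsorAlgebra.mapHom_action ι hqp) N

end TorsorAlgebra

/-! ### Torsors and Galois algebras -/

section GalScheme

open TensorProduct

variable {H : Type} [Group H]

section Spec

variable {R B : Type u} [CommRing R] [CommRing B] [Algebra R B] (ρ : H →* (B →ₐ[R] B))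

/-- The spectrum of an algebra with an action of `H`, where `h` acts through the
automorphism `h⁻¹` of the algebra. -/
def galScheme : GScheme H (Spec (.of R)) where
  T := Spec (.of B)
  π := Spec.map (CommRingCat.ofHom (algebraMap R B))
  act :=
    { toFun := fun h => Spec.map (CommRingCat.ofHom (ρ h⁻¹ : B →+* B))
      map_one' := by
        have h : (ρ 1⁻¹ : B →+* B) = RingHom.id _ := by
          rw [inv_one, map_one]; rfl
        rw [h]; exact Spec.map_id _
      map_mul' := fun a b => by
        have h : (ρ (a * b)⁻¹ : B →+* B) = (ρ b⁻¹ : B →+* B).comp (ρ a⁻¹ : B →+* B) := by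
          rw [mul_inv_rev, map_mul]; rfl
        rw [h, End.mul_def, ← Spec.map_comp]; rfl }
  act_π := fun a => by
    change Spec.map _ ≫ Spec.map _ = Spec.map _
    rw [← Spec.map_comp, ← CommRingCat.ofHom_comp, AlgHom.comp_algebraMap]

/-- The morphism `H × T → T ×_S T` for a scheme with an action of `H`. -/
def GScheme.shear {S : Scheme.{u}} (Q : GScheme H S) :
    (∐ fun _ : H => Q.T) ⟶ pullback Q.π Q.π :=
  Sigma.desc fun g : H =>
    pullback.lift (f := Q.π) (g := Q.π) (𝟙 Q.T) (Q.act g : Q.T ⟶ Q.T) (by simp [Q.act_π g])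

variable [Finite H]

/-- The homomorphism `B ⊗ B → ∏ B`, `x ⊗ y ↦ (x h⁻¹(y))`. -/
def shearHom : B ⊗[R] B →ₐ[B] (H → B) :=
  Algebra.TensorProduct.lift (Algebra.ofId B (H → B)) (AlgHom.pi fun h => ρ h⁻¹)
    fun _ _ => mul_comm _ _

theorem shearHom_tmul (x y : B) (h : H) : shearHom ρ (x ⊗ₜ y) h = x * ρ h⁻¹ y := rfl

theorem bijective_shearHom_iff :
    Function.Bijective (shearHom ρ) ↔ Function.Bijective (tensorToPi ρ) := by
  have h : ⇑(shearHom ρ) = (Equiv.inv H).arrowCongr (Equiv.refl B) ∘ tensorToPi ρ := by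
    funext z
    induction z with
    | zero => rw [map_zero, Function.comp_apply, map_zero]; rfl
    | add x y hx hy =>
      rw [map_add, hx, hy]
      exact (congrArg ((Equiv.inv H).arrowCongr (Equiv.refl B)) (map_add (tensorToPi ρ) x y)).symm
    | tmul x y => rfl
  rw [h]
  exact Function.Bijective.of_comp_iff' (Equiv.bijective _) _

/-- The spectrum of a finite product is the disjoint union of the spectra. The index set need not be
in the universe of the rings. -/
theorem isIso_sigmaSpec (R : H → CommRingCat.{u}) : IsIso (sigmaSpec R) := by
  let E : (∀ i : ULift.{u} H, R i.down) ≃+* ∀ i, R i :=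
    RingEquiv.piCongrLeft (fun i => R i) Equiv.ulift
  have h : sigmaSpec R = (Sigma.reindex Equiv.ulift.{u} fun i => Spec (R i)).inv ≫
      sigmaSpec.{u, u} (fun i : ULift.{u} H => R i.down) ≫
        Spec.map (CommRingCat.ofHom E.symm.toRingHom) := by
    refine Sigma.hom_ext _ _ fun i => ?_
    rw [ι_sigmaSpec]
    refine Eq.trans ?_ (Sigma.ι_reindex_inv_assoc Equiv.ulift.{u} (fun i => Spec (R i)) ⟨i⟩ _).symm
    refine Eq.trans ?_ (ι_sigmaSpec_assoc (fun i : ULift.{u} H => R i.down) ⟨i⟩ _).symm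
    rw [← Spec.map_comp]
    rfl
  have h2 : IsIso (CommRingCat.ofHom E.symm.toRingHom) := E.symm.toCommRingCatIso.isIso_hom
  rw [h]
  exact IsIso.comp_isIso' inferInstance
    (IsIso.comp_isIso' (instIsIsoSchemeSigmaSpecOfFinite _) inferInstance)

/-- The shear morphism of `galScheme ρ` is induced by `shearHom ρ`. -/
theorem sigmaDesc_lift_eq (a : ∀ h : H, Spec.map (CommRingCat.ofHom (ρ h⁻¹ : B →+* B)) ≫
    Spec.map (CommRingCat.ofHom (algebraMap R B)) =
      Spec.map (CommRingCat.ofHom (algebraMap R B))) :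
    (Sigma.desc fun h : H => pullback.lift (𝟙 (Spec (.of B)))
      (Spec.map (CommRingCat.ofHom (ρ h⁻¹ : B →+* B))) ((Category.id_comp _).trans (a h).symm)) =
      sigmaSpec (fun _ : H => CommRingCat.of B) ≫
      Spec.map (CommRingCat.ofHom (shearHom ρ : B ⊗[R] B →+* (H → B))) ≫
        (pullbackSpecIso R B B).inv := by
  refine Sigma.hom_ext _ _ fun h => ?_
  rw [Sigma.ι_desc, ι_sigmaSpec_assoc]
  apply pullback.hom_ext
  · rw [pullback.lift_fst, Category.assoc, Category.assoc, pullbackSpecIso_inv_fst,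
      ← Spec.map_comp, ← Spec.map_comp]
    refine (Spec.map_id _).symm.trans (congrArg Spec.map ?_)
    refine CommRingCat.hom_ext (RingHom.ext fun x => ?_)
    exact ((shearHom_tmul ρ x 1 h).trans ((congrArg (x * ·) (map_one _)).trans (mul_one x))).symm
  · rw [pullback.lift_snd, Category.assoc, Category.assoc, pullbackSpecIso_inv_snd,
      ← Spec.map_comp, ← Spec.map_comp]
    refine congrArg Spec.map ?_
    refine CommRingCat.hom_ext (RingHom.ext fun x => ?_)
    exact ((shearHom_tmul ρ 1 x h).trans (one_mul _)).symm

/-- The morphism `H × T → T ×_S T` is an isomorphism, for the spectrum of an algebra `B`, if and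
only if `B ⊗ B → ∏ B` is. -/
theorem isIso_shear_galScheme_iff :
    IsIso (galScheme ρ).shear ↔ Function.Bijective (tensorToPi ρ) := by
  have h1 := sigmaDesc_lift_eq ρ (galScheme ρ).act_π
  have h2 : IsIso (galScheme ρ).shear ↔ IsIso (sigmaSpec (fun _ : H => CommRingCat.of B) ≫
      Spec.map (CommRingCat.ofHom (shearHom ρ : B ⊗[R] B →+* (H → B))) ≫
        (pullbackSpecIso R B B).inv) := by
    rw [← h1]; rfl
  have := isIso_sigmaSpec fun _ : H => CommRingCat.of B
  rw [h2, isIso_comp_left_iff, isIso_comp_right_iff, isIso_SpecMap_iff, ← bijective_shearHom_iff]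
  rfl

variable {ρ}

theorem IsGal.isTorsor [Nontrivial R] (hρ : IsGal ρ) : (galScheme ρ).IsTorsor := by
  have := hρ.faithfullyFlat
  have := hρ.etale
  refine ⟨?_, ?_, ?_, (isIso_shear_galScheme_iff ρ).2 hρ.bijective_tensorToPi⟩
  · refine Flat.SpecMap_iff.2 ?_
    change (algebraMap R B).Flat
    rw [RingHom.flat_algebraMap_iff]
    infer_instance
  · exact ⟨PrimeSpectrum.comap_surjective_of_faithfullyFlat (A := R) (B := B)⟩
  · refine (LocallyOfFinitePresentation.SpecMap_iff _).2 ?_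
    change (algebraMap R B).FinitePresentation
    rw [RingHom.finitePresentation_algebraMap]
    infer_instance

end Spec

/-! ### Torsors over a field -/

section Field

variable [Finite H]

namespace GScheme.IsTorsor

theorem of_iso {S : Scheme.{u}} {Q Q' : GScheme H S} (hQ : Q.IsTorsor) (e : Q.T ≅ Q'.T)
    (hπ : e.hom ≫ Q'.π = Q.π) (hact : ∀ h, (Q.act h : Q.T ⟶ Q.T) ≫ e.hom =
      e.hom ≫ (Q'.act h : Q'.T ⟶ Q'.T)) : Q'.IsTorsor := by
  have hπ' : Q'.π = e.inv ≫ Q.π := by rw [← hπ, Iso.inv_hom_id_assoc]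
  obtain ⟨h1, h2, h3, h4⟩ := hQ
  refine ⟨by rw [hπ']; infer_instance, by rw [hπ']; infer_instance,
    by rw [hπ']; infer_instance, ?_⟩
  change IsIso Q.shear at h4
  change IsIso Q'.shear
  have h5 : Q'.shear = (Sigma.mapIso fun _ : H => e.symm).hom ≫ Q.shear ≫
      pullback.map Q.π Q.π Q'.π Q'.π e.hom e.hom (𝟙 S) (by simp [hπ]) (by simp [hπ]) := by
    refine Sigma.hom_ext _ _ fun h => ?_
    refine (Sigma.ι_desc _ _).trans ?_
    refine Eq.trans ?_ (Sigma.ι_map_assoc (fun _ : H => e.inv) h _).symm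
    have h6 : Sigma.ι (fun _ : H => Q.T) h ≫ Q.shear = pullback.lift (f := Q.π) (g := Q.π) (𝟙 Q.T)
      (Q.act h : Q.T ⟶ Q.T) (by simp [Q.act_π h]) := Sigma.ι_desc _ _
    rw [reassoc_of% h6]
    apply pullback.hom_ext
    · refine (pullback.lift_fst _ _ _).trans (Eq.symm ?_)
      rw [Category.assoc, Category.assoc]
      have h7 : pullback.map Q.π Q.π Q'.π Q'.π e.hom e.hom (𝟙 S) (by simp [hπ]) (by simp [hπ]) ≫
        pullback.fst _ _ = pullback.fst _ _ ≫ e.hom := pullback.lift_fst _ _ _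
      rw [h7, pullback.lift_fst_assoc, Category.id_comp, Iso.inv_hom_id]
    · refine (pullback.lift_snd _ _ _).trans (Eq.symm ?_)
      rw [Category.assoc, Category.assoc]
      have h7 : pullback.map Q.π Q.π Q'.π Q'.π e.hom e.hom (𝟙 S) (by simp [hπ]) (by simp [hπ]) ≫
        pullback.snd _ _ = pullback.snd _ _ ≫ e.hom := pullback.lift_snd _ _ _
      rw [h7, pullback.lift_snd_assoc, hact, Iso.inv_hom_id_assoc]
  rw [h5]
  infer_instance

variable {S : Scheme.{u}} {Q : GScheme H S} (hQ : Q.IsTorsor)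
include hQ

theorem shear_fst : Q.shear ≫ pullback.fst _ _ = Limits.Sigma.desc fun _ => 𝟙 Q.T :=
  Sigma.hom_ext _ _ fun h => by
    rw [Sigma.ι_desc]
    exact (Sigma.ι_desc_assoc _ _ _).trans (pullback.lift_fst _ _ _)

/-- The group acts transitively on the fibres. -/
theorem exists_act_eq {u t : Q.T} (h : Q.π u = Q.π t) :
    ∃ g, (show Q.T ⟶ Q.T from Q.act g) u = t := by
  have : IsIso Q.shear := hQ.isIso
  obtain ⟨z, rfl, rfl⟩ := Scheme.Pullback.exists_preimage_pullback u t h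
  obtain ⟨w, rfl⟩ := Q.shear.surjective z
  obtain ⟨g, w, rfl⟩ := (sigmaOpenCover fun _ : H => Q.T).exists_eq w
  have h1 : Sigma.ι (fun _ : H => Q.T) g ≫ Q.shear ≫ pullback.fst _ _ = 𝟙 Q.T :=
    (Sigma.ι_desc_assoc _ _ _).trans (pullback.lift_fst _ _ _)
  have h2 : Sigma.ι (fun _ : H => Q.T) g ≫ Q.shear ≫ pullback.snd _ _ = Q.act g :=
    (Sigma.ι_desc_assoc _ _ _).trans (pullback.lift_snd _ _ _)
  refine ⟨g, ?_⟩
  have h3 : (pullback.fst Q.π Q.π) (Q.shear ((sigmaOpenCover fun _ : H => Q.T).f g w)) = w :=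
    congrArg (fun f : Q.T ⟶ Q.T => f w) h1
  rw [h3]
  exact (congrArg (fun f : Q.T ⟶ Q.T => f w) h2).symm

/-- Properties of morphisms which satisfy fpqc descent and are local on the source hold for the
structural morphism, since after base change to the torsor it is a disjoint union
of identity morphisms. -/
theorem of_descendsAlong {P : MorphismProperty Scheme.{u}}
    {RP : ∀ {R S : Type u} [CommRing R] [CommRing S], (R →+* S) → Prop} [HasRingHomProperty P RP]
    [P.IsMultiplicative] [P.DescendsAlong (@Surjective ⊓ @Flat ⊓ @QuasiCompact)] : P Q.π := by
  have h4 : IsIso Q.shear := hQ.isIso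
  have h5 : P (pullback.fst Q.π Q.π) := by
    rw [← MorphismProperty.cancel_left_of_respectsIso P Q.shear, shear_fst hQ]
    exact IsZariskiLocalAtSource.sigmaDesc fun _ => P.id_mem _
  exact MorphismProperty.of_pullback_fst_of_descendsAlong
    (Q := @Surjective ⊓ @Flat ⊓ @LocallyOfFinitePresentation)
    ⟨⟨hQ.surjective, hQ.flat⟩, hQ.locallyOfFinitePresentation⟩ h5

theorem etale : Etale Q.π := hQ.of_descendsAlong (P := @Etale) (RP := RingHom.Etale)

end GScheme.IsTorsor

theorem locallyQuasiFinite_of_formallyUnramified {X Y : Scheme.{u}} (f : X ⟶ Y)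
    [FormallyUnramified f] [LocallyOfFiniteType f] : LocallyQuasiFinite f := by
  rw [HasRingHomProperty.iff_appLE (P := @LocallyQuasiFinite)]
  intro U V e
  have h1 := HasRingHomProperty.appLE (P := @FormallyUnramified) f inferInstance U V e
  have h2 := HasRingHomProperty.appLE (P := @LocallyOfFiniteType) f inferInstance U V e
  algebraize [(f.appLE U V e).hom]
  change Algebra.QuasiFinite _ _
  infer_instance

variable {l : Type u} [Field l]

/-- Torsors over fields are finite: they are étale, hence locally quasi-finite, and have finitely
many points, since the group acts transitively on them. -/
theorem GScheme.IsTorsor.isFinite {Q : GScheme H (Spec (.of l))} (hQ : Q.IsTorsor) :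
    IsFinite Q.π := by
  have := hQ.etale
  have := hQ.surjective
  have := hQ.locallyOfFinitePresentation
  have := locallyQuasiFinite_of_formallyUnramified Q.π
  have : Subsingleton (Spec (.of l)) := inferInstanceAs (Subsingleton (PrimeSpectrum l))
  obtain ⟨u, -⟩ := Q.π.surjective (⊥ : PrimeSpectrum l)
  have : Finite Q.T := Finite.of_surjective (fun g : H => (show Q.T ⟶ Q.T from Q.act g) u)
    fun t => hQ.exists_act_eq (Subsingleton.elim _ _)
  have : QuasiCompact Q.π := by
    rw [quasiCompact_iff_compactSpace]
    infer_instance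
  exact IsFinite.of_locallyQuasiFinite _

theorem nonempty_basis_of_bijective {L : Type u} [CommRing L] [Algebra l L] [Nontrivial L]
    [Module.Finite l L] {μ : H →* (L →ₐ[l] L)} (hμ : Function.Bijective (tensorToPi μ)) :
    Nonempty (Module.Basis H l L) := by
  let := Fintype.ofFinite H
  have h1 := (LinearEquiv.ofBijective (tensorToPi μ).toLinearMap hμ).finrank_eq
  rw [Module.finrank_baseChange, Module.finrank_fintype_fun_eq_card] at h1
  exact ⟨(Module.finBasis l L).reindex (Fintype.equivFinOfCardEq h1.symm).symm⟩

/-- Torsors over fields are spectra of Galois algebras. -/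
theorem GScheme.IsTorsor.exists_isGal {Q : GScheme H (Spec (.of l))} (hQ : Q.IsTorsor) :
    ∃ (L : Type u) (_ : CommRing L) (_ : Algebra l L) (μ : H →* (L →ₐ[l] L)) (_ : IsGal μ)
      (e : Q.T ≅ Spec (.of L)),
      e.hom ≫ Spec.map (CommRingCat.ofHom (algebraMap l L)) = Q.π ∧
        ∀ h, (Q.act h : Q.T ⟶ Q.T) ≫ e.hom =
          e.hom ≫ Spec.map (CommRingCat.ofHom (μ h⁻¹ : L →+* L)) := by
  have := hQ.isFinite
  have := hQ.surjective
  have : IsAffine Q.T := isAffine_of_isAffineHom Q.π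
  let L := Γ(Q.T, ⊤)
  obtain ⟨a, ha⟩ := Spec.map_surjective (Q.T.isoSpec.inv ≫ Q.π)
  let : Algebra l L := a.hom.toAlgebra
  choose m hm using fun h : H => Spec.map_surjective (Q.T.isoSpec.inv ≫ Q.act h ≫ Q.T.isoSpec.hom)
  let μ : H →* (L →ₐ[l] L) :=
    { toFun h := { (m h⁻¹).hom with
        commutes' r := by
          have h1 : a ≫ m h⁻¹ = a := Spec.map_injective (by
            rw [Spec.map_comp, hm, ha]
            simp [Q.act_π])
          exact congrArg (fun f : CommRingCat.of l ⟶ L => f.hom r) h1 }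
      map_one' := by
        have h1 : m 1⁻¹ = 𝟙 L := Spec.map_injective (by
          rw [hm, Spec.map_id, inv_one, map_one, End.one_def, Category.id_comp, Iso.inv_hom_id])
        exact AlgHom.ext fun x => congrArg (fun f : L ⟶ L => f.hom x) h1
      map_mul' h h' := by
        have h1 : m (h * h')⁻¹ = m h'⁻¹ ≫ m h⁻¹ := Spec.map_injective (by
          rw [Spec.map_comp, hm, hm, hm, mul_inv_rev, map_mul, End.mul_def]
          simp)
        exact AlgHom.ext fun x => congrArg (fun f : L ⟶ L => f.hom x) h1 }
  have hμ : ∀ h, Spec.map (CommRingCat.ofHom (μ h⁻¹ : L →+* L)) =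
      Q.T.isoSpec.inv ≫ Q.act h ≫ Q.T.isoSpec.hom := fun h => by
    rw [← hm]
    refine congrArg Spec.map (CommRingCat.hom_ext (RingHom.ext fun x => ?_))
    change (m h⁻¹⁻¹).hom x = (m h).hom x
    rw [inv_inv]
  let e : Q.T ≅ (galScheme μ).T := Q.T.isoSpec
  have he : e.hom ≫ (galScheme μ).π = Q.π :=
    (congrArg (Q.T.isoSpec.hom ≫ ·) ha).trans (Iso.hom_inv_id_assoc _ _)
  have hact : ∀ h, (Q.act h : Q.T ⟶ Q.T) ≫ e.hom =
      e.hom ≫ ((galScheme μ).act h : (galScheme μ).T ⟶ (galScheme μ).T) := fun h =>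
    ((congrArg (Q.T.isoSpec.hom ≫ ·) (hμ h)).trans (Iso.hom_inv_id_assoc _ _)).symm
  have hT := hQ.of_iso e he hact
  have hbij := (isIso_shear_galScheme_iff μ).1 hT.isIso
  have hfin : Module.Finite l L := by
    have h1 : IsFinite (Spec.map a) := by rw [ha]; infer_instance
    exact (IsFinite.SpecMap_iff _).1 h1
  have hnt : Nontrivial L := by
    have := hT.surjective
    obtain ⟨u, -⟩ := (galScheme μ).π.surjective (⊥ : PrimeSpectrum l)
    exact PrimeSpectrum.nontrivial (R := L) u
  obtain ⟨b⟩ := nonempty_basis_of_bijective hbij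
  exact ⟨L, inferInstance, inferInstance, μ, isGal_of_bijective b hbij, e, he, hact⟩

end Field

end GalScheme

/-! ### Affine varieties and their points -/

section SpecOver

open TensorProduct

/-- A homomorphism of Galois algebras over a field which commutes with the group is bijective. -/
theorem IsGal.bijective_of_equivariant {H : Type} [Group H] [Finite H] {l L L' : Type*} [Field l]
    [CommRing L] [Algebra l L] [CommRing L'] [Algebra l L'] {μ : H →* (L →ₐ[l] L)}
    {μ' : H →* (L' →ₐ[l] L')} (hμ : IsGal μ) (hμ' : IsGal μ') (f : L →ₐ[l] L')
    (hf : ∀ h x, f (μ h x) = μ' h (f x)) : Function.Bijective f := by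
  classical
  let := Fintype.ofFinite H
  obtain ⟨b, hb⟩ := hμ.exists_basis
  obtain ⟨b', -⟩ := hμ'.exists_basis
  have : Nontrivial L' := ⟨b' 1, 0, b'.ne_zero 1⟩
  have hb1 := hb.map f
  rw [AlgHom.map_det] at hb1
  have hinj : Function.Injective f := by
    rw [injective_iff_map_eq_zero]
    intro x hx
    refine b.repr.map_eq_zero_iff.1 (Finsupp.ext fun j => (algebraMap l L').injective ?_)
    rw [Finsupp.zero_apply, map_zero]
    refine congrFun (Matrix.mulVec_injective_of_isUnit ((Matrix.isUnit_iff_isUnit_det _).2 hb1)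
      (a₁ := fun j => algebraMap l L' (b.repr x j)) (a₂ := 0) (funext fun h => ?_)) j
    rw [Matrix.mulVec_zero, Pi.zero_apply, ← map_zero (μ' h), ← hx, ← hf]
    conv_rhs => rw [← b.sum_repr x, map_sum, map_sum]
    refine Finset.sum_congr rfl fun j _ => ?_
    rw [map_smul, map_smul, Algebra.smul_def, mul_comm]; rfl
  have := Module.Finite.of_basis b
  have := Module.Finite.of_basis b'
  have hrank : Module.finrank l L = Module.finrank l L' := by
    rw [Module.finrank_eq_card_basis b, Module.finrank_eq_card_basis b']
  exact ⟨hinj, (LinearMap.injective_iff_surjective_of_finrank_eq_finrank (f := f.toLinearMap)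
    hrank).1 hinj⟩

/-- An equivariant homomorphism of Galois algebras, over a homomorphism from a ring to a field,
gives a cartesian square. -/
theorem isPullback_of_isGal {H : Type} [Group H] [Finite H] {R B l L : Type u} [CommRing R]
    [CommRing B] [Algebra R B] [Field l] [CommRing L] [Algebra l L] {ρ : H →* (B →ₐ[R] B)}
    {μ : H →* (L →ₐ[l] L)} (hρ : IsGal ρ) (hμ : IsGal μ) (p : R →+* l) (f : B →+* L)
    (hp : ∀ r, f (algebraMap R B r) = algebraMap l L (p r)) (hf : ∀ h x, f (ρ h x) = μ h (f x)) :
    IsPullback (Spec.map (CommRingCat.ofHom f)) (Spec.map (CommRingCat.ofHom (algebraMap l L)))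
      (Spec.map (CommRingCat.ofHom (algebraMap R B))) (Spec.map (CommRingCat.ofHom p)) := by
  let : Algebra R l := p.toAlgebra
  let : Algebra R L := ((algebraMap l L).comp p).toAlgebra
  have : IsScalarTower R l L := .of_algebraMap_eq' rfl
  let F : l ⊗[R] B →ₐ[l] L := Algebra.TensorProduct.lift (Algebra.ofId l L)
    ({ f with commutes' := hp } : B →ₐ[R] L) fun _ _ => mul_comm _ _
  have hF : Function.Bijective F := (hρ.baseChange l).bijective_of_equivariant hμ F fun h z => by
    induction z with
    | zero => simp
    | add x y hx hy => rw [map_add, map_add, map_add, map_add, hx, hy]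
    | tmul x y =>
      change algebraMap l L x * f (ρ h y) = μ h (algebraMap l L x * f y)
      rw [map_mul, hf, AlgHom.commutes]
  have h1 := (CommRingCat.isPushout_tensorProduct R l B).flip
  refine isPullback_SpecMap_of_isPushout _ _ _ _ (h1.of_iso (Iso.refl _) (Iso.refl _) (Iso.refl _)
    (RingEquiv.ofBijective F hF).toCommRingCatIso ?_ ?_ ?_ ?_)
  · rfl
  · rfl
  · refine CommRingCat.hom_ext (RingHom.ext fun x => ?_)
    change F (1 ⊗ₜ x) = f x
    exact (congrArg (· * f x) (map_one (algebraMap l L))).trans (one_mul _)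
  · refine CommRingCat.hom_ext (RingHom.ext fun x => ?_)
    change F (x ⊗ₜ 1) = algebraMap l L x
    exact (congrArg (algebraMap l L x * ·) (map_one f)).trans (mul_one _)

variable (k : Type u) [Field k] (R : Type u) [CommRing R] [Algebra k R]

/-- The spectrum of a `k`-algebra, as a scheme over `k`. -/
def specOver : Over (Spec (.of k)) :=
  Over.mk (Y := Spec (.of R)) (Spec.map (CommRingCat.ofHom (algebraMap k R)))

theorem isVariety_specOver [Algebra.FiniteType k R] : IsVariety (specOver k R) where
  isSeparated := inferInstanceAs (IsSeparated (Spec.map (CommRingCat.ofHom (algebraMap k R))))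
  locallyOfFiniteType := by
    change LocallyOfFiniteType (Spec.map (CommRingCat.ofHom (algebraMap k R)))
    rw [HasRingHomProperty.Spec_iff (P := @LocallyOfFiniteType)]
    change (algebraMap k R).FiniteType
    rw [RingHom.finiteType_algebraMap]
    infer_instance
  quasiCompact := inferInstanceAs (QuasiCompact (Spec.map (CommRingCat.ofHom (algebraMap k R))))

theorem smooth_specOver [Algebra.Smooth k R] : Smooth (specOver k R).hom := by
  change Smooth (Spec.map (CommRingCat.ofHom (algebraMap k R)))
  rw [HasRingHomProperty.Spec_iff (P := @Smooth)]
  change (algebraMap k R).Smooth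
  rw [RingHom.smooth_algebraMap]
  infer_instance

theorem geometricallyIntegral_specOver
    (h : ∀ (K : Type u) [Field K] [Algebra k K], IsDomain (K ⊗[k] R)) :
    GeometricallyIntegral (specOver k R).hom := by
  change GeometricallyIntegral (Spec.map (CommRingCat.ofHom (algebraMap k R)))
  rw [geometricallyIntegral_iff, geometrically_iff_of_commRing]
  intro K _ _ Y fst snd hY
  have := h K
  have : IsDomain (R ⊗[k] K) :=
    (Algebra.TensorProduct.comm k R K).toMulEquiv.isDomain _
  let e : Y ≅ Spec (.of (R ⊗[k] K)) := hY.isoPullback ≪≫ pullbackSpecIso k R K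
  have : Nonempty Y := ⟨e.inv (⊥ : PrimeSpectrum (R ⊗[k] K))⟩
  exact isIntegral_of_isOpenImmersion e.hom

variable {k R} {l : Type u} [Field l] [Algebra k l]

/-- The point defined by a homomorphism of algebras. -/
def pointOfAlgHom (p : R →ₐ[k] l) : Points (specOver k R) l :=
  ⟨Spec.map (CommRingCat.ofHom (p : R →+* l)), by
    change Spec.map _ ≫ Spec.map _ = Spec.map _
    rw [← Spec.map_comp, ← CommRingCat.ofHom_comp, AlgHom.comp_algebraMap]⟩

theorem exists_eq_pointOfAlgHom (x : Points (specOver k R) l) :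
    ∃ p : R →ₐ[k] l, x = pointOfAlgHom p := by
  obtain ⟨a, ha⟩ := Spec.map_surjective (show Spec (.of l) ⟶ Spec (.of R) from x.1)
  refine ⟨{ a.hom with commutes' := fun r => ?_ }, Subtype.ext ha.symm⟩
  have h1 : CommRingCat.ofHom (algebraMap k R) ≫ a = CommRingCat.ofHom (algebraMap k l) :=
    Spec.map_injective (by
      rw [Spec.map_comp, ha]
      exact x.2)
  exact congrArg (fun f : CommRingCat.of k ⟶ CommRingCat.of l => f.hom r) h1

theorem nonempty_points_iff : Nonempty (Points (specOver k R) l) ↔ Nonempty (R →ₐ[k] l) :=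
  ⟨fun ⟨x⟩ => ⟨(exists_eq_pointOfAlgHom x).choose⟩, fun ⟨p⟩ => ⟨pointOfAlgHom p⟩⟩

/-- A set of points is dense if it is not contained in the zero locus of a nonzero function. -/
theorem dense_points (P : Points (specOver k R) l → Prop)
    (hP : ∀ f : l ⊗[k] R, f ≠ 0 → ∃ p : R →ₐ[k] l, P (pointOfAlgHom p) ∧
      Algebra.TensorProduct.lift (AlgHom.id l l) p (fun _ _ => mul_comm _ _) f ≠ 0) :
    Dense {z : ↥(pullback (specOver k R).hom (specExt k l)) |
      ∃ x : Points (specOver k R) l, P x ∧ z ∈ Set.range x.section} := by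
  let E : pullback (specOver k R).hom (specExt k l) ≅ Spec (.of (R ⊗[k] l)) :=
    pullbackSpecIso k R l
  have hE1 : E.inv ≫ pullback.fst (specOver k R).hom (specExt k l) = Spec.map
    (CommRingCat.ofHom Algebra.TensorProduct.includeLeftRingHom) := pullbackSpecIso_inv_fst k R l
  have hE2 : E.inv ≫ pullback.snd (specOver k R).hom (specExt k l) = Spec.map
    (CommRingCat.ofHom (Algebra.TensorProduct.includeRight : l →ₐ[k] R ⊗[k] l).toRingHom) :=
    pullbackSpecIso_inv_snd k R l
  let c := Algebra.TensorProduct.comm k R l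
  have hsec : ∀ p : R →ₐ[k] l, (pointOfAlgHom p).section ≫ E.hom = Spec.map (CommRingCat.ofHom
      (((Algebra.TensorProduct.lift (AlgHom.id l l) p (fun _ _ => mul_comm _ _) :
        l ⊗[k] R →ₐ[l] l) : l ⊗[k] R →+* l).comp (c : R ⊗[k] l →+* l ⊗[k] R))) := fun p => by
    rw [← Iso.eq_comp_inv]
    apply pullback.hom_ext
    · refine (pullback.lift_fst _ _ _).trans (Eq.symm ?_)
      rw [Category.assoc, hE1]
      refine (Spec.map_comp _ _).symm.trans (congrArg Spec.map
        (CommRingCat.hom_ext (RingHom.ext fun x => ?_)))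
      exact one_mul _
    · refine (pullback.lift_snd _ _ _).trans (Eq.symm ?_)
      rw [Category.assoc, hE2]
      refine ((Spec.map_comp _ _).symm.trans (congrArg Spec.map
        (CommRingCat.hom_ext (RingHom.ext fun x => ?_)))).trans (Spec.map_id _)
      exact (congrArg (x * ·) (map_one p)).trans (mul_one x)
  let e : ↥(pullback (specOver k R).hom (specExt k l)) ≃ₜ PrimeSpectrum (R ⊗[k] l) :=
    E.hom.homeomorph
  rw [dense_iff_inter_open]
  intro U hU hne
  have hU' : IsOpen (e '' U) := e.isOpenMap _ hU
  obtain ⟨z, hz⟩ := hne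
  obtain ⟨_, ⟨f, rfl⟩, hzf, hf⟩ :=
    PrimeSpectrum.isTopologicalBasis_basic_opens.exists_subset_of_mem_open
    (Set.mem_image_of_mem e hz) hU'
  have hf0 : c f ≠ 0 := fun h0 => by
    rw [map_eq_zero_iff _ c.injective] at h0
    subst h0
    exact hzf (Ideal.zero_mem _)
  obtain ⟨p, hp, hpf⟩ := hP _ hf0
  let w : Spec (.of l) := (⊥ : PrimeSpectrum l)
  have h1 : e ((pointOfAlgHom p).section w) ∈
      (PrimeSpectrum.basicOpen f : Set (PrimeSpectrum (R ⊗[k] l))) := by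
    have h2 := congrArg (fun g : Spec (.of l) ⟶ Spec (.of (R ⊗[k] l)) => g w) (hsec p)
    change e ((pointOfAlgHom p).section w) = _ at h2
    rw [h2]
    exact hpf
  obtain ⟨y, hy, hy'⟩ := hf h1
  exact ⟨_, e.injective hy' ▸ hy, pointOfAlgHom p, hp, w, rfl⟩

end SpecOver

/-! ### Lifting varieties -/

section LiftingVariety

open TensorProduct

variable {k : Type u} [Field k] {G H : Type} [Group G] [Finite G] [Group H] [Finite H]
  {p : Gal k →* G} {φ : H →* G}

section Triangle

variable {R B : Type u} [CommRing R] [CommRing B] [Algebra k R] [Algebra R B] [Algebra k B]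
  [IsScalarTower k R B] [Nontrivial R] {ρ : H →* (B →ₐ[R] B)} (hρ : IsGal ρ)
  (j : torsorAlgebra p →ₐ[k] B) (hj : ∀ h a, j (torsorAlgebra.action p (φ h) a) = ρ h (j a))

/-- The lifting triangle given by an equivariant homomorphism from `torsorAlgebra p` to a Galois
algebra. -/
def galTriangle : LiftingTriangle φ (torsorOfHom p) (specOver k R).hom where
  Q := galScheme ρ
  isTorsor := hρ.isTorsor
  F := Spec.map (CommRingCat.ofHom (j : torsorAlgebra p →+* B))
  F_over := by
    change Spec.map (CommRingCat.ofHom _) ≫ Spec.map (CommRingCat.ofHom _) =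
      Spec.map (CommRingCat.ofHom _) ≫ Spec.map (CommRingCat.ofHom _)
    refine (Spec.map_comp _ _).symm.trans (Eq.trans (congrArg Spec.map
      (CommRingCat.hom_ext (RingHom.ext fun x => ?_))) (Spec.map_comp _ _))
    exact (j.commutes x).trans (IsScalarTower.algebraMap_apply k R B x)
  F_equivariant := fun h => by
    change Spec.map (CommRingCat.ofHom _) ≫ Spec.map (CommRingCat.ofHom _) =
      Spec.map (CommRingCat.ofHom _) ≫ Spec.map (CommRingCat.ofHom _)
    refine (Spec.map_comp _ _).symm.trans (Eq.trans (congrArg Spec.map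
      (CommRingCat.hom_ext (RingHom.ext fun x => ?_))) (Spec.map_comp _ _))
    change ρ h⁻¹ (j x) = j (torsorAlgebra.trans p (φ h) x)
    rw [← hj, map_inv]
    exact congrArg j (DFunLike.congr_fun (torsorAlgebra.coe_action_inv p (φ h)) x)

include hρ hj in
/-- A criterion for `galTriangle` to make `Spec R` a lifting variety. A lifting triangle over a
field `l` is given by a Galois algebra `L` over `l` and an equivariant homomorphism
`c : torsorAlgebra p → L`. It is isomorphic to the pullback of `galTriangle` along a point
`x : R → l` if `c` extends to an equivariant homomorphism `v : B → L` over `x`. -/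
theorem isLiftingVariety_specOver [Algebra.FiniteType k R]
    (hdom : ∀ (K : Type u) [Field K] [Algebra k K], IsDomain (K ⊗[k] R))
    (hpt : ∀ (l : Type u) [Field l] [Algebra k l] [Infinite l] (L : Type u) [CommRing L]
      [Algebra l L] [Algebra k L] [IsScalarTower k l L] (μ : H →* (L →ₐ[l] L)) (_ : IsGal μ)
      (c : torsorAlgebra p →ₐ[k] L) (_ : ∀ h a, c (torsorAlgebra.action p (φ h) a) = μ h (c a))
      (f : l ⊗[k] R) (_ : f ≠ 0), ∃ (x : R →ₐ[k] l) (v : B →ₐ[k] L),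
        (∀ r, v (algebraMap R B r) = algebraMap l L (x r)) ∧ (∀ h b, v (ρ h b) = μ h (v b)) ∧
        (∀ a, v (j a) = c a) ∧
        Algebra.TensorProduct.lift (AlgHom.id l l) x (fun _ _ => mul_comm _ _) f ≠ 0) :
    IsLiftingVariety φ (torsorOfHom p) (specOver k R) := by
  refine ⟨isVariety_specOver k R, geometricallyIntegral_specOver k R hdom,
    galTriangle hρ j hj, fun l _ _ _ t => ?_⟩
  obtain ⟨L, _, _, μ, hμ, e, he, hact⟩ := t.isTorsor.exists_isGal
  let : Algebra k L := ((algebraMap l L).comp (algebraMap k l)).toAlgebra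
  have : IsScalarTower k l L := .of_algebraMap_eq' rfl
  -- the homomorphism `c` given by the equivariant morphism `t.F`
  let F : t.Q.T ⟶ Spec (.of (torsorAlgebra p)) := t.F
  have hF1 : F ≫ Spec.map (CommRingCat.ofHom (algebraMap k (torsorAlgebra p))) =
    t.Q.π ≫ specExt k l := t.F_over
  have hF2 : ∀ h, (t.Q.act h : t.Q.T ⟶ t.Q.T) ≫ F =
    F ≫ Spec.map (CommRingCat.ofHom (torsorAlgebra.trans p (φ h))) := t.F_equivariant
  obtain ⟨c', hc'⟩ := Spec.map_surjective (e.inv ≫ F)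
  have hπ : e.inv ≫ t.Q.π = Spec.map (CommRingCat.ofHom (algebraMap l L)) := by
    rw [← he, Iso.inv_hom_id_assoc]
  let c : torsorAlgebra p →ₐ[k] L := { c'.hom with
    commutes' := fun r => by
      have h1 : CommRingCat.ofHom (algebraMap k (torsorAlgebra p)) ≫ c' =
          CommRingCat.ofHom (algebraMap k l) ≫ CommRingCat.ofHom (algebraMap l L) :=
        Spec.map_injective (by
          rw [Spec.map_comp, Spec.map_comp, hc', ← hπ, Category.assoc, Category.assoc, hF1])
      exact congrArg (fun f : CommRingCat.of k ⟶ CommRingCat.of L => f.hom r) h1 }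
  have hcF : F = e.hom ≫ Spec.map (CommRingCat.ofHom (c : torsorAlgebra p →+* L)) := by
    rw [← Iso.inv_comp_eq, ← hc']; rfl
  have hc : ∀ h a, c (torsorAlgebra.action p (φ h) a) = μ h (c a) := fun h a => by
    have h1 : CommRingCat.ofHom (torsorAlgebra.trans p (φ h⁻¹)) ≫ c' =
        c' ≫ CommRingCat.ofHom (μ h⁻¹⁻¹ : L →+* L) := Spec.map_injective (by
      have h3 : Spec.map (CommRingCat.ofHom (μ h⁻¹⁻¹ : L →+* L)) ≫ e.inv =
          e.inv ≫ (t.Q.act h⁻¹ : t.Q.T ⟶ t.Q.T) := by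
        rw [Iso.eq_inv_comp, ← Category.assoc, ← hact, Category.assoc, Iso.hom_inv_id,
          Category.comp_id]
      rw [Spec.map_comp, Spec.map_comp, hc', reassoc_of% h3, hF2, Category.assoc])
    have h4 := congrArg (fun f : CommRingCat.of (torsorAlgebra p) ⟶ CommRingCat.of L => f.hom a) h1
    rw [inv_inv, map_inv] at h4
    refine Eq.trans (congrArg c ?_) h4
    have h5 := DFunLike.congr_fun (torsorAlgebra.coe_action_inv p (φ h)⁻¹) a
    rw [inv_inv] at h5
    exact h5
  refine dense_points _ fun f hf => ?_
  obtain ⟨x, v, hx, hv, hvj, hxf⟩ := hpt l L μ hμ c hc f hf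
  refine ⟨x, ⟨e.hom ≫ Spec.map (CommRingCat.ofHom (v : B →+* L)), ?_, fun h => ?_, ?_⟩, hxf⟩
  · have h1 := isPullback_of_isGal hρ hμ (x : R →+* l) (v : B →+* L) hx hv
    exact h1.of_iso e.symm (Iso.refl _) (Iso.refl _) (Iso.refl _)
      ((Category.comp_id _).trans (e.inv_hom_id_assoc _).symm)
      ((Category.comp_id _).trans hπ.symm)
      ((Category.comp_id _).trans (Category.id_comp _).symm)
      ((Category.comp_id _).trans (Category.id_comp _).symm)
  · refine ((Category.assoc _ _ _).symm.trans (congrArg (· ≫ Spec.map (CommRingCat.ofHom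
      (v : B →+* L))) (hact h))).trans ((Category.assoc _ _ _).trans ?_)
    refine Eq.trans (congrArg (e.hom ≫ ·) ?_) (Category.assoc _ _ _).symm
    change Spec.map (CommRingCat.ofHom _) ≫ Spec.map (CommRingCat.ofHom _) =
      Spec.map (CommRingCat.ofHom _) ≫ Spec.map (CommRingCat.ofHom _)
    refine (Spec.map_comp _ _).symm.trans (Eq.trans (congrArg Spec.map
      (CommRingCat.hom_ext (RingHom.ext fun x => ?_))) (Spec.map_comp _ _))
    exact (hv h⁻¹ x).symm
  · refine Eq.trans ((Category.assoc _ _ _).trans (congrArg (e.hom ≫ ·) ?_)) hcF.symm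
    refine (Spec.map_comp _ _).symm.trans (congrArg Spec.map
      (CommRingCat.hom_ext (RingHom.ext fun x => ?_)))
    exact hvj x

end Triangle

variable (p φ) (N : ℕ)

/-- The ring of functions on the lifting variety. -/
abbrev LiftRing : Type u :=
  invariants (NormalRing.action (N := N) ((torsorAlgebra.action p).comp φ))

/-- The quotient by `H` of the product of the torsor given by `p`, the open subscheme `conjDet ≠ 0`
of the affine space of functions on `H`, and an affine space of dimension `N` with trivial action.
The group acts freely on the second factor. -/
def liftVariety : Over (Spec (.of k)) := specOver k (LiftRing p φ N)

variable {p φ}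

instance liftRing_nontrivial : Nontrivial (LiftRing p φ N) :=
  have : Nontrivial (NormalRing H (torsorAlgebra p) N) := inferInstance
  inferInstance

theorem torsorAlgebra_smooth (hp : IsOpen (p.ker : Set (Gal k))) :
    Algebra.Smooth k (torsorAlgebra p) :=
  have := (torsorAlgebra.isGal hp).etale
  inferInstance

theorem isVariety_liftVariety (hp : IsOpen (p.ker : Set (Gal k))) :
    IsVariety (liftVariety p φ N) :=
  have := torsorAlgebra_smooth hp
  have : Algebra.FiniteType k (LiftRing p φ N) := NormalRing.finiteType_invariants _
  isVariety_specOver _ _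

theorem smooth_liftVariety (hp : IsOpen (p.ker : Set (Gal k))) : Smooth (liftVariety p φ N).hom :=
  have := torsorAlgebra_smooth hp
  have : Algebra.Smooth k (LiftRing p φ N) := NormalRing.smooth_invariants _
  smooth_specOver _ _

theorem nonempty_points_liftVariety_iff (hp : IsOpen (p.ker : Set (Gal k)))
    (hφ : Function.Surjective φ) {l : Type u} [Field l] [Algebra k l] [Infinite l]
    (ι : SeparableClosure k →ₐ[k] SeparableClosure l) :
    Nonempty (Points (liftVariety p φ N) l) ↔
      ∃ q : Gal l →* H, IsOpen (q.ker : Set (Gal l)) ∧ ∀ γ, φ (q γ) = p (galRes ι γ) :=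
  nonempty_points_iff.trans (NormalRing.nonempty_point_iff hp hφ N ι)

theorem isLiftingVariety_liftVariety (hp : IsOpen (p.ker : Set (Gal k)))
    (hφ : Function.Surjective φ) : IsLiftingVariety φ (torsorOfHom p) (liftVariety p φ N) := by
  have := torsorAlgebra_smooth hp
  have : Algebra.FiniteType k (LiftRing p φ N) := NormalRing.finiteType_invariants _
  have hα := torsorAlgebra.isGal hp
  refine isLiftingVariety_specOver
    (NormalRing.isGal (N := N) ((torsorAlgebra.action p).comp φ))
    (IsScalarTower.toAlgHom k (torsorAlgebra p) (NormalRing H (torsorAlgebra p) N))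
    (fun h a => (NormalRing.action_algebraMap ((torsorAlgebra.action p).comp φ) h a).symm)
    (fun K _ _ => NormalRing.isDomain_tensorProduct hα hφ K) ?_
  intro l _ _ _ L _ _ _ _ μ hμ c hc f hf
  obtain ⟨z, u, hz, x, hx, hxf⟩ := NormalRing.exists_point_ne_zero hμ c hc hα hφ f hf
  exact ⟨x, NormalRing.liftAlg c (fun h => μ h z) (fun i => algebraMap l L (u i)) hz,
    fun r => (hx r).symm, (NormalRing.exists_point hμ c hc z u hz).1,
    fun a => NormalRing.liftAlg_algebraMap _ _ _ hz a, hxf⟩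

/-! ### Closed embeddings -/

section Embedding

variable {H' : Type} [Group H'] [Finite H'] {φ' : H' →* G}

theorem surjective_of_generators {k R S : Type*} [CommRing k] [CommRing R] [CommRing S]
    [Algebra k R] [Algebra k S] {σ : Type*} {g : MvPolynomial σ k →ₐ[k] R}
    (hg : Function.Surjective g) (f : S →ₐ[k] R) (y : σ → S)
    (hy : ∀ i, f (y i) = g (MvPolynomial.X i)) : Function.Surjective f := by
  intro r
  obtain ⟨P, rfl⟩ := hg r
  refine ⟨MvPolynomial.aeval y P, ?_⟩
  have h : f.comp (MvPolynomial.aeval y) = g := MvPolynomial.algHom_ext fun i => by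
    rw [AlgHom.comp_apply, MvPolynomial.aeval_X, hy]
  exact DFunLike.congr_fun h P

/-- An injective homomorphism `j : H → H'` over `G` defines an equivariant homomorphism, which maps
the coordinate `x_{h'}` to `x_h` if `h' = j(h)` and to `0` otherwise, and the additional
coordinates to given invariants. -/
theorem NormalRing.exists_equivariant {A : Type*} [CommRing A] [Algebra k A]
    (α : G →* (A →ₐ[k] A)) (j : H →* H') (hj : Function.Injective j) (hφ : ∀ h, φ' (j h) = φ h)
    {N N' : ℕ} (r : Fin N' → invariants (action (N := N) (α.comp φ))) :
    ∃ F : NormalRing H' A N' →ₐ[k] NormalRing H A N,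
      (∀ h b, F (action (α.comp φ') (j h) b) = action (α.comp φ) h (F b)) ∧
      ∀ i, F (y i) = r i := by
  obtain ⟨F, h1, h2, h3⟩ : ∃ F : NormalRing H' A N' →ₐ[k] NormalRing H A N,
      (∀ a : A, F (algebraMap A _ a) = algebraMap A _ a) ∧
      (∀ h, F (x h) = Function.extend j x 0 h) ∧ ∀ i, F (y i) = r i :=
    ⟨liftAlg (IsScalarTower.toAlgHom k A (NormalRing H A N)) (Function.extend j x 0)
      (fun i => r i) (isUnit_conjDet_extend j hj isUnit_conjDet_x),
      liftAlg_algebraMap _ _ _ _, liftAlg_x _ _ _ _, liftAlg_y _ _ _ _⟩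
  refine ⟨F, fun h b => ?_, h3⟩
  have e : F.comp (action (N := N') (α.comp φ') (j h)) =
      (action (N := N) (α.comp φ) h).comp F := by
    refine algHom_ext (fun a => ?_) (fun h' => ?_) (fun i => ?_)
    · rw [AlgHom.comp_apply, AlgHom.comp_apply, action_algebraMap, h1, h1, action_algebraMap,
        MonoidHom.comp_apply, MonoidHom.comp_apply, hφ]
    · rw [AlgHom.comp_apply, AlgHom.comp_apply, action_x, h2, h2]
      by_cases hh : h' ∈ Set.range j
      · obtain ⟨h', rfl⟩ := hh
        rw [← map_mul, hj.extend_apply, hj.extend_apply, action_x]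
      · rw [Function.extend_apply' _ _ _ hh, Function.extend_apply', Pi.zero_apply,
          Pi.zero_apply, map_zero]
        rintro ⟨y, hy⟩
        exact hh ⟨h⁻¹ * y, by rw [map_mul, hy, map_inv, inv_mul_cancel_left]⟩
    · rw [AlgHom.comp_apply, AlgHom.comp_apply, action_y, h3]
      exact ((r i).2 h).symm
  exact DFunLike.congr_fun e b

/-- With sufficiently many additional coordinates, the ring of invariants of `H'` maps onto the ring
of invariants of `H`: the additional coordinates are mapped to generators of the latter. -/
theorem NormalRing.exists_surjective_invariants {A : Type*} [CommRing A] [Algebra k A]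
    [Algebra.FiniteType k A] (α : G →* (A →ₐ[k] A)) (j : H →* H') (hj : Function.Injective j)
    (hφ : ∀ h, φ' (j h) = φ h) (N : ℕ) :
    ∃ (N' : ℕ) (f : invariants (action (N := N') (α.comp φ')) →ₐ[k]
      invariants (action (N := N) (α.comp φ))), Function.Surjective f := by
  obtain ⟨N', g, hg⟩ := Algebra.FiniteType.iff_quotient_mvPolynomial''.1
    (finiteType_invariants (N := N) (α.comp φ))
  obtain ⟨F, hF, hFy⟩ := exists_equivariant α j hj hφ fun i => g (MvPolynomial.X i)
  have hF' : ∀ b : invariants (action (N := N') (α.comp φ')),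
      F b ∈ invariants (action (N := N) (α.comp φ)) := fun b h =>
    (hF h b).symm.trans (congrArg F (b.2 (j h)))
  exact ⟨N', (F.comp (invariants _).val).codRestrict (invariants _) hF',
    surjective_of_generators hg _ (fun i => ⟨y i, fun h => action_y _ h i⟩)
      fun i => Subtype.ext (hFy i)⟩

theorem exists_surjective_liftRing (hp : IsOpen (p.ker : Set (Gal k))) (j : H →* H')
    (hj : Function.Injective j) (hφ : ∀ h, φ' (j h) = φ h) :
    ∃ (N' : ℕ) (f : LiftRing p φ' N' →ₐ[k] LiftRing p φ N), Function.Surjective f :=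
  have := torsorAlgebra_smooth hp
  NormalRing.exists_surjective_invariants (torsorAlgebra.action p) j hj hφ N

theorem exists_isClosedImmersion (hp : IsOpen (p.ker : Set (Gal k))) (j : H →* H')
    (hj : Function.Injective j) (hφ : ∀ h, φ' (j h) = φ h) :
    ∃ (N' : ℕ) (f : liftVariety p φ N ⟶ liftVariety p φ' N'), IsClosedImmersion f.left := by
  obtain ⟨N', f, hf⟩ := exists_surjective_liftRing N hp j hj hφ
  refine ⟨N', Over.homMk
    (Spec.map (CommRingCat.ofHom (f : LiftRing p φ' N' →+* LiftRing p φ N))) ?_,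
    IsClosedImmersion.spec_of_surjective _ hf⟩
  change Spec.map (CommRingCat.ofHom _) ≫ Spec.map (CommRingCat.ofHom _) =
    Spec.map (CommRingCat.ofHom _)
  refine (Spec.map_comp _ _).symm.trans (congrArg Spec.map
    (CommRingCat.hom_ext (RingHom.ext fun x => ?_)))
  exact f.commutes x

/-- A sequence of injective homomorphisms over `G` gives rise to a sequence of closed embeddings. -/
theorem exists_sequence_liftVariety (hp : IsOpen (p.ker : Set (Gal k))) (H : ℕ → Type)
    [∀ m, Group (H m)] [∀ m, Finite (H m)] (φ : ∀ m, H m →* G)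
    (j : ∀ m, H m →* H (m + 1)) (hj : ∀ m, Function.Injective (j m))
    (hφ : ∀ m h, φ (m + 1) (j m h) = φ m h) :
    ∃ N : ℕ → ℕ, ∀ m, ∃ f : liftVariety p (φ m) (N m) ⟶ liftVariety p (φ (m + 1)) (N (m + 1)),
      IsClosedImmersion f.left := by
  choose N' hN' using fun m N => exists_isClosedImmersion N hp (j m) (hj m) (hφ m)
  let N : ℕ → ℕ := fun m => Nat.rec 0 (fun m N => N' m N) m
  exact ⟨N, fun m => hN' m (N m)⟩

end Embedding

end LiftingVariety

/-! ### The lifting varieties of an exact sequence -/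

section Extend

variable {R M N : Type*} [CommRing R] [AddCommGroup M] [Module R M] [AddCommGroup N] [Module R N]
  (ι : M →ₗ[R] N) (π : N →ₗ[R] M) (h : ∀ x, π (ι x) = x)

/-- For a direct summand `M` of `N`, with inclusion `ι` and retraction `π`, the extension of the
endomorphisms of `M` to `N` by the identity of the complement `ker π`. -/
def extendEnd : Module.End R M →* Module.End R N where
  toFun := fun β => ι ∘ₗ β ∘ₗ π + (LinearMap.id - ι ∘ₗ π)
  map_one' := by ext x; simp
  map_mul' := fun β γ => by ext x; simp [h]

/-- The extension of the automorphisms of a direct summand `M` of `N` by the identity of the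
complement. -/
def extendAut : (M ≃ₗ[R] M) →* (N ≃ₗ[R] N) :=
  ((LinearMap.GeneralLinearGroup.generalLinearEquiv R N).toMonoidHom.comp
    (Units.map (extendEnd ι π h))).comp
      (LinearMap.GeneralLinearGroup.generalLinearEquiv R M).symm.toMonoidHom

theorem extendAut_apply (β : M ≃ₗ[R] M) (x : N) :
    extendAut ι π h β x = ι (β (π x)) + (x - ι (π x)) := rfl

theorem extendAut_apply_incl (β : M ≃ₗ[R] M) (x : M) : extendAut ι π h β (ι x) = ι (β x) := by
  rw [extendAut_apply, h, sub_self, add_zero]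

end Extend

section Succ

variable {d n a b m : ℕ} [NeZero d] {hn : 2 ≤ n}

/-- The retraction of the inclusion of the standard free extension of parameter `m` in the one of
parameter `m + 1`. -/
def stdRetr (d n a b m : ℕ) [NeZero d] (hn : 2 ≤ n) (i : ℕ) :
    (std d n a b (m + 1) hn).X i →ₗ[ZMod d] (std d n a b m hn).X i :=
  LinearMap.prodMap (LinearMap.funLeft (ZMod d) (ZMod d) (Fin.castLE (stdRank_le i)))
    (LinearMap.funLeft (ZMod d) (ZMod d) (Fin.castLE (stdRank_le (i + 1))))

theorem funLeft_extendZero {r s : ℕ} (h : r ≤ s) (x : Fin r → ZMod d) :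
    LinearMap.funLeft (ZMod d) (ZMod d) (Fin.castLE h) (extendZero d r s x) = x := by
  ext j
  simp [extendZero, LinearMap.funLeft_apply]

theorem stdRetr_stdIncl (i : ℕ) (x : (std d n a b m hn).X i) :
    stdRetr d n a b m hn i (stdIncl d n a b m hn i x) = x :=
  Prod.ext (funLeft_extendZero _ _) (funLeft_extendZero _ _)

theorem stdIncl_injective (i : ℕ) : Function.Injective (stdIncl d n a b m hn i) :=
  Function.LeftInverse.injective (stdRetr_stdIncl i)

theorem stdIncl_f (i : ℕ) (x : (std d n a b m hn).X i) :
    stdIncl d n a b m hn (i + 1) ((std d n a b m hn).f i x) =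
      (std d n a b (m + 1) hn).f i (stdIncl d n a b m hn i x) :=
  Prod.ext rfl (map_zero (extendZero d _ _))

theorem stdRetr_f (i : ℕ) (x : (std d n a b (m + 1) hn).X i) :
    stdRetr d n a b m hn (i + 1) ((std d n a b (m + 1) hn).f i x) =
      (std d n a b m hn).f i (stdRetr d n a b m hn i x) := rfl

/-- The extension of automorphisms along the inclusion of standard free extensions. -/
def stdAutSucc : (std d n a b m hn).Aut →* (std d n a b (m + 1) hn).Aut :=
  ((MonoidHom.pi fun i => (extendAut (stdIncl d n a b m hn i) (stdRetr d n a b m hn i)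
    (stdRetr_stdIncl i)).comp (Pi.evalMonoidHom _ i)).comp (Subgroup.subtype _)).codRestrict _
    fun β i x => by
      change (std d n a b (m + 1) hn).f i (extendAut _ _ (stdRetr_stdIncl i) (β.1 i) x) =
        extendAut _ _ (stdRetr_stdIncl (i + 1)) (β.1 (i + 1)) ((std d n a b (m + 1) hn).f i x)
      rw [extendAut_apply, extendAut_apply, map_add, map_sub, stdRetr_f, ← stdIncl_f, ← stdIncl_f,
        β.2]

theorem stdAutSucc_stdIncl (β : (std d n a b m hn).Aut) (i : ℕ) (x : (std d n a b m hn).X i) :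
    (stdAutSucc β).1 i (stdIncl d n a b m hn i x) = stdIncl d n a b m hn i (β.1 i x) :=
  extendAut_apply_incl _ _ _ _ _

theorem stdAutSucc_injective :
    Function.Injective (stdAutSucc : (std d n a b m hn).Aut → (std d n a b (m + 1) hn).Aut) := by
  intro β β' h
  refine Subtype.ext (funext fun i => LinearEquiv.ext fun x => stdIncl_injective i ?_)
  rw [← stdAutSucc_stdIncl, h, stdAutSucc_stdIncl]

variable {E : ExactSeq d (n + 1)} (D : Diagram E (std d n a b m hn))

/-- The extension of the automorphisms of a diagram to the next standard free extension. -/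
def Diagram.autSucc : D.Aut →* D.succ.Aut :=
  (((MonoidHom.id E.Aut).prodMap stdAutSucc).comp (Subgroup.subtype _)).codRestrict _
    fun p i x => by
      change stdIncl d n a b m hn i (D.φ i (p.1.1.1 i x)) =
        (stdAutSucc p.1.2).1 i (stdIncl d n a b m hn i (D.φ i x))
      rw [stdAutSucc_stdIncl, p.2]

theorem Diagram.autSucc_injective : Function.Injective D.autSucc := fun _ _ h =>
  Subtype.ext (Prod.ext (congrArg (fun q => q.1.1) h)
    (stdAutSucc_injective (congrArg (fun q => q.1.2) h)))

end Succ

section System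

variable {k : Type u} [Field k] {d n : ℕ} [NeZero d]

theorem GalExactSeq.isOpen_ker_toAut {Γ : Type u} [Group Γ] [TopologicalSpace Γ]
    [IsTopologicalGroup Γ] {N : ℕ} (E : GalExactSeq Γ d N) : IsOpen (E.toAut.ker : Set Γ) := by
  refine Subgroup.isOpen_of_mem_nhds _ (g := 1) (Filter.mem_of_superset
    (x := ⋂ i : Fin (N + 1), {γ | ∀ x, E.ρ i γ x = x}) (IsOpen.mem_nhds ?_ ?_) ?_)
  · exact isOpen_iInter_of_finite fun i : Fin (N + 1) => (E.term i).isOpen_ker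
  · exact Set.mem_iInter.2 fun i : Fin (N + 1) => (E.term i).ρ_one_apply
  · intro γ h1
    refine Subtype.ext (funext fun i => LinearEquiv.ext fun x => ?_)
    by_cases hi : i < N + 1
    · exact Set.mem_iInter.1 h1 ⟨i, hi⟩ x
    · exact (E.subsingleton i (by omega)).elim _ _

/-- For `m` varying, the lifting varieties of the surjections `Aut(D_m) → Aut(E)` form an
ind-variety, which has a point over `l` if and only if `E` comes from a shorter sequence
over `l`. -/
theorem exists_liftingSystem (hn : 3 ≤ n) (E : GalExactSeq (Gal k) d (n + 1))
    (h0 : Module.Free (ZMod d) (E.X 0)) (hE : Module.Free (ZMod d) (E.X n)) :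
    ∃ X : ℕ → Over (Spec (.of k)), IsSmoothIndVariety X ∧
      (∀ (l : Type u) [Field l] [Algebra k l] [Infinite l]
        (ι : SeparableClosure k →ₐ[k] SeparableClosure l),
        IsShortenable (E.res (galRes ι)) ↔ ∃ m, Nonempty (Points (X m) l)) ∧
      IsLiftingSystem (Nat.le_of_succ_le hn) E X := by
  obtain ⟨b, ⟨e₀⟩⟩ := exists_equiv_fin (d := d) (E.X 0)
  obtain ⟨a, ⟨eₙ⟩⟩ := exists_equiv_fin (d := d) (E.X n)
  obtain ⟨m₀, hm₀⟩ := exists_diagram_std (hn := Nat.le_of_succ_le hn) hn E.toExactSeq e₀ eₙ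
  obtain ⟨D₀, hD₀⟩ := hm₀ m₀ le_rfl
  let D : ∀ m, Diagram E.toExactSeq (std d n a b (m₀ + m) (Nat.le_of_succ_le hn)) :=
    fun m => Nat.rec D₀ (fun _ D => D.succ) m
  have hD : ∀ m, (D m).IsInjective := fun m => by
    induction m with
    | zero => exact hD₀
    | succ m ih => exact Diagram.succ_isInjective ih
  have hsurj : ∀ m, Function.Surjective (D m).autHom := fun m => (D m).autHom_surjective (hD m)
  have hp : IsOpen (E.toAut.ker : Set (Gal k)) := E.isOpen_ker_toAut
  obtain ⟨N, hN⟩ := exists_sequence_liftVariety hp (fun m => (D m).Aut) (fun m => (D m).autHom)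
    (fun m => (D m).autSucc) (fun m => (D m).autSucc_injective) fun _ _ => rfl
  have hX : ∀ m, IsLiftingVariety (D m).autHom (torsorOfHom E.toAut)
      (liftVariety E.toAut (D m).autHom (N m)) := fun m =>
    isLiftingVariety_liftVariety (N m) hp (hsurj m)
  refine ⟨fun m => liftVariety E.toAut (D m).autHom (N m),
    ⟨fun m => isVariety_liftVariety (N m) hp, fun m => smooth_liftVariety (N m) hp,
      fun m => (hX m).geometricallyIntegral, hN⟩, ?_,
    hE, a, b, m₀, D, hD, fun _ _ _ => rfl, fun F D' hD' => ⟨0, D'.hasHom_std hD' (D 0)⟩, hsurj, hX⟩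
  intro l _ _ _ ι
  rw [isShortenable_iff_exists_lift hn (E.res (galRes ι)) e₀ m₀ D hD]
  refine exists_congr fun m => ?_
  rw [nonempty_points_liftVariety_iff (N m) hp (hsurj m) ι]
  exact exists_congr fun q => and_congr_right fun _ => DFunLike.ext_iff

end System

end YonedaSplitting

end

theorem mainTheorem2 (k : Type u) [Field k] (d n : ℕ) [NeZero d] (hd : (d : k) ≠ 0) (hn : 3 ≤ n)
    (A B : GalMod (Gal k) d)
    (hAB : Module.Free (ZMod d) A.V ∨ Module.Free (ZMod d) B.V)
    (e : YExt n A B) :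
    ∃ X : ℕ → CategoryTheory.Over (AlgebraicGeometry.Spec (.of k)),
      IsSmoothIndVariety X ∧ IsSplittingFamily e X ∧
      ∃ E : YExtension n A B, E.cls = e ∧
        (Module.Free (ZMod d) B.V →
          IsLiftingSystem (Nat.le_of_succ_le hn) E.toGalExactSeq X) ∧
        (¬ Module.Free (ZMod d) B.V →
          ∃ E' : GalExactSeq (Gal k) d (n + 1), E.toGalExactSeq.IsPontryaginDual E' ∧
            IsLiftingSystem (Nat.le_of_succ_le hn) E' X) := by
  have h2 : 2 ≤ n := Nat.le_of_succ_le hn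
  obtain ⟨E₀, rfl⟩ := Quot.exists_rep e
  by_cases hB : Module.Free (ZMod d) B.V
  · -- `B` is free: the representative is only modified to have a free term in position `n`
    obtain ⟨E', u, hu0, hu1, hfree⟩ := exists_free_last h2 E₀.toGalExactSeq
    let E := E₀.comap u hu0 hu1
    obtain ⟨X, hX, hpt, hsys⟩ := exists_liftingSystem hn E' (Module.Free.of_equiv E.left) hfree
    have hE : E.cls = E₀.cls := E₀.cls_comap u hu0 hu1
    refine ⟨X, hX, fun l _ _ _ ι => ?_, E, hE, fun _ => hsys, fun h => absurd hB h⟩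
    exact (iff_of_eq (congrArg (fun e => (e.res (galRes ι)).IsZero) hE.symm)).trans
      (((E.res (galRes ι)).isZero_cls_iff h2).trans (hpt l ι))
  · -- `B` is not free, so that `A` is: the construction is applied to the dual sequence
    have hA : Module.Free (ZMod d) A.V := hAB.resolve_right hB
    obtain ⟨E', u, hu0, hu1, hfree⟩ := exists_free_last h2 E₀.dual
    -- the dual of the `E'` represents the class, as the bidual of `E₀` is `E₀`
    let w : SeqHom E₀.toGalExactSeq E'.dual := u.dual.comp (SeqHom.evalDual E₀.toGalExactSeq)
    have hw0 : Function.Bijective (w.φ 0) :=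
      (u.dual_bijective (zero_add (n + 1)) hu1).comp (SeqHom.evalDual_bijective _ 0)
    have hw1 : Function.Bijective (w.φ (n + 1)) :=
      (u.dual_bijective (add_zero (n + 1)) hu0).comp (SeqHom.evalDual_bijective _ (n + 1))
    let E := E₀.map w hw0 hw1
    -- `E'` starts with the dual of `A`
    have h0 : Module.Free (ZMod d) (E'.X 0) := by
      have hlast : Module.Free (ZMod d) (E₀.X (n + 1)) := Module.Free.of_equiv E₀.right.symm
      have : Module.Finite (ZMod d) (E₀.X (n + 1)) := Module.Finite.of_finite
      let : Unique {j // 0 + j = n + 1} := ⟨⟨⟨n + 1, zero_add _⟩⟩, fun j =>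
        Subtype.ext ((zero_add _).symm.trans j.2)⟩
      let e : (∀ j : {j // 0 + j = n + 1}, E₀.X j.1 →ₗ[ZMod d] ZMod d) ≃ₗ[ZMod d]
          (E₀.X (n + 1) →ₗ[ZMod d] ZMod d) := LinearEquiv.piUnique (ZMod d) _
      exact Module.Free.of_equiv (e.symm.trans (LinearEquiv.ofBijective (u.φ 0) hu0).symm)
    obtain ⟨X, hX, hpt, hsys⟩ := exists_liftingSystem hn E' h0 hfree
    have hE : E.cls = E₀.cls := E₀.cls_map w hw0 hw1
    refine ⟨X, hX, fun l _ _ _ ι => ?_, E, hE, fun h => absurd h hB, fun _ =>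
      ⟨E', E'.isPontryaginDual_dual, hsys⟩⟩
    exact (iff_of_eq (congrArg (fun e => (e.res (galRes ι)).IsZero) hE.symm)).trans
      (((E.res (galRes ι)).isZero_cls_iff h2).trans
        ((isShortenable_res_dual_iff h2 (galRes ι)).trans (hpt l ι)))
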